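/- Let $q$ be a prime power. An $O^+(8,q)$-space is an $8$-dimensional $\mathbb F_q$-space $V$ with a quadratic form $Q$ whose polar form is nondegenerate and which vanishes on some $4$-dimensional subspace; an $Sp(8,q)$-space is an $8$-dimensional $\mathbb F_q$-space with a nondegenerate alternating form. A subspace is totally singular (t.s.) if $Q$ vanishes on it, and totally isotropic (t.i.) if the bilinear form vanishes on it; a singular point is a t.s. $1$-space; $\perp$ refers to the polar form. An ovoid of $V$ is a set of singular points meeting every maximal t.s. subspace in exactly one member. An orthogonal (resp. symplectic) partial spread is a set of t.s. (resp. t.i.) $4$-spaces, any two of which meet only in $0$; "maximal" refers to inclusion. Two t.s. $4$-spaces have the same type if their intersection has even dimension (there are two types), and two t.s. $4$-spaces are incident if they are equal or meet in a $3$-space; other incidences are containments. A triality map of $V$ is an incidence-preserving permutation of the t.s. points, lines and $4$-spaces that cyclically permutes the set of singular points, the t.s. $4$-spaces of one type, and the t.s. $4$-spaces of the other type. **Theorem.** (i) Every $O^+(8,q)$-space has a triality map. If $q>2$, let $\tau$ be any triality map of an $O^+(8,q)$-space $V$, let $\Omega$ be an ovoid of $V$, and let $a\notin\Omega$ be a singular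 point that is the only singular point in $\langle a^\perp\cap\Omega\rangle^\perp$. Put $\Omega^\bullet=(\Omega\setminus(a^\perp\cap\Omega))\cup\{a\}$. Then $\Sigma^\bullet=(\Omega^\bullet)^\tau$ is a maximal orthogonal partial spread of $V$ of size $q^3-q^2+1$. If moreover $q$ is even, then $\Sigma^\bullet$ is also a maximal symplectic partial spread of $V$ with respect to the polar form of $Q$. (ii) If $q>2$ is even, then every $O^+(8,q)$-space $V$ has such $\tau$, $\Omega$ and $a$, with $\Omega$ a desarguesian ovoid; so $(\Omega^\bullet)^\tau$ is a maximal orthogonal and a maximal symplectic partial spread of $V$ of size $q^3-q^2+1$. Here a desarguesian ovoid is the image, under an isometry onto $V$, of the set of points $\langle(0,0,0,1)\rangle$ and $\langle(1,t,t^{q+q^2},N(t))\rangle$, $t\in F=\mathbb F_{q^3}$, of the $\mathbb F_q$-space $\mathbb F_q\oplus F\oplus F\oplus\mathbb F_q$ with quadratic form $ad+T(\beta\gamma)$ at $(a,\beta,\gamma,d)$, where $T$ and $N$ are the trace and norm $F\to\mathbb F_q$. (iii) For every even $q$ (including $q=2$), every $Sp(8,q)$-space has a maximal symplectic partial spread of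 size $q^3-q^2+1$. -/

import Mathlib

namespace PolarSpread

universe u v w

section General

variable {K : Type u} [Field K] {V : Type v} [AddCommGroup V] [Module K V]

/-- A subspace is totally singular (t.s.) if the quadratic form vanishes on it. -/
def IsTotallySingular (Q : QuadraticForm K V) (W : Submodule K V) : Prop :=
  ∀ x ∈ W, Q x = 0

/-- A subspace is totally isotropic (t.i.) if the bilinear form vanishes on it. -/
def IsTotallyIsotropic (B : LinearMap.BilinForm K V) (W : Submodule K V) : Prop :=
  ∀ x ∈ W, ∀ y ∈ W, B x y = 0

/-- `(V, Q)` is an `O⁺(2n, q)`-space: a nonsingular quadratic space of dimension `2n`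
(the polar form is nondegenerate) that has a totally singular subspace of dimension `n`. -/
structure IsOPlusSpace (n : ℕ) (Q : QuadraticForm K V) : Prop where
  finrank_eq : Module.finrank K V = 2 * n
  nondegenerate : LinearMap.BilinForm.Nondegenerate Q.polarBilin
  exists_totallySingular : ∃ W : Submodule K V, IsTotallySingular Q W ∧ Module.finrank K W = n

/-- `(V, B)` is an `Sp(2n, q)`-space. -/
structure IsSpSpace (n : ℕ) (B : LinearMap.BilinForm K V) : Prop where
  finrank_eq : Module.finrank K V = 2 * n
  isAlt : B.IsAlt
  nondegenerate : LinearMap.BilinForm.Nondegenerate B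

/-- A singular point: a one-dimensional totally singular subspace. -/
def IsSingularPoint (Q : QuadraticForm K V) (p : Submodule K V) : Prop :=
  IsTotallySingular Q p ∧ Module.finrank K p = 1

/-- The subspace `W^⊥`, with respect to the polar form of `Q`. -/
def perp (Q : QuadraticForm K V) (W : Submodule K V) : Submodule K V :=
  LinearMap.BilinForm.orthogonal Q.polarBilin W

/-- A partial ovoid: a set of singular points such that every maximal totally singular
subspace contains at most one of them. -/
def IsPartialOvoid (Q : QuadraticForm K V) (Ω : Set (Submodule K V)) : Prop :=
  (∀ p ∈ Ω, IsSingularPoint Q p) ∧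
    ∀ W : Submodule K V, Maximal (IsTotallySingular Q) W →
      ∀ p ∈ Ω, ∀ p' ∈ Ω, p ≤ W → p' ≤ W → p = p'

/-- An ovoid: a partial ovoid that meets every maximal totally singular subspace. -/
def IsOvoid (Q : QuadraticForm K V) (Ω : Set (Submodule K V)) : Prop :=
  IsPartialOvoid Q Ω ∧
    ∀ W : Submodule K V, Maximal (IsTotallySingular Q) W → ∃ p ∈ Ω, p ≤ W

/-- A partial spread of a `2n`-dimensional space: a set of `n`-dimensional subspaces, any two of
which have only `0` in common. -/
def IsPartialSpread (n : ℕ) (S : Set (Submodule K V)) : Prop :=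
  (∀ W ∈ S, Module.finrank K W = n) ∧ ∀ W ∈ S, ∀ U ∈ S, W ≠ U → W ⊓ U = ⊥

/-- An orthogonal partial spread: a partial spread of totally singular subspaces. -/
def IsOrthogonalPartialSpread (n : ℕ) (Q : QuadraticForm K V) (S : Set (Submodule K V)) : Prop :=
  IsPartialSpread n S ∧ ∀ W ∈ S, IsTotallySingular Q W

/-- A symplectic partial spread: a partial spread of totally isotropic subspaces. -/
def IsSymplecticPartialSpread (n : ℕ) (B : LinearMap.BilinForm K V)
    (S : Set (Submodule K V)) : Prop :=
  IsPartialSpread n S ∧ ∀ W ∈ S, IsTotallyIsotropic B W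

/-- The set `a^⊥ ∩ Ω` of members of `Ω` that are perpendicular to `a`. -/
def perpInter (Q : QuadraticForm K V) (Ω : Set (Submodule K V)) (a : Submodule K V) :
    Set (Submodule K V) :=
  {p ∈ Ω | p ≤ perp Q a}

/-- `a` is a singular point not in `Ω`, and it is the only singular point of
`⟨a^⊥ ∩ Ω⟩^⊥`. -/
structure IsExchangePoint (Q : QuadraticForm K V) (Ω : Set (Submodule K V))
    (a : Submodule K V) : Prop where
  isSingularPoint : IsSingularPoint Q a
  notMem : a ∉ Ω
  unique : ∀ b : Submodule K V, IsSingularPoint Q b →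
    b ≤ perp Q (sSup (perpInter Q Ω a)) → b = a

/-- `Ω^• = (Ω - (a^⊥ ∩ Ω)) ∪ {a}`. -/
def exchange (Q : QuadraticForm K V) (Ω : Set (Submodule K V)) (a : Submodule K V) :
    Set (Submodule K V) :=
  (Ω \ perpInter Q Ω a) ∪ {a}

/-! ### Triality -/

/-- The elements of the triality geometry of an `O⁺(8, q)`-space: the totally singular
points, lines and solids (subspaces of dimension 1, 2 and 4). -/
def Element (Q : QuadraticForm K V) : Type v :=
  {W : Submodule K V // IsTotallySingular Q W ∧
    (Module.finrank K W = 1 ∨ Module.finrank K W = 2 ∨ Module.finrank K W = 4)}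

/-- The dimension of an element. -/
noncomputable def Element.dim {Q : QuadraticForm K V} (x : Element Q) : ℕ :=
  Module.finrank K x.1

/-- Incidence of elements: containment or, for two solids, meeting in a subspace of
dimension 3. -/
def Element.Incident {Q : QuadraticForm K V} (x y : Element Q) : Prop :=
  x.1 ≤ y.1 ∨ y.1 ≤ x.1 ∨
    (x.dim = 4 ∧ y.dim = 4 ∧ Module.finrank K (x.1 ⊓ y.1 : Submodule K V) = 3)

/-- Two totally singular `n`-dimensional subspaces of an `O⁺(2n, q)`-space have the same type if
the dimension of their intersection is congruent to `n` modulo 2. -/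
def SameType (n : ℕ) (W U : Submodule K V) : Prop :=
  Module.finrank K (W ⊓ U : Submodule K V) ≡ n [MOD 2]

/-- A triality map of an `O⁺(8, q)`-space: a permutation of the totally singular points, lines and
solids that preserves incidence and permutes cyclically the singular points, the solids
of one type (that of `M`) and the solids of the other type (so lines go to lines). -/
structure Triality (Q : QuadraticForm K V) where
  toPerm : Equiv.Perm (Element Q)
  incident_iff : ∀ x y : Element Q, (toPerm x).Incident (toPerm y) ↔ x.Incident y
  type_rotation : ∃ M : Element Q, M.dim = 4 ∧ ∀ x : Element Q,
    (x.dim = 1 ↔ (toPerm x).dim = 4 ∧ SameType 4 M.1 (toPerm x).1) ∧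
    ((x.dim = 4 ∧ SameType 4 M.1 x.1) ↔
      (toPerm x).dim = 4 ∧ ¬ SameType 4 M.1 (toPerm x).1) ∧
    ((x.dim = 4 ∧ ¬ SameType 4 M.1 x.1) ↔ (toPerm x).dim = 1)

/-- The image under a triality map of a set of totally singular subspaces. -/
def Triality.image {Q : QuadraticForm K V} (τ : Triality Q) (Ω : Set (Submodule K V)) :
    Set (Submodule K V) :=
  {W | ∃ x : Element Q, x.1 ∈ Ω ∧ (τ.toPerm x).1 = W}

end General

/-! ### The desarguesian ovoid -/

section Desarguesian

variable (K : Type u) [Field K] (F : Type w) [Field F] [Algebra K F]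

/-- The quadratic form `Q(a, β, γ, d) = a d + T(β γ)` on `K ⊕ F ⊕ F ⊕ K`. -/
noncomputable def desarguesianForm : QuadraticForm K (K × F × F × K) :=
  QuadraticMap.linMulLin (LinearMap.fst K K (F × F × K))
      (LinearMap.snd K F K ∘ₗ LinearMap.snd K F (F × K) ∘ₗ LinearMap.snd K K (F × F × K)) +
    (Algebra.trace K F).compQuadraticMap
      (QuadraticMap.linMulLin
        (LinearMap.fst K F (F × K) ∘ₗ LinearMap.snd K K (F × F × K))
        (LinearMap.fst K F K ∘ₗ LinearMap.snd K F (F × K) ∘ₗ LinearMap.snd K K (F × F × K)))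

theorem desarguesianForm_apply (a d : K) (β γ : F) :
    desarguesianForm K F (a, β, γ, d) = a * d + Algebra.trace K F (β * γ) := by
  simp [desarguesianForm]

/-- The points `⟨(0, 0, 0, 1)⟩` and `⟨(1, t, t^(q + q²), N(t))⟩` for `t ∈ F`, where `q = |K|`. -/
noncomputable def desarguesianPoints : Set (Submodule K (K × F × F × K)) :=
  {Submodule.span K {((0 : K), (0 : F), (0 : F), (1 : K))}} ∪
    Set.range fun t : F => Submodule.span K
      {((1 : K), t, t ^ (Nat.card K + Nat.card K ^ 2), Algebra.norm K t)}

variable {K} {V : Type v} [AddCommGroup V] [Module K V]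

/-- `Ω` is a desarguesian ovoid of `(V, Q)`: for a cubic extension `F` of `K`, it is the image
of the set of points above under an isometry from `K ⊕ F ⊕ F ⊕ K` to `V`. -/
def IsDesarguesianOvoid (Q : QuadraticForm K V) (Ω : Set (Submodule K V)) : Prop :=
  ∃ (F : Type u) (_ : Field F) (_ : Algebra K F),
    Module.finrank K F = 3 ∧
      ∃ e : (desarguesianForm K F).IsometryEquiv Q,
        Ω = Submodule.map (e.toLinearEquiv : (K × F × F × K) →ₗ[K] V) '' desarguesianPoints K F

end Desarguesian

end PolarSpread

/-! Triality converts statements about points into statements about solids of one type. Distinct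
perpendicular singular points span a line, and the image of that line is the intersection of the two
image solids. Conversely, image solids that meet nontrivially come from perpendicular points
(`Triality.RotatesFrom.finrank_inf`, `Triality.RotatesFrom.perp_of_inf_ne_bot`). So an ovoid becomes
a family of pairwise disjoint solids covering every singular vector (`IsOvoid.exists_mem_image`).
Counting vectors gives `q³ + 1` members, of which `q² + 1` are perpendicular to a point `a` outside
the ovoid. This yields the size of the exchanged set.

Maximality is `not_disjoint_image_exchange`. A t.s. solid of the other type meets the image of `a`
in odd dimension. A solid of the right type is the image of a point `b`, and if it is disjoint from
the whole family, then `b` is perpendicular to no point of the exchanged set. Hence `b^⊥ ∩ Ω ⊆ a^⊥ ∩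
Ω`; equal cardinalities force equality, and the uniqueness of `a` gives `b = a`, which is absurd. In
characteristic two a t.i. solid contains a t.s. 3-space, which lies in a t.s. solid of the right
type. Parity of intersection dimensions shows that disjointness passes to this solid, so symplectic
maximality follows from the orthogonal argument (`maximal_symplectic_image_exchange`).

Triality maps come from symmetric composition algebras, here the para-octonions: for singular `x`,
left and right multiplication by `x` have 4-dimensional t.s. kernels, these kernels are all the
solids of the two types, and the mixed incidences between points and solids are equations `y x = 0`
(`IsSymmetricComposition.nonempty_triality`).

For even `q`, the points of the desarguesian set are pairwise nonperpendicular because the polar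
form takes the value `N(s + t)` on them, and `q³ + 1` such points are always an ovoid
(`isOvoid_of_ncard`). The exchange point is `⟨(0, β, 0, 0)⟩` for any `β` spanning the
trace-orthogonal of `⟨1, θ⟩`, where `θ` generates the cubic extension; its uniqueness uses a scalar
different from `0` and `1`, hence `q > 2`. For `q = 2` five explicit solids, four of them graphs of
symmetric matrices, are maximal (`IsSpSpace.exists_maximal_of_card_two`). -/

namespace PolarSpread

open Module Submodule

universe u v w

/-! ### Totally singular subspaces: Witt index, adjacency and the two types. -/

section SingularSubspaces

variable {K : Type u} [Field K] {V : Type v} [AddCommGroup V] [Module K V]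
  {Q : QuadraticForm K V} {W U X : Submodule K V} {n : ℕ}

theorem map_add_polar (Q : QuadraticForm K V) (x y : V) :
    Q (x + y) = Q x + Q y + Q.polarBilin x y := by
  simp [QuadraticMap.polar]

theorem polarBilin_comm (Q : QuadraticForm K V) (x y : V) :
    Q.polarBilin x y = Q.polarBilin y x := by
  simp [QuadraticMap.polar_comm]

theorem polarBilin_isRefl (Q : QuadraticForm K V) : Q.polarBilin.IsRefl := by
  intro x y h
  rwa [polarBilin_comm]

theorem mem_perp {x : V} : x ∈ perp Q W ↔ ∀ y ∈ W, Q.polarBilin y x = 0 := Iff.rfl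

theorem mem_perp_span {x y : V} : x ∈ perp Q (span K {y}) ↔ Q.polarBilin y x = 0 := by
  rw [mem_perp]
  refine ⟨fun h => h y (mem_span_singleton_self y), fun h z hz => ?_⟩
  obtain ⟨c, rfl⟩ := mem_span_singleton.1 hz
  rw [map_smul, LinearMap.smul_apply, h, smul_zero]

theorem perp_anti (h : W ≤ U) : perp Q U ≤ perp Q W :=
  LinearMap.BilinForm.orthogonal_le h

theorem le_perp_comm : W ≤ perp Q U ↔ U ≤ perp Q W := by
  constructor <;> exact fun h x hx y hy => by
    rw [polarBilin_comm]; exact h hy x hx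

theorem perp_sup : perp Q (W ⊔ U) = perp Q W ⊓ perp Q U := by
  refine le_antisymm (le_inf (perp_anti le_sup_left) (perp_anti le_sup_right)) ?_
  rw [le_perp_comm, sup_le_iff]
  exact ⟨le_perp_comm.1 inf_le_left, le_perp_comm.1 inf_le_right⟩

theorem IsTotallySingular.mono (hU : IsTotallySingular Q U) (h : W ≤ U) :
    IsTotallySingular Q W := fun x hx => hU x (h hx)

theorem IsTotallySingular.polar_eq_zero (hW : IsTotallySingular Q W) {x y : V} (hx : x ∈ W)
    (hy : y ∈ W) : Q.polarBilin x y = 0 := by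
  have := map_add_polar Q x y
  rwa [hW _ hx, hW _ hy, hW _ (add_mem hx hy), zero_add, zero_add, eq_comm] at this

theorem IsTotallySingular.le_perp (hW : IsTotallySingular Q W) : W ≤ perp Q W :=
  fun _ hx _ hy => hW.polar_eq_zero hy hx

theorem IsTotallySingular.sup (hW : IsTotallySingular Q W) (hU : IsTotallySingular Q U)
    (h : U ≤ perp Q W) : IsTotallySingular Q (W ⊔ U) := by
  intro z hz
  obtain ⟨x, hx, y, hy, rfl⟩ := mem_sup.1 hz
  rw [map_add_polar, hW x hx, hU y hy, h hy x hx, zero_add, zero_add]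

theorem isTotallySingular_span_singleton {x : V} (hx : Q x = 0) :
    IsTotallySingular Q (span K {x}) := by
  intro y hy
  obtain ⟨c, rfl⟩ := mem_span_singleton.1 hy
  rw [QuadraticMap.map_smul, hx, smul_zero]

theorem isTotallySingular_bot : IsTotallySingular Q (⊥ : Submodule K V) := by
  intro x hx
  rw [(mem_bot K).1 hx, QuadraticMap.map_zero]

theorem isSingularPoint_iff {p : Submodule K V} :
    IsSingularPoint Q p ↔ ∃ x : V, x ≠ 0 ∧ Q x = 0 ∧ p = span K {x} := by
  constructor
  · rintro ⟨hs, hp⟩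
    obtain ⟨x, hx, hx0⟩ := finrank_eq_one_iff'.1 hp
    have hx0' : (x : V) ≠ 0 := fun h => hx (Subtype.ext h)
    refine ⟨x, hx0', hs _ x.2, le_antisymm (fun y hy => ?_) ?_⟩
    · obtain ⟨c, hc⟩ := hx0 ⟨y, hy⟩
      exact mem_span_singleton.2 ⟨c, congrArg Subtype.val hc⟩
    · rw [span_singleton_le_iff_mem]
      exact x.2
  · rintro ⟨x, hx, hQ, rfl⟩
    exact ⟨isTotallySingular_span_singleton hQ, finrank_span_singleton hx⟩

variable [FiniteDimensional K V]

theorem finrank_inf_add_finrank_sup (W U : Submodule K V) :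
    finrank K (W ⊓ U : Submodule K V) + finrank K (W ⊔ U : Submodule K V) =
      finrank K W + finrank K U := by
  rw [add_comm]
  exact finrank_sup_add_finrank_inf_eq W U

theorem IsOPlusSpace.finrank_perp (h : IsOPlusSpace n Q) (W : Submodule K V) :
    finrank K W + finrank K (perp Q W) = 2 * n := by
  have h1 := LinearMap.BilinForm.finrank_orthogonal h.nondegenerate W
  have h2 := finrank_le W
  rw [h.finrank_eq] at h1 h2
  unfold perp
  omega

theorem IsOPlusSpace.perp_perp (h : IsOPlusSpace n Q) (W : Submodule K V) :
    perp Q (perp Q W) = W :=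
  LinearMap.BilinForm.orthogonal_orthogonal h.nondegenerate (polarBilin_isRefl Q) W

theorem IsOPlusSpace.perp_inf (h : IsOPlusSpace n Q) (W U : Submodule K V) :
    perp Q (W ⊓ U) = perp Q W ⊔ perp Q U := by
  rw [← h.perp_perp (perp Q W ⊔ perp Q U), perp_sup, h.perp_perp, h.perp_perp]

theorem IsOPlusSpace.finrank_le (h : IsOPlusSpace n Q) (hW : IsTotallySingular Q W) :
    finrank K W ≤ n := by
  have h1 := h.finrank_perp W
  have h2 := finrank_mono hW.le_perp
  omega

theorem IsOPlusSpace.perp_eq_self (h : IsOPlusSpace n Q) (hW : IsTotallySingular Q W)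
    (hn : finrank K W = n) : perp Q W = W := by
  refine (eq_of_le_of_finrank_le hW.le_perp ?_).symm
  have h1 := h.finrank_perp W
  omega

/-- If `W` is maximal and `U` is a t.s. `n`-space, then `W + (U ∩ W^⊥)` is t.s., so `U ∩ W^⊥ ≤ W`.
Since `dim (U ∩ W^⊥) = n - dim W + dim (U ∩ W)`, this forces `dim W ≥ n`. -/
theorem IsOPlusSpace.maximal_iff (h : IsOPlusSpace n Q) :
    Maximal (IsTotallySingular Q) W ↔ IsTotallySingular Q W ∧ finrank K W = n := by
  constructor
  · intro hW
    refine ⟨hW.prop, ?_⟩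
    obtain ⟨U, hU, hUn⟩ := h.exists_totallySingular
    have h1 : U ⊓ perp Q W ≤ U ⊓ W := by
      have h2 : IsTotallySingular Q (W ⊔ (U ⊓ perp Q W)) :=
        hW.prop.sup (hU.mono inf_le_left) inf_le_right
      exact le_inf inf_le_left (le_trans le_sup_right (hW.le_of_ge h2 le_sup_left))
    have h2 := finrank_mono h1
    have h3 := finrank_inf_add_finrank_sup U (perp Q W)
    have h4 := h.finrank_perp W
    have h5 := h.finrank_perp (U ⊓ W)
    rw [h.perp_inf, h.perp_eq_self hU hUn] at h5
    have h6 := h.finrank_le hW.prop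
    omega
  · rintro ⟨hW, hn⟩
    refine ⟨hW, fun U hU hWU => ?_⟩
    rw [eq_of_le_of_finrank_le hWU (by rw [hn]; exact h.finrank_le hU)]

theorem exists_maximal_ge (hW : IsTotallySingular Q W) :
    ∃ U, W ≤ U ∧ Maximal (IsTotallySingular Q) U := by
  obtain ⟨U, ⟨h1, h2⟩, h3⟩ := (wellFounded_gt (α := Submodule K V)).has_min
    {U | W ≤ U ∧ IsTotallySingular Q U} ⟨W, le_rfl, hW⟩
  refine ⟨U, h1, h2, fun X hX hUX => ?_⟩
  by_contra hlt
  exact h3 X ⟨h1.trans hUX, hX⟩ (lt_of_le_not_ge hUX hlt)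

/-- If two maximal totally singular subspaces meet in a hyperplane, then any maximal
totally singular subspace through that hyperplane is one of them. -/
theorem IsOPlusSpace.eq_or_eq_of_inf_le (h : IsOPlusSpace n Q) (hU : IsTotallySingular Q U)
    (hX : IsTotallySingular Q X) (hW : IsTotallySingular Q W) (hUn : finrank K U = n)
    (hXn : finrank K X = n) (hWn : finrank K W = n)
    (hUX : finrank K (U ⊓ X : Submodule K V) + 1 = n) (hle : U ⊓ X ≤ W) : W = U ∨ W = X := by
  have hH := h.finrank_perp (U ⊓ X)
  rw [h.perp_inf, h.perp_eq_self hU hUn, h.perp_eq_self hX hXn] at hH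
  have hWle : W ≤ U ⊔ X := by
    have := perp_anti (Q := Q) hle
    rwa [h.perp_inf, h.perp_eq_self hU hUn, h.perp_eq_self hX hXn, h.perp_eq_self hW hWn] at this
  -- Modulo `H = U ⊓ X`, the space `H^⊥ = U ⊔ X` is a hyperbolic plane, whose only singular points
  -- come from `U` and `X`. Concretely, a singular `w = y + x` with `y ∈ U` and `x ∈ X` has `y ⊥ x`,
  -- so `x` is orthogonal to `H + ⟨y⟩ = U`, that is, `x ∈ U`.
  by_contra! hne
  obtain ⟨w, hw, hwU⟩ : ∃ w ∈ W, w ∉ U := by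
    by_contra! hc
    exact hne.1 (eq_of_le_of_finrank_eq hc (by omega))
  obtain ⟨y, hy, x, hx, hyx⟩ := mem_sup.1 (hWle hw)
  have hxU : x ∉ U := fun hc => hwU (hyx ▸ add_mem hy hc)
  have hyX : y ∉ X := by
    intro hc
    have hwX : w ∈ X := hyx ▸ add_mem hc hx
    have h1 : (U ⊓ X) ⊔ span K {w} ≤ W ⊓ X :=
      sup_le (le_inf hle inf_le_right) (by simp [hw, hwX])
    have h2 : U ⊓ X < (U ⊓ X) ⊔ span K {w} := by
      refine lt_of_le_of_ne le_sup_left fun hc => hwU ?_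
      have : w ∈ U ⊓ X := hc ▸ (le_sup_right (a := U ⊓ X) (mem_span_singleton_self w))
      exact this.1
    have h3 := finrank_lt_finrank_of_lt h2
    have h4 := finrank_mono h1
    have h5 : finrank K (W ⊓ X : Submodule K V) ≤ n := h.finrank_le (hW.mono inf_le_left)
    have h6 : W ⊓ X = W := eq_of_le_of_finrank_le inf_le_left (by omega)
    exact hne.2 (eq_of_le_of_finrank_eq (inf_eq_left.1 h6) (by omega))
  have hB : Q.polarBilin y x = 0 := by
    have := map_add_polar Q y x
    rwa [hyx, hW w hw, hU y hy, hX x hx, zero_add, zero_add, eq_comm] at this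
  have hlt : U ⊓ X < (U ⊓ X) ⊔ span K {y} := by
    refine lt_of_le_of_ne le_sup_left fun hc => hyX ?_
    have : y ∈ U ⊓ X := hc ▸ (le_sup_right (a := U ⊓ X) (mem_span_singleton_self y))
    exact this.2
  have hUeq : (U ⊓ X) ⊔ span K {y} = U :=
    eq_of_le_of_finrank_le (sup_le inf_le_left (by simpa using hy))
      (by have := finrank_lt_finrank_of_lt hlt; omega)
  refine hxU ?_
  rw [← h.perp_eq_self hU hUn, ← hUeq, perp_sup]
  exact ⟨fun z hz => hX.polar_eq_zero hz.2 hx, mem_perp_span.2 hB⟩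

/-- Maximal totally singular subspaces meeting in a hyperplane meet any other one in
dimensions of different parity. -/
theorem IsOPlusSpace.finrank_inf_adjacent (h : IsOPlusSpace n Q) (hU : IsTotallySingular Q U)
    (hX : IsTotallySingular Q X) (hW : IsTotallySingular Q W) (hUn : finrank K U = n)
    (hXn : finrank K X = n) (hWn : finrank K W = n)
    (hUX : finrank K (U ⊓ X : Submodule K V) + 1 = n) :
    finrank K (W ⊓ U : Submodule K V) = finrank K (W ⊓ X : Submodule K V) + 1 ∨
      finrank K (W ⊓ X : Submodule K V) = finrank K (W ⊓ U : Submodule K V) + 1 := by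
  set H := U ⊓ X with hHdef
  have hHs : IsTotallySingular Q H := hU.mono inf_le_left
  have d1 := h.finrank_perp H
  have d2 := finrank_inf_add_finrank_sup W (perp Q H)
  have d3 := h.finrank_perp (W ⊓ H)
  rw [h.perp_inf, h.perp_eq_self hW hWn] at d3
  -- The projection of `W` to the hyperbolic plane `H^⊥ / H` is one of its two singular points. So
  -- `W ∩ H^⊥` is the intersection with one of `U`, `X`, while the other meets `W` only in `W ∩ H`,
  -- of dimension one less.
  have hY : IsTotallySingular Q (H ⊔ (W ⊓ perp Q H)) :=
    hHs.sup (hW.mono inf_le_left) inf_le_right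
  have d4 := finrank_inf_add_finrank_sup H (W ⊓ perp Q H)
  have e1 : H ⊓ (W ⊓ perp Q H) = W ⊓ H := by
    rw [← inf_assoc, inf_comm H W, inf_assoc, inf_eq_left.2 hHs.le_perp]
  rw [e1] at d4
  have hUp : U ≤ perp Q H := (h.perp_eq_self hU hUn).ge.trans (perp_anti inf_le_left)
  have hXp : X ≤ perp Q H := (h.perp_eq_self hX hXn).ge.trans (perp_anti inf_le_right)
  rcases h.eq_or_eq_of_inf_le hU hX hY hUn hXn (by omega) hUX le_sup_left with hc | hc
  · left
    have e2 : W ⊓ perp Q H = W ⊓ U :=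
      le_antisymm (le_inf inf_le_left (le_sup_right.trans hc.le)) (inf_le_inf_left _ hUp)
    have e3 : W ⊓ X = W ⊓ H := by
      refine le_antisymm (le_inf inf_le_left (le_inf ?_ inf_le_right)) (inf_le_inf_left _ inf_le_right)
      exact (inf_le_inf_left W hXp).trans (e2.le.trans inf_le_right)
    rw [e3, ← e2]
    omega
  · right
    have e2 : W ⊓ perp Q H = W ⊓ X :=
      le_antisymm (le_inf inf_le_left (le_sup_right.trans hc.le)) (inf_le_inf_left _ hXp)
    have e3 : W ⊓ U = W ⊓ H := by
      refine le_antisymm (le_inf inf_le_left (le_inf inf_le_right ?_)) (inf_le_inf_left _ inf_le_left)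
      exact (inf_le_inf_left W hUp).trans (e2.le.trans inf_le_right)
    rw [e3, ← e2]
    omega

/-- The maximal totally singular subspace through `x` adjacent to `X`. -/
theorem IsOPlusSpace.exists_adjacent (h : IsOPlusSpace n Q) (hX : IsTotallySingular Q X)
    (hXn : finrank K X = n) {x : V} (hx : Q x = 0) (hxX : x ∉ X) :
    ∃ Y : Submodule K V, IsTotallySingular Q Y ∧ finrank K Y = n ∧ x ∈ Y ∧
      finrank K (Y ⊓ X : Submodule K V) + 1 = n ∧ X ⊓ perp Q (span K {x}) ≤ Y := by
  have hx0 : x ≠ 0 := fun h0 => hxX (h0 ▸ X.zero_mem)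
  have d0 := finrank_span_singleton (K := K) hx0
  have hsx : IsTotallySingular Q (span K {x}) := isTotallySingular_span_singleton hx
  have e1 : X ⊓ span K {x} = ⊥ := by
    rw [← disjoint_iff, disjoint_span_singleton' hx0]
    exact hxX
  have d1 := h.finrank_perp (X ⊓ span K {x})
  rw [h.perp_inf, h.perp_eq_self hX hXn, e1, finrank_bot] at d1
  have d2 := finrank_inf_add_finrank_sup X (perp Q (span K {x}))
  have d3 := h.finrank_perp (span K {x})
  have hY : IsTotallySingular Q ((X ⊓ perp Q (span K {x})) ⊔ span K {x}) :=
    (hX.mono inf_le_left).sup hsx (le_perp_comm.1 inf_le_right)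
  have d4 := finrank_inf_add_finrank_sup (X ⊓ perp Q (span K {x})) (span K {x})
  have e2 : X ⊓ perp Q (span K {x}) ⊓ span K {x} = ⊥ := by
    rw [eq_bot_iff, ← e1]
    exact le_inf (inf_le_left.trans inf_le_left) inf_le_right
  rw [e2, finrank_bot] at d4
  have hxY : x ∈ (X ⊓ perp Q (span K {x})) ⊔ span K {x} :=
    le_sup_right (a := X ⊓ perp Q (span K {x})) (mem_span_singleton_self x)
  refine ⟨_, hY, by omega, hxY, ?_, le_sup_left⟩
  have d5 : finrank K (X ⊓ perp Q (span K {x}) : Submodule K V) ≤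
      finrank K (((X ⊓ perp Q (span K {x})) ⊔ span K {x}) ⊓ X : Submodule K V) :=
    finrank_mono (le_inf le_sup_left inf_le_left)
  have d6 : ((X ⊓ perp Q (span K {x})) ⊔ span K {x}) ⊓ X <
      (X ⊓ perp Q (span K {x})) ⊔ span K {x} := by
    refine lt_of_le_of_ne inf_le_left fun hc => hxX ?_
    exact (inf_eq_left.1 hc) hxY
  have d7 := finrank_lt_finrank_of_lt d6
  omega

/-- Moving one step from `X` towards `U` in the graph of maximal totally singular subspaces. -/
theorem IsOPlusSpace.exists_step (h : IsOPlusSpace n Q) (hU : IsTotallySingular Q U)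
    (hX : IsTotallySingular Q X) (hUn : finrank K U = n) (hXn : finrank K X = n) (hne : U ≠ X) :
    ∃ Y : Submodule K V, IsTotallySingular Q Y ∧ finrank K Y = n ∧
      finrank K (Y ⊓ X : Submodule K V) + 1 = n ∧
      finrank K (U ⊓ Y : Submodule K V) = finrank K (U ⊓ X : Submodule K V) + 1 := by
  obtain ⟨x, hx, hxX⟩ : ∃ x ∈ U, x ∉ X := by
    by_contra! hc
    exact hne (eq_of_le_of_finrank_eq hc (by omega))
  obtain ⟨Y, hY, hYn, hxY, hYX, hle⟩ := h.exists_adjacent hX hXn (hU x hx) hxX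
  refine ⟨Y, hY, hYn, hYX, ?_⟩
  have h1 : U ⊓ X < U ⊓ Y := by
    refine lt_of_le_of_ne (le_inf inf_le_left (le_trans ?_ hle)) fun hc => hxX ?_
    · exact le_inf inf_le_right fun z hz => mem_perp_span.2 (hU.polar_eq_zero hx hz.1)
    · have : x ∈ U ⊓ X := hc ▸ ⟨hx, hxY⟩
      exact this.2
  have h2 := finrank_lt_finrank_of_lt h1
  rcases h.finrank_inf_adjacent hY hX hU hYn hXn hUn hYX with h3 | h3 <;> omega

/-- Every property of maximal totally singular subspaces that is stable under adjacency and
holds once holds everywhere. -/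
theorem IsOPlusSpace.adjacent_induction (h : IsOPlusSpace n Q) {P : Submodule K V → Prop}
    (hX : IsTotallySingular Q X) (hXn : finrank K X = n) (hP : P X)
    (step : ∀ Y Z : Submodule K V, IsTotallySingular Q Y → finrank K Y = n →
      IsTotallySingular Q Z → finrank K Z = n → finrank K (Z ⊓ Y : Submodule K V) + 1 = n →
      P Y → P Z) (hU : IsTotallySingular Q U) (hUn : finrank K U = n) : P U := by
  induction hk : n - finrank K (U ⊓ X : Submodule K V) generalizing X with
  | zero =>
    have h1 : U ⊓ X = U := eq_of_le_of_finrank_le inf_le_left (by omega)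
    rwa [eq_of_le_of_finrank_eq (inf_eq_left.1 h1) (by omega)]
  | succ k ih =>
    have hne : U ≠ X := by
      rintro rfl
      rw [inf_idem] at hk
      omega
    obtain ⟨Y, hY, hYn, hYX, hUY⟩ := h.exists_step hU hX hUn hXn hne
    exact ih hY hYn (step X Y hX hXn hY hYn hYX hP) (by omega)

/-- Replacing `U` by an adjacent subspace changes both `dim (W ∩ U)` and `dim (U ∩ X)` by one, so
the parity of the sum is constant along the connected adjacency graph, and it can be read off at `U
= X`. This is what makes "same type" an equivalence relation with two classes. -/
theorem IsOPlusSpace.parity (h : IsOPlusSpace n Q) (hU : IsTotallySingular Q U)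
    (hX : IsTotallySingular Q X) (hW : IsTotallySingular Q W) (hUn : finrank K U = n)
    (hXn : finrank K X = n) (hWn : finrank K W = n) :
    (finrank K (W ⊓ U : Submodule K V) + finrank K (W ⊓ X : Submodule K V) +
      finrank K (U ⊓ X : Submodule K V)) % 2 = n % 2 := by
  refine h.adjacent_induction (P := fun Y => (finrank K (W ⊓ Y : Submodule K V) +
    finrank K (W ⊓ X : Submodule K V) + finrank K (Y ⊓ X : Submodule K V)) % 2 = n % 2)
    hX hXn ?_ ?_ hU hUn
  · rw [inf_idem]
    omega
  intro Y Z hY hYn hZ hZn hZY hP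
  have h1 := h.finrank_inf_adjacent hZ hY hW hZn hYn hWn hZY
  have h2 := h.finrank_inf_adjacent hZ hY hX hZn hYn hXn hZY
  rw [inf_comm X Z, inf_comm X Y] at h2
  omega

end SingularSubspaces

/-! ### Isotropic complements and hyperbolic coordinates. -/

section HyperbolicCoordinates

variable {K : Type u} [Field K] {V : Type v} [AddCommGroup V] [Module K V]
  [FiniteDimensional K V] {n : ℕ}

/-- A pair of complementary isotropic subspaces gives coordinates in which the form is
the standard pairing. -/
theorem exists_dual_coordinates {B : LinearMap.BilinForm K V} (hB : B.Nondegenerate)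
    (hV : finrank K V = 2 * n) {W U : Submodule K V} (hW : finrank K W = n)
    (hU : finrank K U = n) (hUi : IsTotallyIsotropic B U) (hWU : W ⊓ U = ⊥) :
    ∃ (b : (Fin n → K) ≃ₗ[K] W) (c : (Fin n → K) ≃ₗ[K] U)
      (e : ((Fin n → K) × (Fin n → K)) ≃ₗ[K] V),
      (∀ x y, e (x, y) = b x + c y) ∧ ∀ x y, B (b x) (c y) = x ⬝ᵥ y := by
  have htop : W ⊔ U = ⊤ := by
    apply eq_top_of_finrank_eq
    have := finrank_inf_add_finrank_sup W U
    rw [hWU, finrank_bot] at this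
    omega
  have hcompl : IsCompl W U := ⟨disjoint_iff.2 hWU, codisjoint_iff.2 htop⟩
  let bW : Basis (Fin n) K W := finBasisOfFinrankEq K W hW
  let f : U →ₗ[K] (Fin n → K) := LinearMap.pi fun i => (B (bW i)).comp U.subtype
  have hf : Function.Injective f := by
    rw [← LinearMap.ker_eq_bot, LinearMap.ker_eq_bot']
    intro y hy
    have h1 : ∀ w : W, B w y = 0 := by
      intro w
      have h2 : B.flip y ∘ₗ W.subtype = 0 := bW.ext fun i => congrFun hy i
      exact LinearMap.congr_fun h2 w
    have h3 : (y : V) = 0 := by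
      apply hB.2
      intro v
      obtain ⟨w, hw, z, hz, rfl⟩ := mem_sup.1 (htop ▸ mem_top : v ∈ W ⊔ U)
      rw [map_add, LinearMap.add_apply, h1 ⟨w, hw⟩, hUi z hz y y.2, add_zero]
    exact Subtype.ext h3
  let c : U ≃ₗ[K] (Fin n → K) := LinearEquiv.ofInjectiveOfFinrankEq f hf (by simp [hU])
  refine ⟨bW.equivFun.symm, c.symm, (bW.equivFun.symm.prodCongr c.symm).trans
    (prodEquivOfIsCompl W U hcompl), fun x y => ?_, fun x y => ?_⟩
  · simp
  · have h1 : ∀ i, B (bW i) (c.symm y) = y i := fun i =>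
      congrFun (LinearEquiv.apply_symm_apply c y) i
    simp only [Basis.equivFun_symm_apply, coe_sum, coe_smul, map_sum, map_smul,
      LinearMap.sum_apply, LinearMap.smul_apply, h1, dotProduct, smul_eq_mul]

/-- The predicate `S` allows one extension argument for both t.s. and t.i. complements: a largest
`U` satisfying `S` and meeting `W` trivially can be enlarged by `step` as long as `dim U < n`. -/
theorem exists_isotropic_complement {B : LinearMap.BilinForm K V} (hB : B.Nondegenerate)
    (hr : B.IsRefl) (hV : finrank K V = 2 * n) {W : Submodule K V} (hW : finrank K W = n)
    (hWi : IsTotallyIsotropic B W) (S : Submodule K V → Prop) (hbot : S ⊥)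
    (hS : ∀ U, S U → IsTotallyIsotropic B U)
    (step : ∀ U, S U → ∀ x ∈ B.orthogonal U, x ∉ W ⊔ U →
      ∃ y ∈ B.orthogonal U, y ∉ W ⊔ U ∧ S (U ⊔ span K {y})) :
    ∃ U, S U ∧ finrank K U = n ∧ W ⊓ U = ⊥ := by
  obtain ⟨U, ⟨h1, h2⟩, h3⟩ := (wellFounded_gt (α := Submodule K V)).has_min
    {U | S U ∧ W ⊓ U = ⊥} ⟨⊥, hbot, inf_bot_eq _⟩
  refine ⟨U, h1, ?_, h2⟩
  have d1 := LinearMap.BilinForm.finrank_orthogonal hB U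
  have d2 := finrank_mono (show U ≤ B.orthogonal U from fun x hx y hy => hS U h1 y hy x hx)
  have d3 := finrank_le U
  by_contra hne
  have hlt : finrank K U < n := by omega
  -- Otherwise `W ∩ U^⊥ ≤ (W + U)^⊥ ≤ U`, so `W ∩ U^⊥ = 0`; but its dimension is at least `n - dim U
  -- > 0`.
  have hnle : ¬ B.orthogonal U ≤ W ⊔ U := by
    intro hle
    have e1 : B.orthogonal (W ⊔ U) ≤ U := by
      have := LinearMap.BilinForm.orthogonal_le (B := B) hle
      rwa [LinearMap.BilinForm.orthogonal_orthogonal hB hr] at this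
    have e2 : W ⊓ B.orthogonal U ≤ B.orthogonal (W ⊔ U) := by
      rintro x ⟨hx, hx'⟩ z hz
      obtain ⟨w, hw, y, hy, rfl⟩ := mem_sup.1 hz
      have : B y x = 0 := hx' y hy
      change B (w + y) x = 0
      rw [map_add, LinearMap.add_apply, hWi w hw x hx, this, add_zero]
    have e3 : W ⊓ B.orthogonal U ≤ ⊥ := h2 ▸ le_inf inf_le_left (e2.trans e1)
    have d4 := finrank_mono e3
    have d5 := finrank_inf_add_finrank_sup W (B.orthogonal U)
    have d6 := finrank_le (W ⊔ B.orthogonal U)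
    rw [finrank_bot] at d4
    omega
  obtain ⟨x, hx, hxn⟩ := SetLike.not_le_iff_exists.1 hnle
  obtain ⟨y, -, hyn, hyS⟩ := step U h1 x hx hxn
  refine h3 _ ⟨hyS, ?_⟩ (lt_of_le_of_ne le_sup_left ?_)
  · rw [eq_bot_iff]
    rintro z ⟨hzW, hz⟩
    obtain ⟨a, ha, b, hb, rfl⟩ := mem_sup.1 hz
    obtain ⟨k, rfl⟩ := mem_span_singleton.1 hb
    have hk : k • y ∈ W ⊔ U := by
      have := sub_mem (mem_sup_left hzW : _ ∈ W ⊔ U) (mem_sup_right ha : _ ∈ W ⊔ U)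
      rwa [add_sub_cancel_left] at this
    by_cases hk0 : k = 0
    · rw [hk0, zero_smul, add_zero] at hzW ⊢
      rw [← h2]
      exact ⟨hzW, ha⟩
    · exact absurd ((smul_mem_iff _ hk0).1 hk) hyn
  · intro hc
    exact hyn (mem_sup_right (hc ▸ mem_sup_right (mem_span_singleton_self y)))

theorem IsOPlusSpace.exists_complement {Q : QuadraticForm K V} (h : IsOPlusSpace n Q)
    {W : Submodule K V} (hW : IsTotallySingular Q W) (hWn : finrank K W = n) :
    ∃ U, IsTotallySingular Q U ∧ finrank K U = n ∧ W ⊓ U = ⊥ :=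
  exists_isotropic_complement h.nondegenerate
    (polarBilin_isRefl Q) h.finrank_eq hWn (fun x hx y hy => hW.polar_eq_zero hx hy)
    (IsTotallySingular Q) isTotallySingular_bot
    (fun U hU x hx y hy => hU.polar_eq_zero hx hy) (by
      intro U hU x hx hxn
      have hx1 : x ∈ perp Q U := hx
      -- As `W^⊥ = W`, the perp of `W ∩ U^⊥` is `W + U`. A vector outside it pairs nontrivially with
      -- some `w ∈ W ∩ U^⊥`, and adding a multiple of `w` makes it singular.
      have hx2 : x ∉ perp Q (W ⊓ perp Q U) := by
        rwa [h.perp_inf, h.perp_perp, h.perp_eq_self hW hWn]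
      obtain ⟨w, hw, hwx⟩ : ∃ w ∈ W ⊓ perp Q U, Q.polarBilin w x ≠ 0 := by
        by_contra! hc
        exact hx2 hc
      -- The coefficient solves `Q(x + c w) = Q(x) + c B(w, x) = 0`, as `w` is singular.
      have hmem : x + (-(Q x / Q.polarBilin w x)) • w ∈ perp Q U :=
        add_mem hx1 (smul_mem _ _ hw.2)
      refine ⟨x + (-(Q x / Q.polarBilin w x)) • w, hmem, fun hc => hxn ?_, ?_⟩
      · have := sub_mem hc (mem_sup_left (smul_mem _ (-(Q x / Q.polarBilin w x)) hw.1) :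
          _ ∈ W ⊔ U)
        rwa [add_sub_cancel_right] at this
      · refine hU.sup (isTotallySingular_span_singleton ?_)
          ((span_singleton_le_iff_mem _ _).2 hmem)
        rw [map_add_polar, QuadraticMap.map_smul, hW w hw.1, map_smul, polarBilin_comm Q x w,
          smul_zero, smul_eq_mul]
        field_simp
        ring)

theorem IsOPlusSpace.exists_coordinates {Q : QuadraticForm K V} (h : IsOPlusSpace n Q) :
    ∃ e : ((Fin n → K) × (Fin n → K)) ≃ₗ[K] V, ∀ x y, Q (e (x, y)) = x ⬝ᵥ y := by
  obtain ⟨W, hW, hWn⟩ := h.exists_totallySingular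
  obtain ⟨U, hU, hUn, hWU⟩ := h.exists_complement hW hWn
  obtain ⟨b, c, e, he, hbc⟩ := exists_dual_coordinates h.nondegenerate h.finrank_eq hWn hUn
    (fun x hx y hy => hU.polar_eq_zero hx hy) hWU
  refine ⟨e, fun x y => ?_⟩
  rw [he, map_add_polar, hW _ (b x).2, hU _ (c y).2, hbc, zero_add, zero_add]

theorem IsSpSpace.exists_coordinates {B : LinearMap.BilinForm K V} (h : IsSpSpace n B) :
    ∃ e : ((Fin n → K) × (Fin n → K)) ≃ₗ[K] V,
      ∀ x y x' y', B (e (x, y)) (e (x', y')) = x ⬝ᵥ y' - x' ⬝ᵥ y := by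
  have hr := h.isAlt.isRefl
  have hsup : ∀ U : Submodule K V, IsTotallyIsotropic B U → ∀ x ∈ B.orthogonal U,
      IsTotallyIsotropic B (U ⊔ span K {x}) := by
    intro U hU x hx y hy z hz
    obtain ⟨y1, hy1, y2, hy2, rfl⟩ := mem_sup.1 hy
    obtain ⟨z1, hz1, z2, hz2, rfl⟩ := mem_sup.1 hz
    obtain ⟨k, rfl⟩ := mem_span_singleton.1 hy2
    obtain ⟨l, rfl⟩ := mem_span_singleton.1 hz2
    have e1 : B y1 x = 0 := hx y1 hy1
    have e2 : B x z1 = 0 := hr _ _ (hx z1 hz1)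
    have e3 : B x x = 0 := h.isAlt x
    simp [hU y1 hy1 z1 hz1, e1, e2, e3]
  obtain ⟨W, hWi, hmax⟩ := (wellFounded_gt (α := Submodule K V)).has_min
    {U | IsTotallyIsotropic B U} ⟨⊥, by
      intro x hx y _
      rw [(mem_bot K).1 hx, map_zero, LinearMap.zero_apply]⟩
  have hWeq : B.orthogonal W ≤ W := by
    intro x hx
    by_contra hxW
    refine hmax _ (hsup W hWi x hx) (lt_of_le_of_ne le_sup_left fun hc => hxW ?_)
    exact hc ▸ mem_sup_right (mem_span_singleton_self x)
  have hWn : finrank K W = n := by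
    have d1 := LinearMap.BilinForm.finrank_orthogonal h.nondegenerate W
    have d2 := finrank_mono (show W ≤ B.orthogonal W from fun x hx y hy => hWi y hy x hx)
    have d3 := finrank_mono hWeq
    have d4 := finrank_le W
    have d5 := h.finrank_eq
    omega
  obtain ⟨U, hU, hUn, hWU⟩ := exists_isotropic_complement h.nondegenerate hr h.finrank_eq hWn
    hWi (IsTotallyIsotropic B) (by
      intro x hx y _
      rw [(mem_bot K).1 hx, map_zero, LinearMap.zero_apply]) (fun _ hU => hU)
    (fun U hU x hx hxn => ⟨x, hx, hxn, hsup U hU x hx⟩)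
  obtain ⟨b, c, e, he, hbc⟩ := exists_dual_coordinates h.nondegenerate h.finrank_eq hWn hUn
    hU hWU
  refine ⟨e, fun x y x' y' => ?_⟩
  rw [he, he, map_add, map_add, LinearMap.add_apply, LinearMap.add_apply,
    hWi _ (b x).2 _ (b x').2, hU _ (c y).2 _ (c y').2, hbc, ← h.isAlt.neg_eq (b x' : V) (c y : V), hbc]
  ring

end HyperbolicCoordinates

/-! ### Symmetric composition algebras and the annihilators of singular vectors. -/

section SymmetricComposition

variable {K : Type u} [Field K] {V : Type v} [AddCommGroup V] [Module K V]
  {Q : QuadraticForm K V} {m : V →ₗ[K] V →ₗ[K] V}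

/-- A symmetric composition algebra with norm form `Q` and multiplication `m`. -/
structure IsSymmetricComposition (Q : QuadraticForm K V) (m : V →ₗ[K] V →ₗ[K] V) : Prop where
  left : ∀ x y, m (m x y) x = Q x • y
  right : ∀ x y, m x (m y x) = Q x • y
  assoc : ∀ x y z, Q.polarBilin (m x y) z = Q.polarBilin x (m y z)

/-- The multiplication of the split para-octonions, on `K⁴ ⊕ K⁴`. -/
def paraOctonionMul (K : Type u) [Field K] :
    ((Fin 4 → K) × (Fin 4 → K)) →ₗ[K] ((Fin 4 → K) × (Fin 4 → K)) →ₗ[K]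
      ((Fin 4 → K) × (Fin 4 → K)) :=
  LinearMap.mk₂ K
    (fun x y =>
      -- Zorn vector matrices with both factors conjugated, signed so that the norm is `x.1 ⬝ᵥ x.2`:
      -- index `0` of each block is a diagonal entry, indices `1, 2, 3` are the vector parts, and
      -- these multiply by dot and cross products.
      (![x.2 0 * y.2 0 - (x.1 1 * y.2 1 + x.1 2 * y.2 2 + x.1 3 * y.2 3),
         -(x.2 0 * y.1 1) - y.1 0 * x.1 1 - (x.2 2 * y.2 3 - x.2 3 * y.2 2),
         -(x.2 0 * y.1 2) - y.1 0 * x.1 2 - (x.2 3 * y.2 1 - x.2 1 * y.2 3),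
         -(x.2 0 * y.1 3) - y.1 0 * x.1 3 - (x.2 1 * y.2 2 - x.2 2 * y.2 1)],
       ![x.1 0 * y.1 0 - (x.2 1 * y.1 1 + x.2 2 * y.1 2 + x.2 3 * y.1 3),
         -(y.2 0 * x.2 1) - x.1 0 * y.2 1 - (x.1 2 * y.1 3 - x.1 3 * y.1 2),
         -(y.2 0 * x.2 2) - x.1 0 * y.2 2 - (x.1 3 * y.1 1 - x.1 1 * y.1 3),
         -(y.2 0 * x.2 3) - x.1 0 * y.2 3 - (x.1 1 * y.1 2 - x.1 2 * y.1 1)]))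
    (by
      intro x x' y
      ext i <;> fin_cases i <;> simp <;> ring)
    (by
      intro c x y
      ext i <;> fin_cases i <;> simp <;> ring)
    (by
      intro x y y'
      ext i <;> fin_cases i <;> simp <;> ring)
    (by
      intro c x y
      ext i <;> fin_cases i <;> simp <;> ring)

theorem paraOctonionMul_left (x y : (Fin 4 → K) × (Fin 4 → K)) :
    paraOctonionMul K (paraOctonionMul K x y) x = (x.1 ⬝ᵥ x.2) • y := by
  ext i <;> fin_cases i <;> simp [paraOctonionMul, dotProduct, Fin.sum_univ_four] <;> ring

theorem paraOctonionMul_right (x y : (Fin 4 → K) × (Fin 4 → K)) :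
    paraOctonionMul K x (paraOctonionMul K y x) = (x.1 ⬝ᵥ x.2) • y := by
  ext i <;> fin_cases i <;> simp [paraOctonionMul, dotProduct, Fin.sum_univ_four] <;> ring

theorem paraOctonionMul_assoc (x y z : (Fin 4 → K) × (Fin 4 → K)) :
    (paraOctonionMul K x y).1 ⬝ᵥ z.2 + z.1 ⬝ᵥ (paraOctonionMul K x y).2 =
      x.1 ⬝ᵥ (paraOctonionMul K y z).2 + (paraOctonionMul K y z).1 ⬝ᵥ x.2 := by
  simp [paraOctonionMul, dotProduct, Fin.sum_univ_four]
  ring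

theorem IsOPlusSpace.exists_symmetricComposition [FiniteDimensional K V]
    (h : IsOPlusSpace 4 Q) : ∃ m, IsSymmetricComposition Q m := by
  obtain ⟨e, he⟩ := h.exists_coordinates
  have hQ : ∀ x, Q x = (e.symm x).1 ⬝ᵥ (e.symm x).2 := fun x => by
    rw [← he, Prod.mk.eta, e.apply_symm_apply]
  have hB : ∀ x y, Q.polarBilin x y =
      (e.symm x).1 ⬝ᵥ (e.symm y).2 + (e.symm y).1 ⬝ᵥ (e.symm x).2 := fun x y => by
    have := map_add_polar Q x y
    rw [hQ (x + y), hQ x, hQ y, map_add, Prod.fst_add, Prod.snd_add, add_dotProduct,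
      dotProduct_add, dotProduct_add] at this
    linear_combination -this
  refine ⟨((paraOctonionMul K).compl₁₂ e.symm.toLinearMap e.symm.toLinearMap).compr₂
    e.toLinearMap, fun x y => ?_, fun x y => ?_, fun x y z => ?_⟩
  · simp [paraOctonionMul_left, hQ]
  · simp [paraOctonionMul_right, hQ]
  · rw [hB, hB]
    simpa using paraOctonionMul_assoc (e.symm x) (e.symm y) (e.symm z)

namespace IsSymmetricComposition

theorem flip (h : IsSymmetricComposition Q m) : IsSymmetricComposition Q m.flip where
  left x y := h.right x y
  right x y := h.left x y
  assoc x y z := by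
    rw [LinearMap.flip_apply, LinearMap.flip_apply, polarBilin_comm, ← h.assoc, polarBilin_comm]

theorem left_add (h : IsSymmetricComposition Q m) (x y z : V) :
    m (m x y) z + m (m z y) x = Q.polarBilin x z • y := by
  have h1 := h.left (x + z) y
  rw [map_add_polar] at h1
  simp only [map_add, LinearMap.add_apply, add_smul, h.left] at h1
  linear_combination (norm := module) h1

theorem right_add (h : IsSymmetricComposition Q m) (x y z : V) :
    m x (m y z) + m z (m y x) = Q.polarBilin x z • y := by
  have h1 := h.right (x + z) y
  rw [map_add_polar] at h1
  simp only [map_add, LinearMap.add_apply, add_smul, h.right] at h1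
  linear_combination (norm := module) h1

/-- If `x y = 0`, then `Q(y) x = y (x y) = 0`. -/
theorem isTotallySingular_ker (h : IsSymmetricComposition Q m) {x : V} (hx : x ≠ 0) :
    IsTotallySingular Q (LinearMap.ker (m x)) := by
  intro y hy
  have h1 := h.right y x
  rw [LinearMap.mem_ker.1 hy, map_zero] at h1
  exact (smul_eq_zero.1 h1.symm).resolve_right hx

theorem map_eq_zero_of_mul_eq_zero (h : IsSymmetricComposition Q m) {x y : V} (hy : y ≠ 0)
    (hxy : m x y = 0) : Q x = 0 := by
  have h1 := h.left x y
  rw [hxy, map_zero, LinearMap.zero_apply] at h1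
  exact (smul_eq_zero.1 h1.symm).resolve_right hy

variable [FiniteDimensional K V]

/-- Both annihilators are t.s., so of dimension at most `4`, and `(x y) x = Q(x) y = 0` puts the
range of left multiplication in the kernel of right multiplication. Rank-nullity in dimension `8`
makes every inequality an equality. -/
theorem finrank_ker_and_range (h : IsSymmetricComposition Q m) (hV : IsOPlusSpace 4 Q) {x : V}
    (hx : x ≠ 0) (hQ : Q x = 0) :
    finrank K (LinearMap.ker (m x)) = 4 ∧
      LinearMap.range (m x) = LinearMap.ker (m.flip x) := by
  have h1 := hV.finrank_le (h.isTotallySingular_ker hx)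
  have h2 := hV.finrank_le (h.flip.isTotallySingular_ker hx)
  have h3 : LinearMap.range (m x) ≤ LinearMap.ker (m.flip x) := by
    rintro _ ⟨y, rfl⟩
    rw [LinearMap.mem_ker, LinearMap.flip_apply, h.left, hQ, zero_smul]
  have h4 := LinearMap.finrank_range_add_finrank_ker (m x)
  rw [hV.finrank_eq] at h4
  have h5 := finrank_mono h3
  exact ⟨by omega, eq_of_le_of_finrank_le h3 (by omega)⟩

theorem finrank_ker (h : IsSymmetricComposition Q m) (hV : IsOPlusSpace 4 Q) {x : V}
    (hx : x ≠ 0) (hQ : Q x = 0) : finrank K (LinearMap.ker (m x)) = 4 :=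
  (h.finrank_ker_and_range hV hx hQ).1

theorem range_eq (h : IsSymmetricComposition Q m) (hV : IsOPlusSpace 4 Q) {x : V}
    (hx : x ≠ 0) (hQ : Q x = 0) : LinearMap.range (m x) = LinearMap.ker (m.flip x) :=
  (h.finrank_ker_and_range hV hx hQ).2

theorem finrank_map_add_finrank_inf_ker (f : V →ₗ[K] V) (S : Submodule K V) :
    finrank K (S.map f) + finrank K (S ⊓ LinearMap.ker f : Submodule K V) = finrank K S := by
  have h1 := LinearMap.finrank_range_add_finrank_ker (f.domRestrict S)
  rw [LinearMap.range_domRestrict, LinearMap.ker_domRestrict] at h1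
  rw [← h1, ← Submodule.map_comap_subtype, finrank_map_subtype_eq]

/-- The left kernel of `y` consists of the products `y v`, and polarization together with `y x = 0`
gives `x (y v) = B(x, v) y`. -/
theorem ker_flip_inf_ker_of_mul_eq_zero (h : IsSymmetricComposition Q m)
    (hV : IsOPlusSpace 4 Q) {x y : V} (hy : y ≠ 0) (hQy : Q y = 0) (hyx : m y x = 0) :
    LinearMap.ker (m.flip y) ⊓ LinearMap.ker (m x) = (perp Q (span K {x})).map (m y) := by
  have key : ∀ v, m x (m y v) = Q.polarBilin x v • y := fun v => by
    rw [← h.right_add x y v, hyx, map_zero, add_zero]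
  rw [← h.range_eq hV hy hQy]
  ext z
  simp only [mem_inf, LinearMap.mem_range, LinearMap.mem_ker, mem_map, mem_perp_span]
  constructor
  · rintro ⟨⟨v, rfl⟩, hz⟩
    rw [key] at hz
    exact ⟨v, (smul_eq_zero.1 hz).resolve_right hy, rfl⟩
  · rintro ⟨v, hv, rfl⟩
    exact ⟨⟨v, rfl⟩, by rw [key, hv, zero_smul]⟩

theorem finrank_ker_flip_inf_ker_of_mul_eq_zero (h : IsSymmetricComposition Q m)
    (hV : IsOPlusSpace 4 Q) {x y : V} (hx : x ≠ 0) (hy : y ≠ 0) (hQy : Q y = 0)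
    (hyx : m y x = 0) :
    finrank K (LinearMap.ker (m.flip y) ⊓ LinearMap.ker (m x) : Submodule K V) = 3 := by
  rw [h.ker_flip_inf_ker_of_mul_eq_zero hV hy hQy hyx]
  have h1 := finrank_map_add_finrank_inf_ker (m y) (perp Q (span K {x}))
  have h2 : LinearMap.ker (m y) ≤ perp Q (span K {x}) := by
    intro v hv
    rw [mem_perp_span]
    have := h.right_add x y v
    rw [hyx, LinearMap.mem_ker.1 hv, map_zero, map_zero, add_zero] at this
    exact (smul_eq_zero.1 this.symm).resolve_right hy
  rw [inf_eq_right.2 h2, h.finrank_ker hV hy hQy] at h1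
  have h3 := hV.finrank_perp (span K {x})
  rw [finrank_span_singleton hx] at h3
  omega

/-- The intersection is `⟨y x⟩`. For `y v` in it, `v (y x) = B(x, v) y`. If `B(x, v) ≠ 0`,
multiplying by `v` on the right makes `y v` a multiple of `y x`. If `B(x, v) = 0`, then `v = (y x)
u` for some `u`, and `y ((y x) u) = B(y, u) (y x)`. -/
theorem finrank_ker_flip_inf_ker_of_mul_ne_zero (h : IsSymmetricComposition Q m)
    (hV : IsOPlusSpace 4 Q) {x y : V} (hQx : Q x = 0) (hy : y ≠ 0)
    (hQy : Q y = 0) (hyx : m y x ≠ 0) :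
    finrank K (LinearMap.ker (m.flip y) ⊓ LinearMap.ker (m x) : Submodule K V) = 1 := by
  have hw : Q (m y x) = 0 := by
    refine h.map_eq_zero_of_mul_eq_zero hy ?_
    rw [h.left, hQy, zero_smul]
  suffices LinearMap.ker (m.flip y) ⊓ LinearMap.ker (m x) = span K {m y x} by
    rw [this, finrank_span_singleton hyx]
  refine le_antisymm ?_ ?_
  · rw [← h.range_eq hV hy hQy]
    rintro _ ⟨⟨v, rfl⟩, hz⟩
    have key : m v (m y x) = Q.polarBilin x v • y := by
      rw [← h.right_add x y v, LinearMap.mem_ker.1 hz, zero_add]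
    rw [mem_span_singleton]
    by_cases hB : Q.polarBilin x v = 0
    · rw [hB, zero_smul] at key
      have hv : v ∈ LinearMap.ker (m.flip (m y x)) := key
      rw [← h.range_eq hV hyx hw] at hv
      obtain ⟨u, rfl⟩ := hv
      refine ⟨Q.polarBilin y u, ?_⟩
      rw [← h.right_add y (m y x) u, h.left, hQy, zero_smul, map_zero, add_zero]
    · have h1 := h.left v (m y x)
      rw [key, map_smul, LinearMap.smul_apply] at h1
      refine ⟨(Q.polarBilin x v)⁻¹ * Q v, ?_⟩
      rw [mul_smul, ← h1, smul_smul, inv_mul_cancel₀ hB, one_smul]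
  · rw [span_singleton_le_iff_mem]
    refine mem_inf.2 ⟨?_, ?_⟩
    · rw [LinearMap.mem_ker, LinearMap.flip_apply, h.left, hQy, zero_smul]
    · rw [LinearMap.mem_ker, h.right, hQx, zero_smul]

theorem finrank_ker_flip_inf_ker_eq_three_iff (h : IsSymmetricComposition Q m)
    (hV : IsOPlusSpace 4 Q) {x y : V} (hx : x ≠ 0) (hQx : Q x = 0) (hy : y ≠ 0)
    (hQy : Q y = 0) :
    finrank K (LinearMap.ker (m.flip y) ⊓ LinearMap.ker (m x) : Submodule K V) = 3 ↔
      m y x = 0 := by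
  refine ⟨fun h3 => ?_, h.finrank_ker_flip_inf_ker_of_mul_eq_zero hV hx hy hQy⟩
  by_contra hc
  have := h.finrank_ker_flip_inf_ker_of_mul_ne_zero hV hQx hy hQy hc
  omega

theorem finrank_ker_flip_inf_ker (h : IsSymmetricComposition Q m)
    (hV : IsOPlusSpace 4 Q) {x y : V} (hx : x ≠ 0) (hQx : Q x = 0) (hy : y ≠ 0)
    (hQy : Q y = 0) :
    finrank K (LinearMap.ker (m.flip y) ⊓ LinearMap.ker (m x) : Submodule K V) = 1 ∨
      finrank K (LinearMap.ker (m.flip y) ⊓ LinearMap.ker (m x) : Submodule K V) = 3 := by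
  by_cases hyx : m y x = 0
  · exact Or.inr (h.finrank_ker_flip_inf_ker_of_mul_eq_zero hV hx hy hQy hyx)
  · exact Or.inl (h.finrank_ker_flip_inf_ker_of_mul_ne_zero hV hQx hy hQy hyx)

theorem ker_flip_ne_ker (h : IsSymmetricComposition Q m)
    (hV : IsOPlusSpace 4 Q) {x y : V} (hx : x ≠ 0) (hQx : Q x = 0) (hy : y ≠ 0)
    (hQy : Q y = 0) : LinearMap.ker (m.flip y) ≠ LinearMap.ker (m x) := by
  intro hc
  have h1 := h.finrank_ker_flip_inf_ker hV hx hQx hy hQy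
  rw [hc, inf_idem, h.finrank_ker hV hx hQx] at h1
  omega

/-- A singular point is determined by its right annihilator. -/
theorem mem_span_of_ker_eq (h : IsSymmetricComposition Q m)
    (hV : IsOPlusSpace 4 Q) {x y : V} (hx : x ≠ 0) (hQx : Q x = 0) (hy : y ≠ 0)
    (hQy : Q y = 0) (hxy : LinearMap.ker (m x) = LinearMap.ker (m y)) : y ∈ span K {x} := by
  by_contra hyx
  -- The equation `w x = 0` is equivalent to `ker (m.flip w)` meeting `ker (m x)` in dimension `3`,
  -- so it depends only on `ker (m x)`: equal right annihilators have equal left annihilators.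
  have hflip : LinearMap.ker (m.flip x) ≤ LinearMap.ker (m.flip y) := by
    intro w hw
    by_cases hw0 : w = 0
    · rw [hw0]
      exact zero_mem _
    have hQw : Q w = 0 := h.flip.isTotallySingular_ker hx w hw
    rw [LinearMap.mem_ker, LinearMap.flip_apply] at hw ⊢
    rw [← h.finrank_ker_flip_inf_ker_eq_three_iff hV hy hQy hw0 hQw, ← hxy,
      h.finrank_ker_flip_inf_ker_eq_three_iff hV hx hQx hw0 hQw, hw]
  obtain ⟨v, hv, hv'⟩ : ∃ v, Q.polarBilin x v = 0 ∧ Q.polarBilin y v ≠ 0 := by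
    by_contra! hc
    refine hyx ?_
    rw [← span_singleton_le_iff_mem, ← hV.perp_perp (span K {x}), le_perp_comm]
    intro v hv
    exact mem_perp_span.2 (hc v (mem_perp_span.1 hv))
  -- For `z` with `x z = y z = 0`, polarization gives `(v z) x = B(x, v) z = 0`; hence `(v z) y =
  -- 0`, and this product equals `B(y, v) z` with `B(y, v) ≠ 0`.
  have hbot : LinearMap.ker (m x) = ⊥ := by
    rw [eq_bot_iff]
    intro z hz
    have h1 := h.left_add x z v
    have h2 := h.left_add y z v
    have hz' : z ∈ LinearMap.ker (m y) := hxy ▸ hz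
    rw [LinearMap.mem_ker.1 hz, map_zero, LinearMap.zero_apply, zero_add, hv, zero_smul] at h1
    have h3 : m v z ∈ LinearMap.ker (m.flip y) := hflip h1
    rw [LinearMap.mem_ker.1 hz', map_zero, LinearMap.zero_apply, zero_add,
      show m (m v z) y = 0 from h3] at h2
    exact (mem_bot K).2 ((smul_eq_zero.1 h2.symm).resolve_left hv')
  have := h.finrank_ker hV hx hQx
  rw [hbot, finrank_bot] at this
  omega

/-- Both solids meet `ker (m.flip x)` in odd dimension, so they have the same type. -/
theorem even_finrank_ker_inf_ker (h : IsSymmetricComposition Q m)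
    (hV : IsOPlusSpace 4 Q) {x y : V} (hx : x ≠ 0) (hQx : Q x = 0) (hy : y ≠ 0)
    (hQy : Q y = 0) :
    finrank K (LinearMap.ker (m x) ⊓ LinearMap.ker (m y) : Submodule K V) % 2 = 0 := by
  have hsx := h.isTotallySingular_ker hx
  have hsy := h.isTotallySingular_ker hy
  have h1 := hV.parity hsx hsy (h.flip.isTotallySingular_ker hx) (h.finrank_ker hV hx hQx)
    (h.finrank_ker hV hy hQy) (h.flip.finrank_ker hV hx hQx)
  have h2 := h.finrank_ker_flip_inf_ker hV hx hQx hx hQx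
  have h3 := h.finrank_ker_flip_inf_ker hV hy hQy hx hQx
  omega

/-- An element of `ker (m.flip x)` has the form `x v`. Orthogonality gives `(x v) y = -(y v) x`,
which is killed by `x` on the left, and `y ((x v) y) = Q(y) (x v) = 0`. -/
theorem map_flip_ker_flip_le (h : IsSymmetricComposition Q m)
    (hV : IsOPlusSpace 4 Q) {x y : V} (hx : x ≠ 0) (hQx : Q x = 0) (hQy : Q y = 0)
    (hB : Q.polarBilin x y = 0) :
    (LinearMap.ker (m.flip x)).map (m.flip y) ≤ LinearMap.ker (m x) ⊓ LinearMap.ker (m y) := by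
  rw [← h.range_eq hV hx hQx]
  rintro _ ⟨_, ⟨v, rfl⟩, rfl⟩
  have h1 := h.left_add x v y
  rw [hB, zero_smul] at h1
  refine mem_inf.2 ⟨?_, ?_⟩
  · rw [LinearMap.mem_ker, LinearMap.flip_apply, eq_neg_of_add_eq_zero_left h1, map_neg, h.right,
      hQx, zero_smul, neg_zero]
  · rw [LinearMap.mem_ker, LinearMap.flip_apply, h.right, hQy, zero_smul]

/-- Perpendicular distinct singular points have annihilators meeting in a line. -/
theorem finrank_ker_inf_ker (h : IsSymmetricComposition Q m)
    (hV : IsOPlusSpace 4 Q) {x y : V} (hx : x ≠ 0) (hQx : Q x = 0) (hy : y ≠ 0)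
    (hQy : Q y = 0) (hB : Q.polarBilin x y = 0) (hxy : y ∉ span K {x}) :
    finrank K (LinearMap.ker (m x) ⊓ LinearMap.ker (m y) : Submodule K V) = 2 := by
  -- The upper bound is needed for both products. For `m` it bounds the intersection itself; for
  -- `m.flip` it bounds the kernel of right multiplication by `y` on `ker (m.flip x)`, whose image
  -- in the intersection then has dimension at least `4 - 2`.
  have aux : ∀ m : V →ₗ[K] V →ₗ[K] V, IsSymmetricComposition Q m →
      finrank K (LinearMap.ker (m x) ⊓ LinearMap.ker (m y) : Submodule K V) ≤ 2 := by
    intro m h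
    have h1 := h.even_finrank_ker_inf_ker hV hx hQx hy hQy
    have h2 := finrank_mono (inf_le_left : LinearMap.ker (m x) ⊓ LinearMap.ker (m y) ≤ _)
    have h3 := h.finrank_ker hV hx hQx
    have h4 := h.finrank_ker hV hy hQy
    by_contra hc
    have h5 : LinearMap.ker (m x) ⊓ LinearMap.ker (m y) = LinearMap.ker (m x) :=
      eq_of_le_of_finrank_le inf_le_left (by omega)
    exact hxy (h.mem_span_of_ker_eq hV hx hQx hy hQy
      (eq_of_le_of_finrank_eq (inf_eq_left.1 h5) (by omega)))
  have h1 := aux m h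
  have h2 := aux m.flip h.flip
  have h3 := finrank_mono (h.map_flip_ker_flip_le hV hx hQx hQy hB)
  have h4 := finrank_map_add_finrank_inf_ker (m.flip y) (LinearMap.ker (m.flip x))
  rw [h.flip.finrank_ker hV hx hQx] at h4
  omega

theorem ker_inf_ker_eq_map (h : IsSymmetricComposition Q m)
    (hV : IsOPlusSpace 4 Q) {x y : V} (hx : x ≠ 0) (hQx : Q x = 0) (hy : y ≠ 0)
    (hQy : Q y = 0) (hB : Q.polarBilin x y = 0) (hxy : y ∉ span K {x}) :
    LinearMap.ker (m x) ⊓ LinearMap.ker (m y) =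
      (LinearMap.ker (m.flip x)).map (m.flip y) := by
  refine (eq_of_le_of_finrank_le (h.map_flip_ker_flip_le hV hx hQx hQy hB) ?_).symm
  have h4 := finrank_map_add_finrank_inf_ker (m.flip y) (LinearMap.ker (m.flip x))
  rw [h.flip.finrank_ker hV hx hQx, h.flip.finrank_ker_inf_ker hV hx hQx hy hQy hB hxy] at h4
  rw [h.finrank_ker_inf_ker hV hx hQx hy hQy hB hxy]
  omega

/-- The subspaces adjacent to a left annihilator are right annihilators. -/
theorem exists_eq_ker_of_adjacent (h : IsSymmetricComposition Q m)
    (hV : IsOPlusSpace 4 Q) {x : V} (hx : x ≠ 0) (hQx : Q x = 0) {Z : Submodule K V}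
    (hZ : IsTotallySingular Q Z) (hZn : finrank K Z = 4)
    (hadj : finrank K (Z ⊓ LinearMap.ker (m.flip x) : Submodule K V) + 1 = 4) :
    ∃ w, w ≠ 0 ∧ Q w = 0 ∧ Z = LinearMap.ker (m w) := by
  set H := Z ⊓ LinearMap.ker (m.flip x) with hH
  -- `H` is a hyperplane of the range of `m x`, so its preimage has dimension `3 + 4 = 7` and its
  -- perp is a point `⟨w⟩`. The preimage contains the self-perpendicular solid `ker (m x)`, hence `x
  -- w = 0`, and `H` is the intersection of `ker (m.flip x)` with `ker (m w)`.
  have hmap : (H.comap (m x)).map (m x) = H := by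
    rw [map_comap_eq, h.range_eq hV hx hQx, inf_eq_right]
    exact inf_le_right
  have hker : LinearMap.ker (m x) ≤ H.comap (m x) := by
    intro v hv
    rw [mem_comap, LinearMap.mem_ker.1 hv]
    exact zero_mem _
  have d1 := finrank_map_add_finrank_inf_ker (m x) (H.comap (m x))
  rw [hmap, inf_eq_right.2 hker, h.finrank_ker hV hx hQx] at d1
  have d2 := hV.finrank_perp (H.comap (m x))
  have hle : perp Q (H.comap (m x)) ≤ LinearMap.ker (m x) := by
    refine (perp_anti hker).trans ?_
    rw [hV.perp_eq_self (h.isTotallySingular_ker hx) (h.finrank_ker hV hx hQx)]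
  have hpt : IsSingularPoint Q (perp Q (H.comap (m x))) :=
    ⟨(h.isTotallySingular_ker hx).mono hle, by omega⟩
  obtain ⟨w, hw, hQw, hwp⟩ := isSingularPoint_iff.1 hpt
  have hxw : m x w = 0 := hle (hwp ▸ mem_span_singleton_self w)
  have h1 := h.ker_flip_inf_ker_of_mul_eq_zero hV hx hQx hxw
  rw [← hwp, hV.perp_perp, hmap] at h1
  refine ⟨w, hw, hQw, ?_⟩
  rcases hV.eq_or_eq_of_inf_le hZ (h.flip.isTotallySingular_ker hx) (h.isTotallySingular_ker hw)
    hZn (h.flip.finrank_ker hV hx hQx) (h.finrank_ker hV hw hQw) hadj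
    (h1.ge.trans inf_le_right) with h2 | h2
  · exact h2.symm
  · exact absurd h2.symm (h.ker_flip_ne_ker hV hw hQw hx hQx)

/-- Annihilators of one kind are adjacent only to annihilators of the other kind, and the adjacency
graph is connected. The induction starts at the annihilator of a nonzero vector of `U`. -/
theorem exists_eq_ker (h : IsSymmetricComposition Q m)
    (hV : IsOPlusSpace 4 Q) {U : Submodule K V}
    (hU : IsTotallySingular Q U) (hUn : finrank K U = 4) :
    (∃ x, x ≠ 0 ∧ Q x = 0 ∧ U = LinearMap.ker (m.flip x)) ∨
      ∃ x, x ≠ 0 ∧ Q x = 0 ∧ U = LinearMap.ker (m x) := by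
  obtain ⟨x, hxU, hx⟩ := exists_mem_ne_zero_of_ne_bot (p := U) (by
    rintro rfl
    rw [finrank_bot] at hUn
    omega)
  have hQx := hU x hxU
  refine hV.adjacent_induction (P := fun U => (∃ x, x ≠ 0 ∧ Q x = 0 ∧ U = LinearMap.ker (m.flip x))
    ∨ ∃ x, x ≠ 0 ∧ Q x = 0 ∧ U = LinearMap.ker (m x)) (h.isTotallySingular_ker hx)
    (h.finrank_ker hV hx hQx) (Or.inr ⟨x, hx, hQx, rfl⟩) ?_ hU hUn
  rintro Y Z hY hYn hZ hZn hZY (⟨y, hy, hQy, rfl⟩ | ⟨y, hy, hQy, rfl⟩)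
  · exact Or.inr (h.exists_eq_ker_of_adjacent hV hy hQy hZ hZn hZY)
  · exact Or.inl (h.flip.exists_eq_ker_of_adjacent hV hy hQy hZ hZn hZY)

end IsSymmetricComposition

end SymmetricComposition

/-! ### The triality map of a symmetric composition algebra. -/

section TrialityExistence

variable {K : Type u} [Field K] {V : Type v} [AddCommGroup V] [Module K V]
  {Q : QuadraticForm K V} {m : V →ₗ[K] V →ₗ[K] V}

/-- The left annihilator of a subspace; right annihilators are left annihilators for `m.flip`. -/
def leftAnn (m : V →ₗ[K] V →ₗ[K] V) (W : Submodule K V) : Submodule K V where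
  carrier := {z | ∀ w ∈ W, m z w = 0}
  add_mem' {a b} ha hb w hw := by
    rw [map_add, LinearMap.add_apply, ha w hw, hb w hw, add_zero]
  zero_mem' w _ := by rw [map_zero, LinearMap.zero_apply]
  smul_mem' c a ha w hw := by rw [map_smul, LinearMap.smul_apply, ha w hw, smul_zero]

theorem mem_leftAnn_iff_le {W : Submodule K V} {z : V} :
    z ∈ leftAnn m W ↔ W ≤ LinearMap.ker (m z) := Iff.rfl

theorem leftAnn_span_singleton (x : V) : leftAnn m (span K {x}) = LinearMap.ker (m.flip x) := by
  ext z
  rw [mem_leftAnn_iff_le, span_singleton_le_iff_mem, LinearMap.mem_ker, LinearMap.mem_ker,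
    LinearMap.flip_apply]

theorem leftAnn_sup (W U : Submodule K V) : leftAnn m (W ⊔ U) = leftAnn m W ⊓ leftAnn m U := by
  ext z
  rw [mem_inf, mem_leftAnn_iff_le, mem_leftAnn_iff_le, mem_leftAnn_iff_le, sup_le_iff]

theorem le_leftAnn_flip_leftAnn (W : Submodule K V) : W ≤ leftAnn m.flip (leftAnn m W) :=
  fun w hw _ hz => hz w hw

/-- Incidence of totally singular subspaces. -/
def IncidentSubspaces (W U : Submodule K V) : Prop :=
  W ≤ U ∨ U ≤ W ∨
    (finrank K W = 4 ∧ finrank K U = 4 ∧ finrank K (W ⊓ U : Submodule K V) = 3)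

theorem IncidentSubspaces.comm {W U : Submodule K V} :
    IncidentSubspaces W U ↔ IncidentSubspaces U W := by
  unfold IncidentSubspaces
  rw [inf_comm]
  tauto

open Classical in
/-- The action of the triality map attached to `m` on subspaces. -/
noncomputable def trialityFun (m : V →ₗ[K] V →ₗ[K] V) (W : Submodule K V) : Submodule K V :=
  -- The left annihilator is the right image for points, lines and solids `ker (m x)`, the last
  -- going to `⟨x⟩`. It vanishes exactly on the solids `ker (m.flip x)`; for these, the first right
  -- annihilator recovers `⟨x⟩` and the second gives `ker (m x)`.
  if leftAnn m W = ⊥ then leftAnn m.flip (leftAnn m.flip W) else leftAnn m W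

theorem IsSymmetricComposition.isTotallySingular_leftAnn (h : IsSymmetricComposition Q m) {W : Submodule K V}
    (hW : W ≠ ⊥) : IsTotallySingular Q (leftAnn m W) := by
  obtain ⟨x, hx, hx0⟩ := exists_mem_ne_zero_of_ne_bot hW
  exact fun z hz => h.map_eq_zero_of_mul_eq_zero hx0 (hz x hx)

variable [FiniteDimensional K V]

theorem incidentSubspaces_iff_le {W U : Submodule K V} (hlt : finrank K W < finrank K U)
    (h4 : finrank K W ≠ 4) : IncidentSubspaces W U ↔ W ≤ U := by
  refine ⟨?_, Or.inl⟩
  rintro (h | h | h)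
  · exact h
  · have := finrank_mono h
    omega
  · exact absurd h.1 h4

theorem incidentSubspaces_iff_eq {W U : Submodule K V} (heq : finrank K W = finrank K U)
    (h3 : finrank K W = 4 → finrank K (W ⊓ U : Submodule K V) ≠ 3) :
    IncidentSubspaces W U ↔ W = U := by
  refine ⟨?_, fun h => Or.inl h.le⟩
  rintro (h | h | h)
  · exact eq_of_le_of_finrank_eq h heq
  · exact (eq_of_le_of_finrank_eq h heq.symm).symm
  · exact absurd h.2.2 (h3 h.1)

theorem exists_basis_of_line {W : Submodule K V} (hW : finrank K W = 2) :
    ∃ x y, x ≠ 0 ∧ y ≠ 0 ∧ x ∈ W ∧ y ∈ W ∧ y ∉ span K {x} ∧ W = span K {x} ⊔ span K {y} := by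
  obtain ⟨x, hx, hx0⟩ := exists_mem_ne_zero_of_ne_bot (p := W) (by
    rintro rfl
    rw [finrank_bot] at hW
    omega)
  have hle : span K {x} ≤ W := (span_singleton_le_iff_mem _ _).2 hx
  have d1 := finrank_span_singleton (K := K) hx0
  obtain ⟨y, hy, hyx⟩ : ∃ y ∈ W, y ∉ span K {x} := by
    by_contra! hc
    have := finrank_mono (show W ≤ span K {x} from hc)
    omega
  refine ⟨x, y, hx0, ?_, hx, hy, hyx, ?_⟩
  · rintro rfl
    exact hyx (zero_mem _)
  · have h1 : span K {x} < span K {x} ⊔ span K {y} := by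
      refine lt_of_le_of_ne le_sup_left fun hc => hyx ?_
      rw [hc]
      exact mem_sup_right (mem_span_singleton_self y)
    have h2 := finrank_lt_finrank_of_lt h1
    exact (eq_of_le_of_finrank_le (sup_le hle ((span_singleton_le_iff_mem _ _).2 hy))
      (by omega)).symm

namespace IsSymmetricComposition

theorem leftAnn_ker (h : IsSymmetricComposition Q m) (hV : IsOPlusSpace 4 Q) {x : V}
    (hx : x ≠ 0) (hQx : Q x = 0) : leftAnn m (LinearMap.ker (m x)) = span K {x} := by
  refine le_antisymm (fun z hz => ?_) ((span_singleton_le_iff_mem _ _).2 fun _ hw => hw)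
  by_cases hz0 : z = 0
  · rw [hz0]
    exact zero_mem _
  rw [mem_leftAnn_iff_le] at hz
  have d1 := h.finrank_ker hV hx hQx
  obtain ⟨w, hw, hw0⟩ := exists_mem_ne_zero_of_ne_bot (p := LinearMap.ker (m x)) (by
    intro hc
    rw [hc, finrank_bot] at d1
    omega)
  have hQz : Q z = 0 := h.map_eq_zero_of_mul_eq_zero hw0 (hz hw)
  exact h.mem_span_of_ker_eq hV hx hQx hz0 hQz
    (eq_of_le_of_finrank_eq hz (d1.trans (h.finrank_ker hV hz0 hQz).symm))

/-- A nonzero `z` annihilating this solid would make it equal to `ker (m z)`, a solid of the other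
type. -/
theorem leftAnn_ker_flip (h : IsSymmetricComposition Q m) (hV : IsOPlusSpace 4 Q) {x : V}
    (hx : x ≠ 0) (hQx : Q x = 0) : leftAnn m (LinearMap.ker (m.flip x)) = ⊥ := by
  rw [eq_bot_iff]
  intro z hz
  rw [mem_bot]
  by_contra hz0
  rw [mem_leftAnn_iff_le] at hz
  have d1 := h.flip.finrank_ker hV hx hQx
  obtain ⟨w, hw, hw0⟩ := exists_mem_ne_zero_of_ne_bot (p := LinearMap.ker (m.flip x)) (by
    intro hc
    rw [hc, finrank_bot] at d1
    omega)
  have hQz : Q z = 0 := h.map_eq_zero_of_mul_eq_zero hw0 (hz hw)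
  exact h.ker_flip_ne_ker hV hz0 hQz hx hQx
    (eq_of_le_of_finrank_eq hz (d1.trans (h.finrank_ker hV hz0 hQz).symm))

theorem finrank_leftAnn_line (h : IsSymmetricComposition Q m) (hV : IsOPlusSpace 4 Q)
    {W : Submodule K V} (hW : IsTotallySingular Q W) (hW2 : finrank K W = 2) :
    finrank K (leftAnn m W) = 2 := by
  obtain ⟨x, y, hx, hy, hxW, hyW, hyx, rfl⟩ := exists_basis_of_line hW2
  rw [leftAnn_sup, leftAnn_span_singleton, leftAnn_span_singleton]
  exact h.flip.finrank_ker_inf_ker hV hx (hW x hxW) hy (hW y hyW) (hW.polar_eq_zero hxW hyW) hyx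

theorem leftAnn_flip_leftAnn_line (h : IsSymmetricComposition Q m) (hV : IsOPlusSpace 4 Q)
    {W : Submodule K V} (hW : IsTotallySingular Q W) (hW2 : finrank K W = 2) :
    leftAnn m.flip (leftAnn m W) = W := by
  have hne : W ≠ ⊥ := by
    rintro rfl
    rw [finrank_bot] at hW2
    omega
  have d1 := h.finrank_leftAnn_line hV hW hW2
  have d2 := h.flip.finrank_leftAnn_line hV (h.isTotallySingular_leftAnn hne) d1
  exact (eq_of_le_of_finrank_eq (le_leftAnn_flip_leftAnn W) (by omega)).symm

/-- The map on lines has order dividing three. By `ker_inf_ker_eq_map`, the right annihilator of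
`⟨x, y⟩` consists of the products `s y` with `s x = 0`. If `z x = z y = 0`, then `(s y) z = B(s, z)
y - (z y) s = 0`, because `s` and `z` both lie in the t.s. space `ker (m.flip x)`. -/
theorem leftAnn_leftAnn_line (h : IsSymmetricComposition Q m) (hV : IsOPlusSpace 4 Q)
    {W : Submodule K V} (hW : IsTotallySingular Q W) (hW2 : finrank K W = 2) :
    leftAnn m (leftAnn m W) = leftAnn m.flip W := by
  have hne : W ≠ ⊥ := by
    rintro rfl
    rw [finrank_bot] at hW2
    omega
  have d1 := h.finrank_leftAnn_line hV hW hW2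
  have d2 := h.finrank_leftAnn_line hV (h.isTotallySingular_leftAnn hne) d1
  have d3 := h.flip.finrank_leftAnn_line hV hW hW2
  refine (eq_of_le_of_finrank_eq ?_ (by omega)).symm
  obtain ⟨x, y, hx, hy, hxW, hyW, hyx, rfl⟩ := exists_basis_of_line hW2
  have hB := hW.polar_eq_zero hxW hyW
  rw [leftAnn_sup, leftAnn_sup, leftAnn_span_singleton, leftAnn_span_singleton,
    leftAnn_span_singleton, leftAnn_span_singleton, LinearMap.flip_flip,
    h.ker_inf_ker_eq_map hV hx (hW x hxW) hy (hW y hyW) hB hyx]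
  rintro _ ⟨s, hs, rfl⟩ z hz
  obtain ⟨hz1, hz2⟩ := mem_inf.1 hz
  have h1 := h.left_add s y z
  rw [LinearMap.mem_ker, LinearMap.flip_apply] at hz2
  rw [hz2, map_zero, LinearMap.zero_apply, add_zero,
    (h.flip.isTotallySingular_ker hx).polar_eq_zero hs hz1, zero_smul] at h1
  exact h1

section Values

variable (h : IsSymmetricComposition Q m) (hV : IsOPlusSpace 4 Q)
include h hV

theorem trialityFun_point {x : V} (hx : x ≠ 0) (hQx : Q x = 0) :
    trialityFun m (span K {x}) = LinearMap.ker (m.flip x) := by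
  rw [trialityFun, leftAnn_span_singleton, if_neg]
  intro hc
  have := h.flip.finrank_ker hV hx hQx
  rw [hc, finrank_bot] at this
  omega

theorem trialityFun_ker_flip {x : V} (hx : x ≠ 0) (hQx : Q x = 0) :
    trialityFun m (LinearMap.ker (m.flip x)) = LinearMap.ker (m x) := by
  rw [trialityFun, if_pos (h.leftAnn_ker_flip hV hx hQx), h.flip.leftAnn_ker hV hx hQx,
    leftAnn_span_singleton, LinearMap.flip_flip]

theorem trialityFun_ker {x : V} (hx : x ≠ 0) (hQx : Q x = 0) :
    trialityFun m (LinearMap.ker (m x)) = span K {x} := by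
  rw [trialityFun, h.leftAnn_ker hV hx hQx, if_neg]
  simpa using hx

theorem trialityFun_line {W : Submodule K V} (hW : IsTotallySingular Q W)
    (hW2 : finrank K W = 2) : trialityFun m W = leftAnn m W := by
  rw [trialityFun, if_neg]
  intro hc
  have := h.finrank_leftAnn_line hV hW hW2
  rw [hc, finrank_bot] at this
  omega

theorem element_cases {W : Submodule K V} (hW : IsTotallySingular Q W)
    (hd : finrank K W = 1 ∨ finrank K W = 2 ∨ finrank K W = 4) :
    (∃ x, x ≠ 0 ∧ Q x = 0 ∧ W = span K {x}) ∨ finrank K W = 2 ∨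
      (∃ x, x ≠ 0 ∧ Q x = 0 ∧ W = LinearMap.ker (m.flip x)) ∨
        ∃ x, x ≠ 0 ∧ Q x = 0 ∧ W = LinearMap.ker (m x) := by
  rcases hd with h1 | h2 | h4
  · exact Or.inl (isSingularPoint_iff.1 ⟨hW, h1⟩)
  · exact Or.inr (Or.inl h2)
  · exact Or.inr (Or.inr (h.exists_eq_ker hV hW h4))

theorem trialityFun_flip_trialityFun {W : Submodule K V} (hW : IsTotallySingular Q W)
    (hd : finrank K W = 1 ∨ finrank K W = 2 ∨ finrank K W = 4) :
    trialityFun m.flip (trialityFun m W) = W := by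
  rcases h.element_cases hV hW hd with ⟨x, hx, hQx, rfl⟩ | h2 | ⟨x, hx, hQx, rfl⟩ |
    ⟨x, hx, hQx, rfl⟩
  · rw [h.trialityFun_point hV hx hQx, h.flip.trialityFun_ker hV hx hQx]
  · have hne : W ≠ ⊥ := by
      rintro rfl
      rw [finrank_bot] at h2
      omega
    rw [h.trialityFun_line hV hW h2, h.flip.trialityFun_line hV
      (h.isTotallySingular_leftAnn hne) (h.finrank_leftAnn_line hV hW h2),
      h.leftAnn_flip_leftAnn_line hV hW h2]
  · rw [h.trialityFun_ker_flip hV hx hQx]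
    exact h.flip.trialityFun_ker_flip hV hx hQx
  · rw [h.trialityFun_ker hV hx hQx, h.flip.trialityFun_point hV hx hQx, LinearMap.flip_flip]

theorem trialityFun_element {W : Submodule K V} (hW : IsTotallySingular Q W)
    (hd : finrank K W = 1 ∨ finrank K W = 2 ∨ finrank K W = 4) :
    IsTotallySingular Q (trialityFun m W) ∧ (finrank K (trialityFun m W) = 1 ∨
      finrank K (trialityFun m W) = 2 ∨ finrank K (trialityFun m W) = 4) := by
  rcases h.element_cases hV hW hd with ⟨x, hx, hQx, rfl⟩ | h2 | ⟨x, hx, hQx, rfl⟩ |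
    ⟨x, hx, hQx, rfl⟩
  · rw [h.trialityFun_point hV hx hQx]
    exact ⟨h.flip.isTotallySingular_ker hx, Or.inr (Or.inr (h.flip.finrank_ker hV hx hQx))⟩
  · have hne : W ≠ ⊥ := by
      rintro rfl
      rw [finrank_bot] at h2
      omega
    rw [h.trialityFun_line hV hW h2]
    exact ⟨h.isTotallySingular_leftAnn hne, Or.inr (Or.inl (h.finrank_leftAnn_line hV hW h2))⟩
  · rw [h.trialityFun_ker_flip hV hx hQx]
    exact ⟨h.isTotallySingular_ker hx, Or.inr (Or.inr (h.finrank_ker hV hx hQx))⟩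
  · rw [h.trialityFun_ker hV hx hQx]
    exact ⟨isTotallySingular_span_singleton hQx, Or.inl (finrank_span_singleton hx)⟩

theorem incident_point_ker {x y : V} (hx : x ≠ 0) (hy : y ≠ 0) (hQy : Q y = 0) :
    IncidentSubspaces (span K {x}) (LinearMap.ker (m y)) ↔ m y x = 0 := by
  have h1 := finrank_span_singleton (K := K) hx
  have h2 := h.finrank_ker hV hy hQy
  rw [incidentSubspaces_iff_le (by omega) (by omega), span_singleton_le_iff_mem,
    LinearMap.mem_ker]

/-- The same equation `y x = 0` that describes incidence of a point with a solid of either kind.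
Cycling points and the two kinds of solids therefore only permutes the readings of this equation. -/
theorem incident_ker_flip_ker {x y : V} (hx : x ≠ 0) (hQx : Q x = 0) (hy : y ≠ 0)
    (hQy : Q y = 0) :
    IncidentSubspaces (LinearMap.ker (m.flip y)) (LinearMap.ker (m x)) ↔ m y x = 0 := by
  have d1 := h.flip.finrank_ker hV hy hQy
  have d2 := h.finrank_ker hV hx hQx
  have hne := h.ker_flip_ne_ker hV hx hQx hy hQy
  rw [← h.finrank_ker_flip_inf_ker_eq_three_iff hV hx hQx hy hQy]
  refine ⟨?_, fun h3 => Or.inr (Or.inr ⟨d1, d2, h3⟩)⟩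
  rintro (hc | hc | hc)
  · exact absurd (eq_of_le_of_finrank_eq hc (by omega)) hne
  · exact absurd (eq_of_le_of_finrank_eq hc (by omega)).symm hne
  · exact hc.2.2

theorem incident_line_ker {W : Submodule K V} (hW2 : finrank K W = 2) {x : V} (hx : x ≠ 0)
    (hQx : Q x = 0) :
    IncidentSubspaces W (LinearMap.ker (m x)) ↔ x ∈ leftAnn m W := by
  have d2 := h.finrank_ker hV hx hQx
  rw [incidentSubspaces_iff_le (by omega) (by omega), mem_leftAnn_iff_le]

theorem incident_ker_ker {x y : V} (hx : x ≠ 0) (hQx : Q x = 0) (hy : y ≠ 0)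
    (hQy : Q y = 0) :
    IncidentSubspaces (LinearMap.ker (m x)) (LinearMap.ker (m y)) ↔
      LinearMap.ker (m x) = LinearMap.ker (m y) := by
  have d1 := h.finrank_ker hV hx hQx
  have d2 := h.finrank_ker hV hy hQy
  have d3 := h.even_finrank_ker_inf_ker hV hx hQx hy hQy
  exact incidentSubspaces_iff_eq (by omega) (by omega)

theorem incident_trialityFun {W U : Submodule K V} (hW : IsTotallySingular Q W)
    (hdW : finrank K W = 1 ∨ finrank K W = 2 ∨ finrank K W = 4) (hU : IsTotallySingular Q U)
    (hdU : finrank K U = 1 ∨ finrank K U = 2 ∨ finrank K U = 4) :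
    IncidentSubspaces (trialityFun m W) (trialityFun m U) ↔ IncidentSubspaces W U := by
  have hinj : trialityFun m W = trialityFun m U ↔ W = U := by
    refine ⟨fun he => ?_, fun he => by rw [he]⟩
    rw [← h.trialityFun_flip_trialityFun hV hW hdW, he, h.trialityFun_flip_trialityFun hV hU hdU]
  have hpl : ∀ x, x ≠ 0 → Q x = 0 → ∀ L, IsTotallySingular Q L → finrank K L = 2 →
      (IncidentSubspaces (trialityFun m (span K {x})) (trialityFun m L) ↔
        IncidentSubspaces (span K {x}) L) := by
    intro x hx hQx L hL hL2
    have d1 := finrank_span_singleton (K := K) hx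
    rw [h.trialityFun_point hV hx hQx, h.trialityFun_line hV hL hL2, IncidentSubspaces.comm,
      h.flip.incident_line_ker hV (h.finrank_leftAnn_line hV hL hL2) hx hQx,
      h.leftAnn_flip_leftAnn_line hV hL hL2, incidentSubspaces_iff_le (by omega) (by omega),
      span_singleton_le_iff_mem]
  have hpa : ∀ x, x ≠ 0 → Q x = 0 → ∀ y, y ≠ 0 → Q y = 0 →
      (IncidentSubspaces (trialityFun m (span K {x})) (trialityFun m (LinearMap.ker (m.flip y))) ↔
        IncidentSubspaces (span K {x}) (LinearMap.ker (m.flip y))) := by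
    intro x hx hQx y hy hQy
    rw [h.trialityFun_point hV hx hQx, h.trialityFun_ker_flip hV hy hQy,
      h.incident_ker_flip_ker hV hy hQy hx hQx, h.flip.incident_point_ker hV hx hy hQy,
      LinearMap.flip_apply]
  have hpc : ∀ x, x ≠ 0 → Q x = 0 → ∀ y, y ≠ 0 → Q y = 0 →
      (IncidentSubspaces (trialityFun m (span K {x})) (trialityFun m (LinearMap.ker (m y))) ↔
        IncidentSubspaces (span K {x}) (LinearMap.ker (m y))) := by
    intro x hx hQx y hy hQy
    rw [h.trialityFun_point hV hx hQx, h.trialityFun_ker hV hy hQy, IncidentSubspaces.comm,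
      h.flip.incident_point_ker hV hy hx hQx, h.incident_point_ker hV hx hy hQy,
      LinearMap.flip_apply]
  have hla : ∀ L, IsTotallySingular Q L → finrank K L = 2 → ∀ y, y ≠ 0 → Q y = 0 →
      (IncidentSubspaces (trialityFun m L) (trialityFun m (LinearMap.ker (m.flip y))) ↔
        IncidentSubspaces L (LinearMap.ker (m.flip y))) := by
    intro L hL hL2 y hy hQy
    rw [h.trialityFun_line hV hL hL2, h.trialityFun_ker_flip hV hy hQy,
      h.incident_line_ker hV (h.finrank_leftAnn_line hV hL hL2) hy hQy,
      h.leftAnn_leftAnn_line hV hL hL2, h.flip.incident_line_ker hV hL2 hy hQy]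
  have hlc : ∀ L, IsTotallySingular Q L → finrank K L = 2 → ∀ y, y ≠ 0 → Q y = 0 →
      (IncidentSubspaces (trialityFun m L) (trialityFun m (LinearMap.ker (m y))) ↔
        IncidentSubspaces L (LinearMap.ker (m y))) := by
    intro L hL hL2 y hy hQy
    have d1 := finrank_span_singleton (K := K) hy
    have d2 := h.finrank_leftAnn_line hV hL hL2
    rw [h.trialityFun_line hV hL hL2, h.trialityFun_ker hV hy hQy, IncidentSubspaces.comm,
      incidentSubspaces_iff_le (by omega) (by omega), span_singleton_le_iff_mem,
      h.incident_line_ker hV hL2 hy hQy]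
  have hac : ∀ x, x ≠ 0 → Q x = 0 → ∀ y, y ≠ 0 → Q y = 0 →
      (IncidentSubspaces (trialityFun m (LinearMap.ker (m.flip x)))
        (trialityFun m (LinearMap.ker (m y))) ↔
        IncidentSubspaces (LinearMap.ker (m.flip x)) (LinearMap.ker (m y))) := by
    intro x hx hQx y hy hQy
    rw [h.trialityFun_ker_flip hV hx hQx, h.trialityFun_ker hV hy hQy, IncidentSubspaces.comm,
      h.incident_point_ker hV hy hx hQx, h.incident_ker_flip_ker hV hy hQy hx hQx]
  -- Between elements of one kind, incidence is equality, so injectivity suffices. The six mixed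
  -- pairs are treated above, and the reversed ones follow by symmetry.
  rcases h.element_cases hV hW hdW with ⟨x, hx, hQx, rfl⟩ | h2 | ⟨x, hx, hQx, rfl⟩ |
    ⟨x, hx, hQx, rfl⟩ <;>
  rcases h.element_cases hV hU hdU with ⟨y, hy, hQy, rfl⟩ | h2' | ⟨y, hy, hQy, rfl⟩ |
    ⟨y, hy, hQy, rfl⟩
  · have d1 := finrank_span_singleton (K := K) hx
    have d2 := finrank_span_singleton (K := K) hy
    rw [incidentSubspaces_iff_eq (W := span K {x}) (by omega) (by omega), ← hinj,
      h.trialityFun_point hV hx hQx, h.trialityFun_point hV hy hQy,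
      h.flip.incident_ker_ker hV hx hQx hy hQy]
  · exact hpl x hx hQx U hU h2'
  · exact hpa x hx hQx y hy hQy
  · exact hpc x hx hQx y hy hQy
  · rw [IncidentSubspaces.comm, hpl y hy hQy W hW h2, IncidentSubspaces.comm]
  · have d1 := h.finrank_leftAnn_line hV hW h2
    have d2 := h.finrank_leftAnn_line hV hU h2'
    rw [incidentSubspaces_iff_eq (W := W) (by omega) (by omega), ← hinj,
      h.trialityFun_line hV hW h2, h.trialityFun_line hV hU h2',
      incidentSubspaces_iff_eq (by omega) (by omega)]
  · exact hla W hW h2 y hy hQy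
  · exact hlc W hW h2 y hy hQy
  · rw [IncidentSubspaces.comm, hpa y hy hQy x hx hQx, IncidentSubspaces.comm]
  · rw [IncidentSubspaces.comm, hla U hU h2' x hx hQx, IncidentSubspaces.comm]
  · rw [h.flip.incident_ker_ker hV hx hQx hy hQy, ← hinj, h.trialityFun_ker_flip hV hx hQx,
      h.trialityFun_ker_flip hV hy hQy, h.incident_ker_ker hV hx hQx hy hQy]
  · exact hac x hx hQx y hy hQy
  · rw [IncidentSubspaces.comm, hpc y hy hQy x hx hQx, IncidentSubspaces.comm]
  · rw [IncidentSubspaces.comm, hlc U hU h2' x hx hQx, IncidentSubspaces.comm]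
  · rw [IncidentSubspaces.comm, hac y hy hQy x hx hQx, IncidentSubspaces.comm]
  · have d1 := finrank_span_singleton (K := K) hx
    have d2 := finrank_span_singleton (K := K) hy
    rw [h.incident_ker_ker hV hx hQx hy hQy, ← hinj, h.trialityFun_ker hV hx hQx,
      h.trialityFun_ker hV hy hQy, incidentSubspaces_iff_eq (by omega) (by omega)]

end Values

/-- The triality map attached to a symmetric composition algebra. -/
theorem nonempty_triality (h : IsSymmetricComposition Q m) (hV : IsOPlusSpace 4 Q) :
    Nonempty (Triality Q) := by
  obtain ⟨W, hW, hW4⟩ := hV.exists_totallySingular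
  obtain ⟨x, hxW, hx⟩ := exists_mem_ne_zero_of_ne_bot (p := W) (by
    rintro rfl
    rw [finrank_bot] at hW4
    omega)
  have hQx := hW x hxW
  refine ⟨⟨⟨fun E => ⟨trialityFun m E.1, h.trialityFun_element hV E.2.1 E.2.2⟩,
    fun E => ⟨trialityFun m.flip E.1, h.flip.trialityFun_element hV E.2.1 E.2.2⟩,
    fun E => Subtype.ext (h.trialityFun_flip_trialityFun hV E.2.1 E.2.2),
    fun E => Subtype.ext (h.flip.trialityFun_flip_trialityFun hV E.2.1 E.2.2)⟩,
    fun E E' => h.incident_trialityFun hV E.2.1 E.2.2 E'.2.1 E'.2.2,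
    ⟨LinearMap.ker (m.flip x), h.flip.isTotallySingular_ker hx,
      Or.inr (Or.inr (h.flip.finrank_ker hV hx hQx))⟩, h.flip.finrank_ker hV hx hQx, ?_⟩⟩
  rintro ⟨E, hE, hd⟩
  have hA : ∀ y, y ≠ 0 → Q y = 0 →
      SameType 4 (LinearMap.ker (m.flip x)) (LinearMap.ker (m.flip y)) := by
    intro y hy hQy
    have := h.flip.even_finrank_ker_inf_ker hV hx hQx hy hQy
    unfold SameType Nat.ModEq
    omega
  have hC : ∀ y, y ≠ 0 → Q y = 0 →
      ¬ SameType 4 (LinearMap.ker (m.flip x)) (LinearMap.ker (m y)) := by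
    intro y hy hQy
    have := h.finrank_ker_flip_inf_ker hV hy hQy hx hQx
    unfold SameType Nat.ModEq
    omega
  change (finrank K E = 1 ↔ finrank K (trialityFun m E) = 4 ∧
      SameType 4 (LinearMap.ker (m.flip x)) (trialityFun m E)) ∧
    ((finrank K E = 4 ∧ SameType 4 (LinearMap.ker (m.flip x)) E) ↔
      finrank K (trialityFun m E) = 4 ∧
        ¬ SameType 4 (LinearMap.ker (m.flip x)) (trialityFun m E)) ∧
    ((finrank K E = 4 ∧ ¬ SameType 4 (LinearMap.ker (m.flip x)) E) ↔
      finrank K (trialityFun m E) = 1)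
  rcases h.element_cases hV hE hd with ⟨y, hy, hQy, rfl⟩ | h2 | ⟨y, hy, hQy, rfl⟩ |
    ⟨y, hy, hQy, rfl⟩
  · have d1 := finrank_span_singleton (K := K) hy
    have d2 := h.flip.finrank_ker hV hy hQy
    have := hA y hy hQy
    rw [h.trialityFun_point hV hy hQy]
    simp [d1, d2, this]
  · have d1 := h.finrank_leftAnn_line hV hE h2
    rw [h.trialityFun_line hV hE h2]
    simp [d1, h2]
  · have d1 := h.finrank_ker hV hy hQy
    have d2 := h.flip.finrank_ker hV hy hQy
    have h1 := hA y hy hQy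
    have h2 := hC y hy hQy
    rw [h.trialityFun_ker_flip hV hy hQy]
    simp [d1, d2, h1, h2]
  · have d1 := finrank_span_singleton (K := K) hy
    have d2 := h.finrank_ker hV hy hQy
    have := hC y hy hQy
    rw [h.trialityFun_ker hV hy hQy]
    simp [d1, d2, this]

end IsSymmetricComposition

theorem IsOPlusSpace.nonempty_triality (hV : IsOPlusSpace 4 Q) : Nonempty (Triality Q) := by
  obtain ⟨m, hm⟩ := hV.exists_symmetricComposition
  exact hm.nonempty_triality hV

end TrialityExistence

/-! ### Counting singular vectors and vectors covered by disjoint subspaces. -/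

section Counting

variable {K : Type u} [Field K] {V : Type v} [AddCommGroup V] [Module K V]
  {Q : QuadraticForm K V}

/-- Fibre over the first vector: the fibre is everything over `0` and a hyperplane otherwise. -/
theorem card_isotropic_pairs (K : Type u) [Field K] [Finite K] (n : ℕ) :
    Nat.card {p : (Fin (n + 1) → K) × (Fin (n + 1) → K) // p.1 ⬝ᵥ p.2 = 0} =
      Nat.card K ^ (n + 1) + (Nat.card K ^ (n + 1) - 1) * Nat.card K ^ n := by
  classical
  have := Fintype.ofFinite K
  have hfib : ∀ x : Fin (n + 1) → K, Nat.card {y : Fin (n + 1) → K // x ⬝ᵥ y = 0} =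
      if x = 0 then Nat.card K ^ (n + 1) else Nat.card K ^ n := by
    intro x
    split_ifs with hx
    · subst hx
      simp
    · let f : Dual K (Fin (n + 1) → K) := dotProductBilin K K x
      have hf : f ≠ 0 := by
        intro hc
        refine hx (dotProduct_eq_zero _ fun y => ?_)
        exact LinearMap.congr_fun hc y
      have h1 := Module.Dual.finrank_ker_add_one_of_ne_zero hf
      rw [finrank_fin_fun] at h1
      have h2 := Module.natCard_eq_pow_finrank (K := K) (V := LinearMap.ker f)
      rw [show finrank K (LinearMap.ker f) = n by omega] at h2
      rw [← h2]
      rfl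
  rw [Nat.card_congr (Equiv.subtypeProdEquivSigmaSubtype
    fun x y : Fin (n + 1) → K => x ⬝ᵥ y = 0), Nat.card_sigma, Finset.sum_congr rfl fun x _ => hfib x,
    Finset.sum_ite, Finset.sum_const, Finset.sum_const, Finset.filter_eq' Finset.univ,
    if_pos (Finset.mem_univ _), Finset.card_singleton, Finset.filter_ne', one_smul,
    Finset.card_erase_of_mem (Finset.mem_univ _), Finset.card_univ, smul_eq_mul,
    Fintype.card_pi_const, ← Nat.card_eq_fintype_card]

theorem IsOPlusSpace.ncard_singular [Finite K] [FiniteDimensional K V] (hV : IsOPlusSpace 4 Q) :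
    {v : V | v ≠ 0 ∧ Q v = 0}.ncard = (Nat.card K ^ 3 + 1) * (Nat.card K ^ 4 - 1) := by
  have := Module.finite_of_finite K (M := V)
  obtain ⟨e, he⟩ := hV.exists_coordinates
  have h1 : {v : V | Q v = 0}.ncard =
      Nat.card K ^ 4 + (Nat.card K ^ 4 - 1) * Nat.card K ^ 3 := by
    rw [← card_isotropic_pairs K 3]
    refine (Nat.card_congr (e.toEquiv.subtypeEquiv fun p => ?_)).symm
    change _ ↔ Q (e (p.1, p.2)) = 0
    rw [he]
  have h2 : {v : V | v ≠ 0 ∧ Q v = 0} = {v : V | Q v = 0} \ {0} := by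
    ext v
    simp [and_comm]
  rw [h2, Set.ncard_sdiff_singleton_of_mem (by simp), h1]
  have h3 : 1 ≤ Nat.card K ^ 4 := Nat.one_le_pow _ _ Nat.card_pos
  obtain ⟨k, hk⟩ := Nat.exists_eq_add_of_le h3
  rw [hk, Nat.add_sub_cancel_left, add_mul, one_mul, add_comm 1 k, Nat.add_right_comm,
    Nat.add_sub_cancel]
  ring

theorem ncard_nonzero [Finite K] [FiniteDimensional K V] (W : Submodule K V) :
    {v : V | v ≠ 0 ∧ v ∈ W}.ncard = Nat.card K ^ finrank K W - 1 := by
  have := Module.finite_of_finite K (M := V)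
  have h2 : {v : V | v ≠ 0 ∧ v ∈ W} = (W : Set V) \ {0} := by
    ext v
    simp [and_comm]
  rw [h2, Set.ncard_sdiff_singleton_of_mem (by simp), ← Module.natCard_eq_pow_finrank]
  rfl

/-- Counting the nonzero vectors of `A` covered by pairwise disjoint subspaces. -/
theorem ncard_covered [Finite K] [FiniteDimensional K V] {S : Set (Submodule K V)}
    {A : Submodule K V} {d : ℕ} (hd : ∀ W ∈ S, finrank K (W ⊓ A : Submodule K V) = d)
    (hS : ∀ W ∈ S, ∀ U ∈ S, W ≠ U → W ⊓ U = ⊥) :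
    {v : V | v ≠ 0 ∧ v ∈ A ∧ ∃ W ∈ S, v ∈ W}.ncard = S.ncard * (Nat.card K ^ d - 1) := by
  have := Module.finite_of_finite K (M := V)
  have h1 : {v : V | v ≠ 0 ∧ v ∈ A ∧ ∃ W ∈ S, v ∈ W} =
      ⋃ W ∈ S, {v : V | v ≠ 0 ∧ v ∈ W ⊓ A} := by
    ext v
    simp only [Set.mem_ofPred_eq, Set.mem_iUnion, mem_inf]
    constructor
    · rintro ⟨h0, hA, W, hW, hv⟩
      exact ⟨W, hW, h0, hv, hA⟩
    · rintro ⟨W, hW, h0, hv, hA⟩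
      exact ⟨h0, hA, W, hW, hv⟩
  have h2 : S.PairwiseDisjoint fun W => {v : V | v ≠ 0 ∧ v ∈ W ⊓ A} := by
    intro W hW U hU hne
    refine Set.disjoint_left.2 fun v hv hv' => hv.1 ?_
    rw [← mem_bot K, ← hS W hW U hU hne]
    exact mem_inf.2 ⟨(mem_inf.1 hv.2).1, (mem_inf.1 hv'.2).1⟩
  have hfin := S.toFinite
  rw [h1, hfin.ncard_biUnion (fun _ _ => Set.toFinite _) h2,
    finsum_mem_congr rfl fun W hW => (ncard_nonzero (W ⊓ A)).trans (by rw [hd W hW]),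
    finsum_mem_eq_finite_toFinset_sum _ hfin, Finset.sum_const, smul_eq_mul,
    Set.ncard_eq_toFinset_card S hfin]

end Counting

/-! ### Perpendicularity and intersections under an arbitrary triality map. -/

section Triality

variable {K : Type u} [Field K] {V : Type v} [AddCommGroup V] [Module K V]
  {Q : QuadraticForm K V} {τ : Triality Q} {M : Element Q}

/-- The triality map permutes cyclically the points, the solids of the type of `M` and the other
solids. -/
def Triality.RotatesFrom (τ : Triality Q) (M : Element Q) : Prop :=
  M.dim = 4 ∧ ∀ x : Element Q,
    (x.dim = 1 ↔ (τ.toPerm x).dim = 4 ∧ SameType 4 M.1 (τ.toPerm x).1) ∧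
    ((x.dim = 4 ∧ SameType 4 M.1 x.1) ↔
      (τ.toPerm x).dim = 4 ∧ ¬ SameType 4 M.1 (τ.toPerm x).1) ∧
    ((x.dim = 4 ∧ ¬ SameType 4 M.1 x.1) ↔ (τ.toPerm x).dim = 1)

theorem Element.dim_cases (x : Element Q) : x.dim = 1 ∨ x.dim = 2 ∨ x.dim = 4 := x.2.2

theorem Triality.RotatesFrom.dim_eq_two_iff (h : τ.RotatesFrom M) (x : Element Q) :
    (τ.toPerm x).dim = 2 ↔ x.dim = 2 := by
  obtain ⟨h1, h2, h3⟩ := h.2 x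
  have h4 := x.dim_cases
  have h5 := (τ.toPerm x).dim_cases
  by_cases hs : SameType 4 M.1 x.1 <;> by_cases hs' : SameType 4 M.1 (τ.toPerm x).1 <;>
    simp only [hs, hs', not_true, not_false_iff, and_true, and_false, false_iff, iff_false]
      at h1 h2 h3 <;> omega

/-- The singular point `p` as an element of the triality geometry. -/
def pointElement {p : Submodule K V} (hp : IsSingularPoint Q p) : Element Q :=
  ⟨p, hp.1, Or.inl hp.2⟩

theorem perp_of_le_singular {L p p' : Submodule K V} (hL : IsTotallySingular Q L) (hp : p ≤ L)
    (hp' : p' ≤ L) : p ≤ perp Q p' :=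
  fun _ hx _ hy => hL.polar_eq_zero (hp' hy) (hp hx)

theorem Triality.ncard_image {Ω : Set (Submodule K V)} (hΩ : ∀ p ∈ Ω, IsSingularPoint Q p) :
    (τ.image Ω).ncard = Ω.ncard := by
  have hinj : Function.Injective (fun x : Element Q => x.1) := fun _ _ => Subtype.ext
  have h1 : τ.image Ω =
      (fun x : Element Q => x.1) '' (τ.toPerm '' ((fun x : Element Q => x.1) ⁻¹' Ω)) := by
    ext W
    constructor
    · rintro ⟨x, hx, rfl⟩
      exact ⟨_, ⟨x, hx, rfl⟩, rfl⟩
    · rintro ⟨_, ⟨x, hx, rfl⟩, rfl⟩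
      exact ⟨x, hx, rfl⟩
  have h2 : (fun x : Element Q => x.1) '' ((fun x : Element Q => x.1) ⁻¹' Ω) = Ω :=
    Set.image_preimage_eq_of_subset fun p hp => ⟨pointElement (hΩ p hp), rfl⟩
  rw [h1, Set.ncard_image_of_injective _ hinj, Set.ncard_image_of_injective _ τ.toPerm.injective,
    ← Set.ncard_image_of_injective _ hinj, h2]

variable [FiniteDimensional K V]

theorem incident_iff_le_of_dim_lt {x y : Element Q} (h : x.dim < y.dim) :
    x.Incident y ↔ x.1 ≤ y.1 := by
  have h1 := x.dim_cases
  have h2 := y.dim_cases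
  exact incidentSubspaces_iff_le (W := x.1) (U := y.1) h
    (show x.dim ≠ 4 by omega)

theorem Element.ext_of_le {x y : Element Q} (h : x.dim = y.dim) (hle : x.1 ≤ y.1) : x = y :=
  Subtype.ext (eq_of_le_of_finrank_eq hle h)

section

variable (hV : IsOPlusSpace 4 Q) (h : τ.RotatesFrom M)
include hV

theorem sameType_parity {x y z : Element Q} (hx : x.dim = 4) (hy : y.dim = 4) (hz : z.dim = 4) :
    (SameType 4 x.1 y.1 ↔ SameType 4 x.1 z.1) ↔ SameType 4 y.1 z.1 := by
  have h1 := hV.parity y.2.1 z.2.1 x.2.1 hy hz hx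
  unfold SameType Nat.ModEq
  omega

include h

/-- Collinear points go to solids meeting in a line. -/
theorem Triality.RotatesFrom.finrank_inf {x y : Element Q} (hx : x.dim = 1) (hy : y.dim = 1)
    (hne : x ≠ y) (hxy : x.1 ≤ perp Q y.1) :
    finrank K ((τ.toPerm x).1 ⊓ (τ.toPerm y).1 : Submodule K V) = 2 := by
  have hL : IsTotallySingular Q (y.1 ⊔ x.1) := y.2.1.sup x.2.1 hxy
  have d0 : finrank K x.1 = 1 := hx
  have d1 : finrank K y.1 = 1 := hy
  have e1 : y.1 ⊓ x.1 = ⊥ := by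
    rw [← finrank_eq_zero (R := K)]
    have h1 := finrank_mono (inf_le_left : y.1 ⊓ x.1 ≤ y.1)
    by_contra hc
    have h2 : y.1 ⊓ x.1 = y.1 := eq_of_le_of_finrank_le inf_le_left (by omega)
    exact hne (Element.ext_of_le (hy.trans hx.symm) (inf_eq_left.1 h2)).symm
  have d2 := finrank_inf_add_finrank_sup y.1 x.1
  rw [e1, finrank_bot] at d2
  let L : Element Q := ⟨y.1 ⊔ x.1, hL, Or.inr (Or.inl (by omega))⟩
  have hLd : L.dim = 2 := show finrank K (y.1 ⊔ x.1 : Submodule K V) = 2 by omega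
  have hτL := (h.dim_eq_two_iff L).2 hLd
  obtain ⟨hx4, hxM⟩ := (h.2 x).1.1 hx
  obtain ⟨hy4, hyM⟩ := (h.2 y).1.1 hy
  have hLx : (τ.toPerm L).1 ≤ (τ.toPerm x).1 :=
    (incident_iff_le_of_dim_lt (by omega)).1 ((τ.incident_iff _ _).2
      (Or.inr (Or.inl (le_sup_right : x.1 ≤ y.1 ⊔ x.1))))
  have hLy : (τ.toPerm L).1 ≤ (τ.toPerm y).1 :=
    (incident_iff_le_of_dim_lt (by omega)).1 ((τ.incident_iff _ _).2
      (Or.inr (Or.inl (le_sup_left : y.1 ≤ y.1 ⊔ x.1))))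
  have d3 : finrank K (τ.toPerm L).1 ≤ _ := finrank_mono (le_inf hLx hLy)
  have d4 : finrank K (τ.toPerm L).1 = 2 := hτL
  have d5 : finrank K (τ.toPerm x).1 = 4 := hx4
  have d6 := finrank_mono (inf_le_left : (τ.toPerm x).1 ⊓ (τ.toPerm y).1 ≤ (τ.toPerm x).1)
  have hs := (sameType_parity hV h.1 hx4 hy4).1 (iff_of_true hxM hyM)
  unfold SameType Nat.ModEq at hs
  by_contra hc
  have e2 : (τ.toPerm x).1 ⊓ (τ.toPerm y).1 = (τ.toPerm x).1 :=
    eq_of_le_of_finrank_le inf_le_left (by omega)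
  exact hne (τ.toPerm.injective (Element.ext_of_le (hx4.trans hy4.symm) (inf_eq_left.1 e2)))

/-- For distinct points, the image solids have the same type, so a nonzero intersection is a line.
This line is the image of a line `L`, and preservation of incidence puts both points on `L`. -/
theorem Triality.RotatesFrom.perp_of_inf_ne_bot {x y : Element Q} (hx : x.dim = 1)
    (hy : y.dim = 1) (hxy : (τ.toPerm x).1 ⊓ (τ.toPerm y).1 ≠ ⊥) : x.1 ≤ perp Q y.1 := by
  by_cases hne : x = y
  · rw [hne]
    exact y.2.1.le_perp
  obtain ⟨hx4, hxM⟩ := (h.2 x).1.1 hx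
  obtain ⟨hy4, hyM⟩ := (h.2 y).1.1 hy
  have hs := (sameType_parity hV h.1 hx4 hy4).1 (iff_of_true hxM hyM)
  unfold SameType Nat.ModEq at hs
  have d5 : finrank K (τ.toPerm x).1 = 4 := hx4
  have d6 := finrank_mono (inf_le_left : (τ.toPerm x).1 ⊓ (τ.toPerm y).1 ≤ (τ.toPerm x).1)
  have d7 : finrank K ((τ.toPerm x).1 ⊓ (τ.toPerm y).1 : Submodule K V) ≠ 0 := by
    rwa [Ne, finrank_eq_zero]
  have d8 : finrank K ((τ.toPerm x).1 ⊓ (τ.toPerm y).1 : Submodule K V) ≠ 4 := by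
    intro hc
    have e2 : (τ.toPerm x).1 ⊓ (τ.toPerm y).1 = (τ.toPerm x).1 :=
      eq_of_le_of_finrank_le inf_le_left (by omega)
    exact hne (τ.toPerm.injective (Element.ext_of_le (hx4.trans hy4.symm) (inf_eq_left.1 e2)))
  let E : Element Q := ⟨(τ.toPerm x).1 ⊓ (τ.toPerm y).1, (τ.toPerm x).2.1.mono inf_le_left,
    Or.inr (Or.inl (by omega))⟩
  have hE : E.dim = 2 :=
    show finrank K ((τ.toPerm x).1 ⊓ (τ.toPerm y).1 : Submodule K V) = 2 by omega
  obtain ⟨L, hL⟩ := τ.toPerm.surjective E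
  have hL2 : L.dim = 2 := by rw [← h.dim_eq_two_iff, hL, hE]
  have key : ∀ z : Element Q, z.dim = 1 → E.1 ≤ (τ.toPerm z).1 → z.1 ≤ L.1 := by
    intro z hz hEz
    refine (incident_iff_le_of_dim_lt (by omega)).1 ((τ.incident_iff _ _).1 ?_)
    rw [hL]
    exact Or.inr (Or.inl hEz)
  exact perp_of_le_singular L.2.1 (key x hx inf_le_left) (key y hy inf_le_right)

omit h in
-- The inverse rotates the three classes the other way, with the roles of the two types exchanged. A
-- result about solids of one type thus transfers to the other type.
theorem Triality.RotatesFrom.exists_symm (h : τ.RotatesFrom M) :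
    ∃ (σ : Triality Q) (M' : Element Q), σ.RotatesFrom M' ∧ σ.toPerm = τ.toPerm.symm ∧
      ∀ x : Element Q, x.dim = 4 → (SameType 4 M'.1 x.1 ↔ ¬ SameType 4 M.1 x.1) := by
  have hMM : SameType 4 M.1 M.1 := by
    have : finrank K M.1 = 4 := h.1
    rw [SameType, inf_idem, this]
  obtain ⟨hM', hMM'⟩ := (h.2 M).2.1.1 ⟨h.1, hMM⟩
  have htype : ∀ x : Element Q, x.dim = 4 →
      (SameType 4 (τ.toPerm M).1 x.1 ↔ ¬ SameType 4 M.1 x.1) := by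
    intro x hx
    have := sameType_parity hV h.1 hM' hx
    tauto
  have hrot : ∀ x : Element Q,
      (x.dim = 1 ↔ (τ.toPerm.symm x).dim = 4 ∧
        SameType 4 (τ.toPerm M).1 (τ.toPerm.symm x).1) ∧
      ((x.dim = 4 ∧ SameType 4 (τ.toPerm M).1 x.1) ↔
        (τ.toPerm.symm x).dim = 4 ∧ ¬ SameType 4 (τ.toPerm M).1 (τ.toPerm.symm x).1) ∧
      ((x.dim = 4 ∧ ¬ SameType 4 (τ.toPerm M).1 x.1) ↔ (τ.toPerm.symm x).dim = 1) := by
    intro x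
    obtain ⟨h1, h2, h3⟩ := h.2 (τ.toPerm.symm x)
    rw [Equiv.apply_symm_apply] at h1 h2 h3
    refine ⟨?_, ?_, ?_⟩
    · rw [← h3]
      exact and_congr_right fun hd => (htype _ hd).symm
    · rw [and_congr_right fun hd => htype x hd, ← h2]
      refine and_congr_right fun hd => ?_
      rw [htype _ hd, not_not]
    · rw [h1]
      refine and_congr_right fun hd => ?_
      rw [htype _ hd, not_not]
  exact ⟨⟨τ.toPerm.symm, fun x y => by
    rw [← τ.incident_iff, Equiv.apply_symm_apply, Equiv.apply_symm_apply], _, hM', hrot⟩,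
    _, ⟨hM', hrot⟩, rfl, htype⟩

end

theorem pairwise_inf_eq_bot_image (hV : IsOPlusSpace 4 Q) (h : τ.RotatesFrom M)
    {Ω : Set (Submodule K V)} (hΩ : ∀ p ∈ Ω, IsSingularPoint Q p)
    (hperp : ∀ p ∈ Ω, ∀ p' ∈ Ω, p ≤ perp Q p' → p = p') :
    ∀ W ∈ τ.image Ω, ∀ U ∈ τ.image Ω, W ≠ U → W ⊓ U = ⊥ := by
  rintro _ ⟨x, hx, rfl⟩ _ ⟨y, hy, rfl⟩ hne
  by_contra hc
  have := h.perp_of_inf_ne_bot hV (hΩ _ hx).2 (hΩ _ hy).2 hc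
  exact hne (by rw [Subtype.ext (hperp _ hx _ hy this)])

theorem isOrthogonalPartialSpread_image (hV : IsOPlusSpace 4 Q) (h : τ.RotatesFrom M)
    {Ω : Set (Submodule K V)} (hΩ : ∀ p ∈ Ω, IsSingularPoint Q p)
    (hperp : ∀ p ∈ Ω, ∀ p' ∈ Ω, p ≤ perp Q p' → p = p') :
    IsOrthogonalPartialSpread 4 Q (τ.image Ω) := by
  refine ⟨⟨?_, pairwise_inf_eq_bot_image hV h hΩ hperp⟩, ?_⟩
  · rintro _ ⟨x, hx, rfl⟩
    exact ((h.2 x).1.1 (hΩ _ hx).2).1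
  · rintro _ ⟨x, hx, rfl⟩
    exact (τ.toPerm x).2.1

theorem IsOvoid.eq_of_perp {Ω : Set (Submodule K V)} (hΩ : IsOvoid Q Ω) :
    ∀ p ∈ Ω, ∀ p' ∈ Ω, p ≤ perp Q p' → p = p' := by
  intro p hp p' hp' hpp
  obtain ⟨W, hW, hmax⟩ := exists_maximal_ge ((hΩ.1.1 p' hp').1.sup (hΩ.1.1 p hp).1 hpp)
  exact hΩ.1.2 W hmax p hp p' hp' (le_sup_right.trans hW) (le_sup_left.trans hW)

/-- Incidence of a point with a solid sent to a point becomes the reversed incidence. This turns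
"the ovoid meets every such solid" into "the image solids cover every singular point". -/
theorem point_le_iff (h : τ.RotatesFrom M) {x m : Element Q}
    (hx : x.dim = 1) (hm : (τ.toPerm m).dim = 1) :
    x.1 ≤ m.1 ↔ (τ.toPerm m).1 ≤ (τ.toPerm x).1 := by
  have h1 := ((h.2 m).2.2.2 hm).1
  have h2 := ((h.2 x).1.1 hx).1
  rw [← incident_iff_le_of_dim_lt (by omega), ← incident_iff_le_of_dim_lt (by omega),
    ← τ.incident_iff]
  exact IncidentSubspaces.comm

end Triality

/-! ### Ovoids, the exchange, and maximality. -/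

section Ovoids

variable {K : Type u} [Field K] [Finite K] {V : Type v} [AddCommGroup V] [Module K V]
  [FiniteDimensional K V] {Q : QuadraticForm K V} {τ : Triality Q} {M : Element Q}
  {Ω : Set (Submodule K V)}

theorem one_lt_card_pow {d : ℕ} (hd : d ≠ 0) : 1 < Nat.card K ^ d :=
  Nat.one_lt_pow hd Finite.one_lt_card

theorem ncard_image_mul (hV : IsOPlusSpace 4 Q) (h : τ.RotatesFrom M)
    (hΩ : ∀ p ∈ Ω, IsSingularPoint Q p)
    (hperp : ∀ p ∈ Ω, ∀ p' ∈ Ω, p ≤ perp Q p' → p = p') :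
    {v : V | v ≠ 0 ∧ v ∈ (⊤ : Submodule K V) ∧ ∃ W ∈ τ.image Ω, v ∈ W}.ncard =
      Ω.ncard * (Nat.card K ^ 4 - 1) := by
  rw [← τ.ncard_image hΩ]
  refine ncard_covered (fun W hW => ?_) (pairwise_inf_eq_bot_image hV h hΩ hperp)
  obtain ⟨x, hx, rfl⟩ := hW
  rw [inf_top_eq]
  exact ((h.2 x).1.1 (hΩ _ hx).2).1

/-- The images of a large set of pairwise nonperpendicular points cover all singular vectors. -/
theorem exists_mem_image_of_ncard (hV : IsOPlusSpace 4 Q) (h : τ.RotatesFrom M)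
    (hΩ : ∀ p ∈ Ω, IsSingularPoint Q p)
    (hperp : ∀ p ∈ Ω, ∀ p' ∈ Ω, p ≤ perp Q p' → p = p')
    (hcard : Ω.ncard = Nat.card K ^ 3 + 1) {v : V} (hv : v ≠ 0) (hQ : Q v = 0) :
    ∃ W ∈ τ.image Ω, v ∈ W := by
  have := Module.finite_of_finite K (M := V)
  have hsub : {v : V | v ≠ 0 ∧ v ∈ (⊤ : Submodule K V) ∧ ∃ W ∈ τ.image Ω, v ∈ W} ⊆
      {v : V | v ≠ 0 ∧ Q v = 0} := by
    rintro v ⟨hv, -, _, ⟨x, hx, rfl⟩, hvx⟩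
    exact ⟨hv, (τ.toPerm x).2.1 v hvx⟩
  have heq := Set.eq_of_subset_of_ncard_le hsub
    (by rw [hV.ncard_singular, ncard_image_mul hV h hΩ hperp, hcard])
  have hmem : v ∈ {v : V | v ≠ 0 ∧ Q v = 0} := ⟨hv, hQ⟩
  rw [← heq] at hmem
  exact hmem.2.2

theorem exists_le_of_ncard (hV : IsOPlusSpace 4 Q) (h : τ.RotatesFrom M)
    (hΩ : ∀ p ∈ Ω, IsSingularPoint Q p)
    (hperp : ∀ p ∈ Ω, ∀ p' ∈ Ω, p ≤ perp Q p' → p = p')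
    (hcard : Ω.ncard = Nat.card K ^ 3 + 1) {m : Element Q} (hm : m.dim = 4)
    (hmM : ¬ SameType 4 M.1 m.1) : ∃ p ∈ Ω, p ≤ m.1 := by
  have hm1 := (h.2 m).2.2.1 ⟨hm, hmM⟩
  obtain ⟨v, hv, hQv, hmv⟩ := isSingularPoint_iff.1 ⟨(τ.toPerm m).2.1, hm1⟩
  obtain ⟨_, ⟨x, hx, rfl⟩, hvx⟩ := exists_mem_image_of_ncard hV h hΩ hperp hcard hv hQv
  refine ⟨x.1, hx, (point_le_iff h (hΩ _ hx).2 hm1).2 ?_⟩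
  rwa [hmv, span_singleton_le_iff_mem]

/-- Any `q³ + 1` pairwise nonperpendicular singular points form an ovoid. -/
theorem isOvoid_of_ncard (hV : IsOPlusSpace 4 Q) (hΩ : ∀ p ∈ Ω, IsSingularPoint Q p)
    (hperp : ∀ p ∈ Ω, ∀ p' ∈ Ω, p ≤ perp Q p' → p = p')
    (hcard : Ω.ncard = Nat.card K ^ 3 + 1) : IsOvoid Q Ω := by
  refine ⟨⟨hΩ, fun W hW p hp p' hp' hpW hpW' =>
    hperp p hp p' hp' (perp_of_le_singular hW.prop hpW hpW')⟩, fun W hW => ?_⟩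
  obtain ⟨hWs, hW4⟩ := hV.maximal_iff.1 hW
  obtain ⟨τ⟩ := hV.nonempty_triality
  obtain ⟨M, hM⟩ := τ.type_rotation
  obtain ⟨σ, M', hσ, -, htype⟩ := Triality.RotatesFrom.exists_symm hV (τ := τ) (M := M) hM
  let m : Element Q := ⟨W, hWs, Or.inr (Or.inr hW4)⟩
  by_cases hmM : SameType 4 M.1 m.1
  · refine exists_le_of_ncard (m := m) hV hσ hΩ hperp hcard hW4 ?_
    rwa [htype m hW4, not_not]
  · exact exists_le_of_ncard (m := m) hV hM hΩ hperp hcard hW4 hmM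

omit [Finite K] in
-- The point `⟨v⟩` is the image of a solid. That solid contains a member of the ovoid, whose image
-- contains `v`.
theorem IsOvoid.exists_mem_image (h : τ.RotatesFrom M) (hV : IsOPlusSpace 4 Q)
    (hΩ : IsOvoid Q Ω) {v : V} (hv : v ≠ 0) (hQ : Q v = 0) : ∃ W ∈ τ.image Ω, v ∈ W := by
  obtain ⟨m, hm⟩ := τ.toPerm.surjective
    (pointElement (isSingularPoint_iff.2 ⟨v, hv, hQ, rfl⟩))
  have hm1 : (τ.toPerm m).dim = 1 := by
    rw [hm]
    exact finrank_span_singleton hv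
  obtain ⟨p, hp, hpm⟩ := hΩ.2 m.1 (hV.maximal_iff.2 ⟨m.2.1, ((h.2 m).2.2.2 hm1).1⟩)
  have hpp := hΩ.1.1 p hp
  refine ⟨_, ⟨pointElement hpp, hp, rfl⟩,
    (point_le_iff h (x := pointElement hpp) hpp.2 hm1).1 hpm ?_⟩
  rw [hm]
  exact mem_span_singleton_self v

theorem IsOvoid.ncard_eq (hV : IsOPlusSpace 4 Q) (hΩ : IsOvoid Q Ω) :
    Ω.ncard = Nat.card K ^ 3 + 1 := by
  obtain ⟨τ⟩ := hV.nonempty_triality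
  obtain ⟨M, hM⟩ := τ.type_rotation
  have h1 := ncard_image_mul (τ := τ) (M := M) hV hM hΩ.1.1 hΩ.eq_of_perp
  have h2 : {v : V | v ≠ 0 ∧ v ∈ (⊤ : Submodule K V) ∧ ∃ W ∈ τ.image Ω, v ∈ W} =
      {v : V | v ≠ 0 ∧ Q v = 0} := by
    ext v
    constructor
    · rintro ⟨hv, -, _, ⟨x, hx, rfl⟩, hvx⟩
      exact ⟨hv, (τ.toPerm x).2.1 v hvx⟩
    · rintro ⟨hv, hQ⟩
      exact ⟨hv, mem_top, hΩ.exists_mem_image (τ := τ) (M := M) hM hV hv hQ⟩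
  rw [h2, hV.ncard_singular] at h1
  have h3 := one_lt_card_pow (K := K) (d := 4) (by norm_num)
  exact (Nat.eq_of_mul_eq_mul_right (by omega) h1).symm

/-- The image of `a` is a solid whose nonzero vectors are covered by the disjoint images of the
members of `Ω`. Only members perpendicular to `a` contribute, each in a line, so their number is
`(q⁴ - 1) / (q² - 1)`. -/
theorem IsOvoid.ncard_perpInter (hV : IsOPlusSpace 4 Q) (hΩ : IsOvoid Q Ω)
    {a : Submodule K V} (ha : IsSingularPoint Q a) (haΩ : a ∉ Ω) :
    (perpInter Q Ω a).ncard = Nat.card K ^ 2 + 1 := by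
  obtain ⟨τ⟩ := hV.nonempty_triality
  obtain ⟨M, hM⟩ := τ.type_rotation
  have h : τ.RotatesFrom M := hM
  have hP : ∀ p ∈ perpInter Q Ω a, IsSingularPoint Q p := fun p hp => hΩ.1.1 p hp.1
  have h1 := ncard_covered (S := τ.image (perpInter Q Ω a)) (A := (τ.toPerm (pointElement ha)).1)
    (d := 2) (by
      rintro _ ⟨x, hx, rfl⟩
      refine h.finrank_inf hV (hP _ hx).2 ha.2 ?_ hx.2
      rintro rfl
      exact haΩ hx.1)
    (pairwise_inf_eq_bot_image hV h hP fun p hp p' hp' =>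
      hΩ.eq_of_perp p hp.1 p' hp'.1)
  have h2 : {v : V | v ≠ 0 ∧ v ∈ (τ.toPerm (pointElement ha)).1 ∧
      ∃ W ∈ τ.image (perpInter Q Ω a), v ∈ W} =
      {v : V | v ≠ 0 ∧ v ∈ (τ.toPerm (pointElement ha)).1} := by
    ext v
    refine ⟨fun hv => ⟨hv.1, hv.2.1⟩, fun hv => ⟨hv.1, hv.2, ?_⟩⟩
    obtain ⟨_, ⟨x, hx, rfl⟩, hvx⟩ := hΩ.exists_mem_image h hV hv.1
      ((τ.toPerm (pointElement ha)).2.1 v hv.2)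
    refine ⟨_, ⟨x, ⟨hx, ?_⟩, rfl⟩, hvx⟩
    refine h.perp_of_inf_ne_bot hV (hΩ.1.1 _ hx).2 (y := pointElement ha) ha.2 fun hc => hv.1 ?_
    rw [← mem_bot K, ← hc]
    exact ⟨hvx, hv.2⟩
  have h4 : finrank K (τ.toPerm (pointElement ha)).1 = 4 := ((h.2 (pointElement ha)).1.1 ha.2).1
  rw [h2, ncard_nonzero, h4, τ.ncard_image hP] at h1
  have h5 := one_lt_card_pow (K := K) (d := 2) (by norm_num)
  refine Nat.eq_of_mul_eq_mul_right (by omega : 0 < Nat.card K ^ 2 - 1) ?_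
  rw [← h1, show Nat.card K ^ 4 = (Nat.card K ^ 2) ^ 2 by ring]
  exact Nat.sq_sub_sq (Nat.card K ^ 2) 1

omit [Finite K] [FiniteDimensional K V] in
theorem exchange_points {a : Submodule K V} (hΩ : IsOvoid Q Ω) (ha : IsSingularPoint Q a) :
    ∀ p ∈ exchange Q Ω a, IsSingularPoint Q p := by
  rintro p (⟨hp, -⟩ | rfl)
  · exact hΩ.1.1 p hp
  · exact ha

omit [Finite K] in
theorem exchange_eq_of_perp {a : Submodule K V} (hΩ : IsOvoid Q Ω) :
    ∀ p ∈ exchange Q Ω a, ∀ p' ∈ exchange Q Ω a, p ≤ perp Q p' → p = p' := by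
  rintro p (⟨hp, hpa⟩ | rfl) p' (⟨hp', hpa'⟩ | rfl) hpp
  · exact hΩ.eq_of_perp p hp p' hp' hpp
  · exact absurd ⟨hp, hpp⟩ hpa
  · exact absurd ⟨hp', le_perp_comm.1 hpp⟩ hpa'
  · rfl

theorem ncard_exchange (hV : IsOPlusSpace 4 Q) (hΩ : IsOvoid Q Ω) {a : Submodule K V}
    (ha : IsSingularPoint Q a) (haΩ : a ∉ Ω) :
    ((exchange Q Ω a).ncard : ℤ) = (Nat.card K : ℤ) ^ 3 - (Nat.card K : ℤ) ^ 2 + 1 := by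
  have := Module.finite_of_finite K (M := V)
  have hsub : perpInter Q Ω a ⊆ Ω := fun p hp => hp.1
  have h1 := Set.ncard_sdiff_add_ncard_of_subset hsub
  rw [hΩ.ncard_eq hV, hΩ.ncard_perpInter hV ha haΩ] at h1
  rw [exchange, Set.ncard_union_eq (by
    rw [Set.disjoint_singleton_right]
    exact fun hc => haΩ hc.1), Set.ncard_singleton]
  have h2 : ((Ω \ perpInter Q Ω a).ncard : ℤ) + (Nat.card K ^ 2 + 1) = Nat.card K ^ 3 + 1 := by
    exact_mod_cast h1
  push_cast
  linarith

/-- No totally singular solid is disjoint from all members of the exchanged spread. -/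
theorem not_disjoint_image_exchange (hV : IsOPlusSpace 4 Q) (h : τ.RotatesFrom M)
    (hΩ : IsOvoid Q Ω) {a : Submodule K V} (ha : IsExchangePoint Q Ω a) {E : Element Q}
    (hE : E.dim = 4) (hdisj : ∀ U ∈ τ.image (exchange Q Ω a), E.1 ⊓ U = ⊥) : False := by
  have := Module.finite_of_finite K (M := V)
  have hne : ∀ F : Element Q, F.dim = 4 → F.1 ≠ ⊥ := by
    intro F hF hc
    have h1 : finrank K F.1 = 4 := hF
    rw [hc, finrank_bot] at h1
    omega
  have haS := ha.isSingularPoint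
  by_cases hEM : SameType 4 M.1 E.1
  swap
  -- A solid disjoint from the image of `a` meets it in even dimension, so it cannot have the other
  -- type.
  · have h1 := (h.2 (pointElement haS)).1.1 haS.2
    have h2 := sameType_parity hV h.1 hE h1.1
    have h3 : E.1 ⊓ (τ.toPerm (pointElement haS)).1 = ⊥ := hdisj _ ⟨pointElement haS, Or.inr rfl, rfl⟩
    have h4 : SameType 4 E.1 (τ.toPerm (pointElement haS)).1 := by
      rw [SameType, h3, finrank_bot]
      decide
    tauto
  -- A solid of the type of the images is itself the image of a point, so disjointness becomes
  -- nonperpendicularity of points.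
  obtain ⟨b, rfl⟩ := τ.toPerm.surjective E
  have hb : b.dim = 1 := (h.2 b).1.2 ⟨hE, hEM⟩
  have hkey : ∀ x : Element Q, x.1 ∈ exchange Q Ω a → x.dim = 1 → ¬ x.1 ≤ perp Q b.1 := by
    intro x hx hx1 hperp
    have h1 := hdisj _ ⟨x, hx, rfl⟩
    by_cases hxb : x = b
    · rw [hxb, inf_idem] at h1
      exact hne _ hE h1
    · have h2 := h.finrank_inf hV hx1 hb hxb hperp
      rw [inf_comm, h1, finrank_bot] at h2
      omega
  have hsub : perpInter Q Ω b.1 ⊆ perpInter Q Ω a := by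
    rintro p ⟨hp, hpb⟩
    by_contra hpa
    exact hkey (pointElement (hΩ.1.1 p hp)) (Or.inl ⟨hp, hpa⟩) (hΩ.1.1 p hp).2 hpb
  have hba : ¬ b.1 ≤ perp Q a := fun hc =>
    hkey (pointElement haS) (Or.inr rfl) haS.2 (le_perp_comm.1 hc)
  have hbΩ : b.1 ∉ Ω := fun hc => hba (hsub ⟨hc, b.2.1.le_perp⟩).2
  have hbS : IsSingularPoint Q b.1 := ⟨b.2.1, hb⟩
  -- Neither `a` nor `b` lies in `Ω`, so both sets have `q² + 1` elements and the inclusion is an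
  -- equality.
  have heq : perpInter Q Ω b.1 = perpInter Q Ω a := by
    refine Set.eq_of_subset_of_ncard_le hsub ?_
    rw [hΩ.ncard_perpInter hV haS ha.notMem, hΩ.ncard_perpInter hV hbS hbΩ]
  have h1 : b.1 = a := by
    refine ha.unique b.1 hbS ?_
    rw [le_perp_comm, ← heq]
    exact sSup_le fun p hp => hp.2
  exact hba (h1 ▸ b.2.1.le_perp)

theorem maximal_orthogonal_image_exchange (hV : IsOPlusSpace 4 Q) (h : τ.RotatesFrom M)
    (hΩ : IsOvoid Q Ω) {a : Submodule K V} (ha : IsExchangePoint Q Ω a) :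
    Maximal (IsOrthogonalPartialSpread 4 Q) (τ.image (exchange Q Ω a)) := by
  refine ⟨isOrthogonalPartialSpread_image hV h (exchange_points hΩ ha.isSingularPoint)
    (exchange_eq_of_perp hΩ), fun T hT hle W hW => ?_⟩
  by_contra hWS
  refine not_disjoint_image_exchange hV h hΩ ha
    (E := ⟨W, hT.2 W hW, Or.inr (Or.inr (hT.1.1 W hW))⟩) (hT.1.1 W hW) fun U hU => ?_
  refine hT.1.2 W hW U (hle hU) ?_
  rintro rfl
  exact hWS hU

/-- In characteristic two, the singular vectors of a totally isotropic subspace form a subspace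
of codimension at most one. -/
theorem exists_singular_hyperplane [CharP K 2] {W : Submodule K V}
    (hW : IsTotallyIsotropic Q.polarBilin W) :
    ∃ H ≤ W, IsTotallySingular Q H ∧ finrank K W ≤ finrank K H + 1 := by
  let H : Submodule K V :=
    { carrier := {x | x ∈ W ∧ Q x = 0}
      add_mem' := by
        rintro x y ⟨hx, hQx⟩ ⟨hy, hQy⟩
        refine ⟨add_mem hx hy, ?_⟩
        rw [map_add_polar, hQx, hQy, hW x hx y hy, zero_add, zero_add]
      zero_mem' := ⟨zero_mem _, QuadraticMap.map_zero Q⟩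
      smul_mem' := by
        rintro c x ⟨hx, hQx⟩
        exact ⟨smul_mem _ _ hx, by rw [QuadraticMap.map_smul, hQx, smul_zero]⟩ }
  have hHW : H ≤ W := fun x hx => hx.1
  refine ⟨H, hHW, fun x hx => hx.2, ?_⟩
  by_cases hWs : ∀ x ∈ W, Q x = 0
  · have : W ≤ H := fun x hx => ⟨hx, hWs x hx⟩
    exact (finrank_mono this).trans (Nat.le_succ _)
  push Not at hWs
  obtain ⟨x, hx, hQx⟩ := hWs
  have hle : W ≤ H ⊔ span K {x} := by
    intro y hy
    -- On `W` the form `Q` is additive, and every scalar is a square: with `c² = Q(y) / Q(x)` the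
    -- vector `y + c x` is singular because the two terms cancel in characteristic two.
    obtain ⟨c, hc⟩ := FiniteField.isSquare_of_char_two (ringChar.eq_iff.2 inferInstance) (Q y / Q x)
    have hmem : y + c • x ∈ H := by
      refine ⟨add_mem hy (smul_mem _ _ hx), ?_⟩
      rw [map_add_polar, QuadraticMap.map_smul, map_smul, hW y hy x hx, smul_zero, add_zero,
        ← hc, smul_eq_mul, div_mul_cancel₀ _ hQx, CharTwo.add_self_eq_zero]
    have : y = (y + c • x) + (-c) • x := by module
    rw [this]
    exact add_mem (mem_sup_left hmem) (mem_sup_right (smul_mem _ _ (mem_span_singleton_self x)))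
  have h1 := finrank_mono hle
  have h2 := finrank_inf_add_finrank_sup H (span K {x})
  have h3 : finrank K (span K {x}) ≤ 1 := finrank_span_le_card {x} |>.trans (by simp)
  omega

omit [Finite K] in
/-- Totally singular `3`-spaces are contained in solids of both types. -/
theorem exists_solid_of_type (hV : IsOPlusSpace 4 Q) (hM : M.dim = 4) {H : Submodule K V}
    (hH : IsTotallySingular Q H) (hH3 : finrank K H = 3) :
    ∃ E : Element Q, E.dim = 4 ∧ SameType 4 M.1 E.1 ∧ H ≤ E.1 := by
  obtain ⟨U, hHU, hmax⟩ := exists_maximal_ge hH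
  obtain ⟨hU, hU4⟩ := hV.maximal_iff.1 hmax
  let F : Element Q := ⟨U, hU, Or.inr (Or.inr hU4)⟩
  by_cases hF : SameType 4 M.1 F.1
  · exact ⟨F, hU4, hF, hHU⟩
  obtain ⟨U', hU', hU'4, hUU'⟩ := hV.exists_complement hU hU4
  have d1 := hV.finrank_perp H
  have d2 := finrank_inf_add_finrank_sup (perp Q H) U'
  have d3 := finrank_le (perp Q H ⊔ U')
  rw [hV.finrank_eq] at d3
  -- `H^⊥` has dimension `5` and `U'` dimension `4` in an `8`-space, so they share a singular vector
  -- outside `U`. The solid through it adjacent to `U` keeps `H` and has the other type.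
  obtain ⟨z, hz, hz0⟩ := exists_mem_ne_zero_of_ne_bot (p := perp Q H ⊓ U') (by
    intro hc
    rw [hc, finrank_bot] at d2
    omega)
  have hzU : z ∉ U := fun hc => hz0 ((mem_bot K).1 (hUU' ▸ mem_inf.2 ⟨hc, hz.2⟩))
  obtain ⟨Y, hY, hY4, -, hYU, hle⟩ := hV.exists_adjacent hU hU4 (hU' z hz.2) hzU
  let E : Element Q := ⟨Y, hY, Or.inr (Or.inr hY4)⟩
  refine ⟨E, hY4, ?_, le_trans (le_inf hHU ?_) hle⟩
  · have h1 := sameType_parity hV (x := M) (y := E) (z := F) hM hY4 hU4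
    have h2 : ¬ SameType 4 E.1 F.1 := by
      change ¬ finrank K (Y ⊓ U : Submodule K V) ≡ 4 [MOD 2]
      unfold Nat.ModEq
      omega
    tauto
  · rw [le_perp_comm, span_singleton_le_iff_mem]
    exact hz.1

theorem maximal_symplectic_image_exchange [CharP K 2] (hV : IsOPlusSpace 4 Q)
    (h : τ.RotatesFrom M) (hΩ : IsOvoid Q Ω) {a : Submodule K V} (ha : IsExchangePoint Q Ω a) :
    Maximal (IsSymplecticPartialSpread 4 Q.polarBilin) (τ.image (exchange Q Ω a)) := by
  have hS := isOrthogonalPartialSpread_image hV h (exchange_points hΩ ha.isSingularPoint)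
    (exchange_eq_of_perp hΩ)
  refine ⟨⟨hS.1, fun W hW x hx y hy => (hS.2 W hW).polar_eq_zero hx hy⟩,
    fun T hT hle W hW => ?_⟩
  by_contra hWS
  have hW4 := hT.1.1 W hW
  have hdisj : ∀ U ∈ τ.image (exchange Q Ω a), W ⊓ U = ⊥ := fun U hU =>
    hT.1.2 W hW U (hle hU) (by rintro rfl; exact hWS hU)
  obtain ⟨H, hHW, hH, hHd⟩ := exists_singular_hyperplane (hT.2 W hW)
  have hHd' := hV.finrank_le hH
  by_cases hH4 : finrank K H = 4
  · have hWH : H = W := eq_of_le_of_finrank_eq hHW (by omega)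
    exact not_disjoint_image_exchange hV h hΩ ha
      (E := ⟨H, hH, Or.inr (Or.inr hH4)⟩) hH4 fun U hU => hWH.symm ▸ hdisj U hU
  -- Here `H` has dimension `3`. A solid `E ≥ H` of the type of the images meets each image in even
  -- dimension. Since the hyperplane `H` of `E` misses the image, that dimension is at most one,
  -- hence zero.
  obtain ⟨E, hE4, hEM, hHE⟩ := exists_solid_of_type hV h.1 hH (by omega)
  refine not_disjoint_image_exchange hV h hΩ ha hE4 fun U hU => ?_
  have hU' := hU
  obtain ⟨x, hx, rfl⟩ := hU'
  obtain ⟨hx4, hxM⟩ := (h.2 x).1.1 (exchange_points hΩ ha.isSingularPoint _ hx).2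
  have hs := (sameType_parity hV h.1 hE4 hx4).1 (iff_of_true hEM hxM)
  unfold SameType Nat.ModEq at hs
  have d1 := finrank_inf_add_finrank_sup H (E.1 ⊓ (τ.toPerm x).1)
  have d2 : finrank K (H ⊔ (E.1 ⊓ (τ.toPerm x).1) : Submodule K V) ≤ finrank K E.1 :=
    finrank_mono (sup_le hHE inf_le_left)
  have d3 : finrank K E.1 = 4 := hE4
  have e1 : H ⊓ (E.1 ⊓ (τ.toPerm x).1) = ⊥ := by
    rw [eq_bot_iff, ← hdisj _ hU]
    exact le_inf (inf_le_left.trans hHW) (inf_le_right.trans inf_le_right)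
  rw [e1, finrank_bot] at d1
  rw [← finrank_eq_zero (R := K)]
  omega

end Ovoids

/-! ### Trace and norm of a cubic extension, and the form `ad + T(βγ)`. -/

section DesarguesianForm

variable {K : Type u} [Field K] {F : Type w} [Field F] [Algebra K F]

theorem desarguesianForm_polar (a d a' d' : K) (β γ β' γ' : F) :
    (desarguesianForm K F).polarBilin (a, β, γ, d) (a', β', γ', d') =
      a * d' + a' * d + Algebra.trace K F (β * γ' + β' * γ) := by
  have h := map_add_polar (desarguesianForm K F) (a, β, γ, d) (a', β', γ', d')
  simp only [Prod.mk_add_mk, desarguesianForm_apply, add_mul, mul_add, map_add] at h ⊢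
  linear_combination -h

variable [Finite K] (hF : finrank K F = 3)
include hF

theorem algebraMap_norm_cubic (t : F) :
    algebraMap K F (Algebra.norm K t) = t * t ^ Nat.card K * t ^ Nat.card K ^ 2 := by
  have : FiniteDimensional K F := finite_of_finrank_pos (by omega)
  have := Module.finite_of_finite K (M := F)
  rw [FiniteField.algebraMap_norm_eq_prod_pow, hF]
  simp [Finset.prod_range_succ]

theorem algebraMap_norm_eq_mul (t : F) :
    algebraMap K F (Algebra.norm K t) = t * t ^ (Nat.card K + Nat.card K ^ 2) := by
  rw [algebraMap_norm_cubic hF, pow_add, mul_assoc]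

theorem algebraMap_trace_cubic (t : F) :
    algebraMap K F (Algebra.trace K F t) = t + t ^ Nat.card K + t ^ Nat.card K ^ 2 := by
  have : FiniteDimensional K F := finite_of_finrank_pos (by omega)
  have := Module.finite_of_finite K (M := F)
  rw [FiniteField.algebraMap_trace_eq_sum_pow, hF]
  simp [Finset.sum_range_succ]

/-- Expand the product of the three conjugates of `s + t`: the mixed terms form two Frobenius
orbits, each summing to a trace. -/
theorem norm_add_cubic (s t : F) :
    Algebra.norm K (s + t) = Algebra.norm K s + Algebra.norm K t +
      Algebra.trace K F (s * t ^ (Nat.card K + Nat.card K ^ 2) +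
        t * s ^ (Nat.card K + Nat.card K ^ 2)) := by
  have hfd : FiniteDimensional K F := finite_of_finrank_pos (by omega)
  have := Module.finite_of_finite K (M := F)
  have := Fintype.ofFinite K
  have := Fintype.ofFinite F
  have hadd : ∀ x y : F, (x + y) ^ Nat.card K = x ^ Nat.card K + y ^ Nat.card K := by
    intro x y
    have := map_add (FiniteField.frobeniusAlgHom K F) x y
    simpa [← Nat.card_eq_fintype_card] using this
  have hcube : ∀ x : F, ((x ^ Nat.card K) ^ Nat.card K) ^ Nat.card K = x := by
    intro x
    rw [← pow_mul, ← pow_mul, ← pow_two, ← pow_succ', show 2 + 1 = finrank K F from hF.symm,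
      ← Module.natCard_eq_pow_finrank,
      Nat.card_eq_fintype_card, FiniteField.pow_card]
  apply (algebraMap K F).injective
  simp only [map_add, algebraMap_norm_cubic hF, algebraMap_trace_cubic hF, pow_add, mul_pow,
    pow_two (Nat.card K), pow_mul, hadd, hcube]
  ring

theorem isOPlusSpace_desarguesianForm : IsOPlusSpace 4 (desarguesianForm K F) := by
  have hfd : FiniteDimensional K F := finite_of_finrank_pos (by omega)
  refine ⟨by simp [hF], ?_, ?_⟩
  · suffices hl : ∀ x, (∀ y, (desarguesianForm K F).polarBilin x y = 0) → x = 0 from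
      ⟨hl, fun y h => hl y fun x => by rw [polarBilin_comm]; exact h x⟩
    rintro ⟨a, β, γ, d⟩ h
    have h1 := h (0, 0, 0, 1)
    have h2 := h (1, 0, 0, 0)
    have h3 : ∀ δ, Algebra.trace K F (β * δ) = 0 := fun δ => by
      simpa only [desarguesianForm_polar, mul_zero, zero_mul, add_zero, zero_add] using h (0, 0, δ, 0)
    have h4 : ∀ δ, Algebra.trace K F (γ * δ) = 0 := fun δ => by
      simpa only [desarguesianForm_polar, mul_zero, zero_mul, add_zero, zero_add,
        mul_comm γ δ] using h (0, δ, 0, 0)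
    have h5 := (traceForm_nondegenerate K F).1 β h3
    have h6 := (traceForm_nondegenerate K F).1 γ h4
    simp only [desarguesianForm_polar, mul_zero, mul_one, zero_mul, one_mul, add_zero, zero_add,
      map_zero] at h1 h2
    rw [h1, h2, h5, h6]
    rfl
  · let f : (K × F) →ₗ[K] (K × F × F × K) :=
      LinearMap.prod (LinearMap.fst K K F) (LinearMap.prod (LinearMap.snd K K F) 0)
    refine ⟨LinearMap.range f, ?_, ?_⟩
    · rintro _ ⟨⟨a, β⟩, rfl⟩
      change desarguesianForm K F (a, β, 0, 0) = 0
      simp [desarguesianForm_apply]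
    · rw [LinearMap.finrank_range_of_inj]
      · simp [hF]
      · rintro ⟨a, β⟩ ⟨a', β'⟩ h
        exact Prod.ext (congrArg (fun x : K × F × F × K => x.1) h)
          (congrArg (fun x : K × F × F × K => x.2.1) h)

omit hF in
theorem exists_cubic_extension (K : Type u) [Field K] [Finite K] :
    ∃ (F : Type u) (_ : Field F) (_ : Algebra K F), finrank K F = 3 := by
  obtain ⟨p, hp⟩ := CharP.exists K
  have : Fact p.Prime := ⟨CharP.char_is_prime K p⟩
  -- The lift places the extension in the universe of `K`, as `IsDesarguesianOvoid` demands.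
  refine ⟨ULift.{u} (FiniteField.Extension K p 3), inferInstance, inferInstance, ?_⟩
  rw [finrank_ulift]
  exact FiniteField.finrank_extension K p 3

/-- A generator of a cubic extension. -/
theorem exists_cubic_generator :
    ∃ θ : F, ∀ a b c : K, a • (1 : F) + b • θ + c • θ ^ 2 = 0 → a = 0 ∧ b = 0 ∧ c = 0 := by
  have hfd : FiniteDimensional K F := finite_of_finrank_pos (by omega)
  let pb := Field.powerBasisOfFiniteOfSeparable K F
  have hdim : pb.dim = 3 := by rw [← pb.finrank, hF]
  refine ⟨pb.gen, fun a b c h => ?_⟩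
  have hli := pb.basis.linearIndependent
  rw [pb.coe_basis] at hli
  have hli' : LinearIndependent K fun i : Fin 3 => pb.gen ^ (i : ℕ) := by
    have := hli.comp (Fin.cast hdim.symm) (Fin.cast_injective _)
    exact this
  have := Fintype.linearIndependent_iff.1 hli' ![a, b, c] (by
    rw [Fin.sum_univ_three]
    simpa using h)
  exact ⟨this 0, this 1, this 2⟩

/-- The orthogonal of the plane `⟨1, θ⟩` under the nondegenerate trace form on a 3-space is a line.
A generator of it is the nonzero coordinate of the exchange point. -/
theorem finrank_trace_orthogonal {θ : F}
    (hθ : ∀ a b c : K, a • (1 : F) + b • θ + c • θ ^ 2 = 0 → a = 0 ∧ b = 0 ∧ c = 0) :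
    ∃ β : F, β ≠ 0 ∧ Algebra.trace K F β = 0 ∧ Algebra.trace K F (β * θ) = 0 ∧
      ∀ b : F, Algebra.trace K F b = 0 → Algebra.trace K F (b * θ) = 0 → ∃ k : K, b = k • β := by
  have hfd : FiniteDimensional K F := finite_of_finrank_pos (by omega)
  have hli : LinearIndependent K ![1, θ] := by
    rw [LinearIndependent.pair_iff]
    intro a b hab
    have := hθ a b 0 (by rw [hab, zero_smul, zero_add])
    exact ⟨this.1, this.2.1⟩
  have h1 := finrank_span_eq_card hli
  have h2 := LinearMap.BilinForm.finrank_orthogonal (traceForm_nondegenerate K F)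
    (span K (Set.range ![1, θ]))
  rw [h1, hF, Fintype.card_fin] at h2
  have hmem : ∀ b : F, b ∈ LinearMap.BilinForm.orthogonal (Algebra.traceForm K F)
      (span K (Set.range ![1, θ])) ↔
      Algebra.trace K F b = 0 ∧ Algebra.trace K F (b * θ) = 0 := by
    intro b
    rw [LinearMap.BilinForm.mem_orthogonal_iff]
    constructor
    · intro h
      have e1 : Algebra.trace K F (1 * b) = 0 := h 1 (subset_span ⟨0, rfl⟩)
      have e2 : Algebra.trace K F (θ * b) = 0 := h θ (subset_span ⟨1, rfl⟩)
      rw [one_mul] at e1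
      rw [mul_comm] at e2
      exact ⟨e1, e2⟩
    · rintro ⟨e1, e2⟩ n hn
      change Algebra.trace K F (n * b) = 0
      have : span K (Set.range ![1, θ]) ≤
          LinearMap.ker ((Algebra.traceForm K F).flip b) := by
        rw [span_le]
        rintro _ ⟨i, rfl⟩
        fin_cases i
        · simpa [Algebra.traceForm_apply] using e1
        · simpa [Algebra.traceForm_apply, mul_comm] using e2
      exact this hn
  obtain ⟨⟨β, hβ⟩, hβ0, hall⟩ := finrank_eq_one_iff'.1 h2
  refine ⟨β, fun hc => hβ0 (Subtype.ext hc), ((hmem β).1 hβ).1, ((hmem β).1 hβ).2,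
    fun b hb hb' => ?_⟩
  obtain ⟨k, hk⟩ := hall ⟨b, (hmem b).2 ⟨hb, hb'⟩⟩
  exact ⟨k, (congrArg Subtype.val hk).symm⟩

/-- `1`, `θ⁻¹`, `(1 + θ)⁻¹` are a basis: multiplying a relation by `θ (1 + θ)` gives a relation
between `1`, `θ`, `θ²`. So `c` is trace-orthogonal to everything. -/
theorem eq_zero_of_trace_inv_eq_zero {θ : F}
    (hθ : ∀ a b c : K, a • (1 : F) + b • θ + c • θ ^ 2 = 0 → a = 0 ∧ b = 0 ∧ c = 0)
    {c : F} (h1 : Algebra.trace K F c = 0) (h2 : Algebra.trace K F (c * θ⁻¹) = 0)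
    (h3 : Algebra.trace K F (c * (1 + θ)⁻¹) = 0) : c = 0 := by
  have hfd : FiniteDimensional K F := finite_of_finrank_pos (by omega)
  have hθ0 : θ ≠ 0 := by
    rintro rfl
    exact one_ne_zero (hθ 0 1 0 (by simp)).2.1
  have hθ1 : 1 + θ ≠ 0 := fun hc =>
    one_ne_zero (hθ 1 1 0 (by rw [one_smul, one_smul, hc, zero_smul, zero_add])).1
  have hli : LinearIndependent K ![1, θ⁻¹, (1 + θ)⁻¹] := by
    rw [Fintype.linearIndependent_iff]
    intro g hg
    rw [Fin.sum_univ_three] at hg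
    simp only [Matrix.cons_val] at hg
    have hg' : g 1 • (1 : F) + (g 0 + g 1 + g 2) • θ + g 0 • θ ^ 2 = 0 := by
      have : (g 0 • (1 : F) + g 1 • θ⁻¹ + g 2 • (1 + θ)⁻¹) * (θ * (1 + θ)) = 0 := by
        rw [hg, zero_mul]
      simp only [Algebra.smul_def, map_add] at this ⊢
      field_simp at this
      linear_combination this
    obtain ⟨e1, e2, e3⟩ := hθ _ _ _ hg'
    intro i
    fin_cases i
    · exact e3
    · exact e1
    · simpa [e1, e3] using e2
  have htop := hli.span_eq_top_of_card_eq_finrank (by rw [hF, Fintype.card_fin])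
  refine (traceForm_nondegenerate K F).1 c fun y => ?_
  have hle : span K (Set.range ![1, θ⁻¹, (1 + θ)⁻¹]) ≤
      LinearMap.ker (Algebra.traceForm K F c) := by
    rw [span_le]
    rintro _ ⟨i, rfl⟩
    fin_cases i
    · simpa [Algebra.traceForm_apply] using h1
    · simpa [Algebra.traceForm_apply] using h2
    · simpa [Algebra.traceForm_apply] using h3
  exact hle (htop ▸ mem_top : y ∈ _)

end DesarguesianForm

/-! ### Perpendicularity between points of the desarguesian ovoid in even characteristic. -/

section DesarguesianOvoid

variable {K : Type u} [Field K] [Finite K] [CharP K 2] {F : Type w} [Field F] [Algebra K F]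
  (hF : finrank K F = 3)

/-- Vectors spanning the points of the desarguesian ovoid. -/
noncomputable def desarguesianVector (K : Type u) [Field K] {F : Type w} [Field F] [Algebra K F] :
    Option F → K × F × F × K
  | none => (0, 0, 0, 1)
  | some t => (1, t, t ^ (Nat.card K + Nat.card K ^ 2), Algebra.norm K t)

theorem desarguesianPoints_eq (K : Type u) [Field K] (F : Type w) [Field F] [Algebra K F] :
    desarguesianPoints K F = Set.range fun o : Option F => span K {desarguesianVector K o} := by
  ext p
  simp only [desarguesianPoints, Set.mem_union, Set.mem_singleton_iff, Set.mem_range,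
    Option.exists, desarguesianVector]
  exact or_congr_left eq_comm

include hF

/-- The value is `N(t) + T(N(t)) = 4 N(t)`, which vanishes in characteristic two. -/
theorem desarguesianForm_desarguesianVector (o : Option F) :
    desarguesianForm K F (desarguesianVector K o) = 0 := by
  rcases o with _ | t
  · simp [desarguesianVector, desarguesianForm_apply]
  · simp only [desarguesianVector, desarguesianForm_apply]
    have h2 : ((3 : ℕ) : K) = 1 := by
      rw [show (3 : ℕ) = 2 + 1 from rfl, Nat.cast_add, CharP.cast_eq_zero K 2, zero_add,
        Nat.cast_one]
    rw [← algebraMap_norm_eq_mul hF, Algebra.trace_algebraMap, hF, nsmul_eq_mul, h2, one_mul,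
      CharTwo.add_self_eq_zero]

/-- By `norm_add_cubic`, the polar form at the points of parameters `t` and `s` is `N(t + s)`, which
is zero only for `t = -s = s`. -/
theorem polar_desarguesianVector {o o' : Option F} :
    (desarguesianForm K F).polarBilin (desarguesianVector K o) (desarguesianVector K o') = 0 ↔
      o = o' := by
  have hfd : FiniteDimensional K F := finite_of_finrank_pos (by omega)
  have hchar : CharP F 2 := charP_of_injective_algebraMap (algebraMap K F).injective 2
  rcases o with _ | t <;> rcases o' with _ | s
  · simp only [desarguesianVector, desarguesianForm_polar]
    simp
  · simp only [desarguesianVector, desarguesianForm_polar]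
    simp
  · simp only [desarguesianVector, desarguesianForm_polar]
    simp
  · simp only [desarguesianVector, desarguesianForm_polar, one_mul]
    rw [add_comm (Algebra.norm K s), ← norm_add_cubic hF, Algebra.norm_eq_zero_iff,
      CharTwo.add_eq_zero, Option.some_inj]

/-- The point of the desarguesian ovoid with prescribed direction of its third coordinate. -/
theorem exists_pow_eq {u : F} (hu : u ≠ 0) :
    ∃ s : K, s ≠ 0 ∧ ∀ k : K, k ≠ 0 →
      (algebraMap K F (k * s) * u⁻¹) ^ (Nat.card K + Nat.card K ^ 2) = k ^ 2 • u := by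
  have hfd : FiniteDimensional K F := finite_of_finrank_pos (by omega)
  obtain ⟨s, hs⟩ := FiniteField.isSquare_of_char_two (ringChar.eq_iff.2 inferInstance)
    (Algebra.norm K u)
  have hN : Algebra.norm K u ≠ 0 := Algebra.norm_ne_zero_iff.2 hu
  have hs0 : s ≠ 0 := by
    rintro rfl
    exact hN (by rw [hs, mul_zero])
  refine ⟨s, hs0, fun k hk => ?_⟩
  have ht0 : algebraMap K F (k * s) * u⁻¹ ≠ 0 :=
    mul_ne_zero ((map_ne_zero _).2 (mul_ne_zero hk hs0)) (inv_ne_zero hu)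
  apply mul_left_cancel₀ ht0
  -- With `s² = N(u)` and `t = k s u⁻¹`, the norm is `k³ s³ / N(u)`; dividing it by `t` gives `t^(q
  -- + q²) = k² u`.
  have hnorm : Algebra.norm K (algebraMap K F (k * s) * u⁻¹) = k ^ 3 * s := by
    rw [map_mul, Algebra.norm_algebraMap, hF, Algebra.norm_inv, hs]
    field_simp
  rw [← algebraMap_norm_eq_mul hF, hnorm, Algebra.smul_def]
  simp only [map_mul, map_pow]
  field_simp

/-- The points `∞` and `t = 0` are perpendicular to `⟨(0, β, 0, 0)⟩` and kill the outer coordinates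
`a` and `d`. For `u` with `T(βu) = 0`, the points with `t = k s u⁻¹` give a polynomial in `k` with
linear coefficient `s T(c u⁻¹)` and quadratic coefficient `T(b u)`. Taking several `k` separates the
two conditions. -/
theorem mem_span_of_perp_desarguesianVector (hK : 2 < Nat.card K) {θ β : F}
    (hθ : ∀ a b c : K, a • (1 : F) + b • θ + c • θ ^ 2 = 0 → a = 0 ∧ b = 0 ∧ c = 0)
    (hβ1 : Algebra.trace K F β = 0) (hβθ : Algebra.trace K F (β * θ) = 0)
    (hall : ∀ b : F, Algebra.trace K F b = 0 → Algebra.trace K F (b * θ) = 0 →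
      ∃ k : K, b = k • β) {x : K × F × F × K}
    (hx : ∀ o : Option F, (desarguesianForm K F).polarBilin (0, β, 0, 0)
      (desarguesianVector K o) = 0 →
        (desarguesianForm K F).polarBilin (desarguesianVector K o) x = 0) :
    ∃ k : K, x = k • ((0 : K), β, (0 : F), (0 : K)) := by
  obtain ⟨a, b, c, d⟩ := x
  have hθ0 : θ ≠ 0 := by
    rintro rfl
    exact one_ne_zero (hθ 0 1 0 (by simp)).2.1
  have hθ1 : 1 + θ ≠ 0 := fun hc =>
    one_ne_zero (hθ 1 1 0 (by rw [one_smul, one_smul, hc, zero_smul, zero_add])).1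
  have ha : a = 0 := by
    have := hx none (by simp only [desarguesianVector, desarguesianForm_polar]; simp)
    simpa only [desarguesianVector, desarguesianForm_polar, zero_mul, mul_zero, mul_one, zero_add,
      map_zero, add_zero] using this
  have hsome : ∀ t : F, Algebra.trace K F (β * t ^ (Nat.card K + Nat.card K ^ 2)) = 0 →
      d + Algebra.trace K F (t * c + b * t ^ (Nat.card K + Nat.card K ^ 2)) = 0 := by
    intro t ht
    have := hx (some t) (by
      simpa only [desarguesianVector, desarguesianForm_polar, zero_mul, mul_zero, zero_add,
        add_zero] using ht)
    simpa only [desarguesianVector, desarguesianForm_polar, ha, one_mul, zero_mul, add_zero]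
      using this
  have hd : d = 0 := by
    have h0 : (0 : F) ^ (Nat.card K + Nat.card K ^ 2) = 0 := zero_pow (by omega)
    have := hsome 0 (by rw [h0, mul_zero, map_zero])
    rwa [h0, zero_mul, mul_zero, add_zero, map_zero, add_zero] at this
  -- The use of `q > 2`: the relation for this `k` is compared with the one for `k = 1`.
  obtain ⟨k, hk0, hk1⟩ : ∃ k : K, k ≠ 0 ∧ k ≠ 1 := by
    by_contra! hc
    have hsub : (Set.univ : Set K) ⊆ {0, 1} := fun k _ => by
      by_cases hk : k = 0
      · exact Or.inl hk
      · exact Or.inr (hc k hk)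
    have := Set.ncard_le_ncard hsub
    rw [Set.ncard_univ] at this
    exact absurd (this.trans (Set.ncard_pair zero_ne_one).le) (by omega)
  have key : ∀ u : F, u ≠ 0 → Algebra.trace K F (β * u) = 0 →
      Algebra.trace K F (b * u) = 0 ∧ Algebra.trace K F (c * u⁻¹) = 0 := by
    intro u hu hβu
    obtain ⟨s, hs0, hs⟩ := exists_pow_eq hF hu
    have hk : ∀ k : K, k ≠ 0 →
        k * s * Algebra.trace K F (c * u⁻¹) + k ^ 2 * Algebra.trace K F (b * u) = 0 := by
      intro k hk0
      have := hsome (algebraMap K F (k * s) * u⁻¹) (by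
        rw [hs k hk0, mul_smul_comm, map_smul, hβu, smul_zero])
      rw [hs k hk0, hd, zero_add, map_add, mul_smul_comm, map_smul, mul_assoc,
        ← Algebra.smul_def, map_smul, mul_comm u⁻¹ c] at this
      exact this
    have e1 := hk 1 one_ne_zero
    have e2 := hk k hk0
    have e3 : Algebra.trace K F (b * u) = 0 := by
      have : k * (k - 1) * Algebra.trace K F (b * u) = 0 := by linear_combination e2 - k * e1
      exact (mul_eq_zero.1 this).resolve_left (mul_ne_zero hk0 (sub_ne_zero.2 hk1))
    refine ⟨e3, ?_⟩
    rw [e3, mul_zero, add_zero, one_mul] at e1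
    exact (mul_eq_zero.1 e1).resolve_left hs0
  -- The values `u = 1, θ, 1 + θ` lie in the trace-orthogonal of `β`. Their inverses form a basis,
  -- which gives `c = 0`, while `u = 1, θ` already make `b` a multiple of `β`.
  have k1 := key 1 one_ne_zero (by rwa [mul_one])
  have k2 := key θ hθ0 hβθ
  have k3 := key (1 + θ) hθ1 (by rw [mul_add, mul_one, map_add, hβ1, hβθ, add_zero])
  rw [inv_one, mul_one, mul_one] at k1
  have hc := eq_zero_of_trace_inv_eq_zero hF hθ k1.2 k2.2 k3.2
  obtain ⟨l, hl⟩ := hall b k1.1 k2.1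
  refine ⟨l, ?_⟩
  rw [ha, hd, hc, hl]
  simp

end DesarguesianOvoid

/-! ### Transport of the desarguesian ovoid and its exchange point to an arbitrary space. -/

section DesarguesianExchange

variable {K : Type u} [Field K] [Finite K] [CharP K 2] {V : Type v} [AddCommGroup V] [Module K V]
  [FiniteDimensional K V] {Q : QuadraticForm K V}

omit [Finite K] [CharP K 2] in
theorem IsOPlusSpace.nonempty_isometryEquiv {V' : Type w} [AddCommGroup V'] [Module K V']
    [FiniteDimensional K V'] {n : ℕ} {Q' : QuadraticForm K V'} (h : IsOPlusSpace n Q)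
    (h' : IsOPlusSpace n Q') : Nonempty (Q'.IsometryEquiv Q) := by
  obtain ⟨e, he⟩ := h.exists_coordinates
  obtain ⟨e', he'⟩ := h'.exists_coordinates
  refine ⟨⟨e'.symm.trans e, fun x => ?_⟩⟩
  obtain ⟨⟨y, z⟩, rfl⟩ := e'.surjective x
  change Q (e (e'.symm (e' (y, z)))) = _
  rw [e'.symm_apply_apply, he, he']

theorem IsOPlusSpace.exists_desarguesian (hV : IsOPlusSpace 4 Q) (hK : 2 < Nat.card K) :
    ∃ (Ω : Set (Submodule K V)) (a : Submodule K V),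
      IsDesarguesianOvoid Q Ω ∧ IsOvoid Q Ω ∧ IsExchangePoint Q Ω a := by
  obtain ⟨F, _, _, hF⟩ := exists_cubic_extension K
  have hfd : FiniteDimensional K F := finite_of_finrank_pos (by omega)
  obtain ⟨e⟩ := hV.nonempty_isometryEquiv (isOPlusSpace_desarguesianForm hF)
  obtain ⟨θ, hθ⟩ := exists_cubic_generator hF
  obtain ⟨β, hβ0, hβ1, hβθ, hall⟩ := finrank_trace_orthogonal hF hθ
  have hQ : ∀ x, Q (e x) = desarguesianForm K F x := fun x => e.map_app x
  have hB : ∀ x y, Q.polarBilin (e x) (e y) = (desarguesianForm K F).polarBilin x y := by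
    intro x y
    have h1 := map_add_polar Q (e x) (e y)
    have h2 := map_add_polar (desarguesianForm K F) x y
    rw [← map_add, hQ, hQ, hQ, h2] at h1
    exact (add_left_cancel h1).symm
  have hne : ∀ o : Option F, e (desarguesianVector K o) ≠ 0 := by
    intro o ho
    have h1 : ∀ o', (desarguesianForm K F).polarBilin (desarguesianVector K o)
        (desarguesianVector K o') = 0 := fun o' => by
      rw [← hB, ho, map_zero, LinearMap.zero_apply]
    have h2 := (polar_desarguesianVector hF).1 (h1 none)
    have h3 := (polar_desarguesianVector hF).1 (h1 (some 0))
    rw [h2] at h3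
    exact absurd h3 (by simp)
  let Ω : Set (Submodule K V) := Set.range fun o : Option F => span K {e (desarguesianVector K o)}
  have hΩdes : IsDesarguesianOvoid Q Ω := by
    refine ⟨F, _, _, hF, e, ?_⟩
    rw [desarguesianPoints_eq, ← Set.range_comp]
    refine congrArg Set.range (funext fun o => ?_)
    exact (LinearMap.map_span (e.toLinearEquiv : (K × F × F × K) →ₗ[K] V)
      {desarguesianVector K o}).trans (by rw [Set.image_singleton]; rfl)
      |>.symm
  have hperp : ∀ o o' : Option F, span K {e (desarguesianVector K o)} ≤
      perp Q (span K {e (desarguesianVector K o')}) ↔ o = o' := by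
    intro o o'
    rw [span_singleton_le_iff_mem, mem_perp_span, hB, polar_desarguesianVector hF, eq_comm]
  have hsing : ∀ p ∈ Ω, IsSingularPoint Q p := by
    rintro _ ⟨o, rfl⟩
    refine isSingularPoint_iff.2 ⟨_, hne o, ?_, rfl⟩
    rw [hQ, desarguesianForm_desarguesianVector hF]
  have hinj : Function.Injective fun o : Option F => span K {e (desarguesianVector K o)} := by
    intro o o' h
    refine (hperp o o').1 ?_
    rw [show span K {e (desarguesianVector K o)} = span K {e (desarguesianVector K o')} from h]
    exact (hsing _ ⟨o', rfl⟩).1.le_perp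
  have hcard : Ω.ncard = Nat.card K ^ 3 + 1 := by
    have := Module.finite_of_finite K (M := F)
    rw [← hF, ← Module.natCard_eq_pow_finrank, ← Finite.card_option]
    exact Nat.card_range_of_injective hinj
  have hov : IsOvoid Q Ω := by
    refine isOvoid_of_ncard hV hsing ?_ hcard
    rintro _ ⟨o, rfl⟩ _ ⟨o', rfl⟩ h
    rw [(hperp o o').1 h]
  have hv0 : e ((0 : K), β, (0 : F), (0 : K)) ≠ 0 := by
    rw [Ne, EmbeddingLike.map_eq_zero_iff]
    intro hc
    exact hβ0 (congrArg (fun x => x.2.1) hc)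
  refine ⟨Ω, span K {e ((0 : K), β, (0 : F), (0 : K))}, hΩdes, hov, ?_, ?_, ?_⟩
  · refine isSingularPoint_iff.2 ⟨_, hv0, ?_, rfl⟩
    rw [hQ, desarguesianForm_apply, zero_mul, mul_zero, map_zero, add_zero]
  · rintro ⟨o, ho⟩
    have h1 : e ((0 : K), β, (0 : F), (0 : K)) ∈ span K {e (desarguesianVector K o)} :=
      ho.ge (mem_span_singleton_self _)
    obtain ⟨k, hk⟩ := mem_span_singleton.1 h1
    rw [← map_smul] at hk
    have hk' := e.injective hk
    rcases o with _ | t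
    · have h2 : k • (0 : F) = β := congrArg (fun x => x.2.1) hk'
      exact hβ0 (by rw [← h2, smul_zero])
    · have h2 : k • t = β := congrArg (fun x => x.2.1) hk'
      have h3 : k • (1 : K) = 0 := congrArg (fun x => x.1) hk'
      rw [smul_eq_mul, mul_one] at h3
      exact hβ0 (by rw [← h2, h3, zero_smul])
  · intro b hb hbp
    obtain ⟨y, hy0, hQy, rfl⟩ := isSingularPoint_iff.1 hb
    obtain ⟨x, rfl⟩ : ∃ x, e x = y := e.surjective y
    obtain ⟨k, rfl⟩ := mem_span_of_perp_desarguesianVector hF hK hθ hβ1 hβθ hall (x := x) (by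
      intro o ho
      have hmem : span K {e (desarguesianVector K o)} ∈
          perpInter Q Ω (span K {e ((0 : K), β, (0 : F), (0 : K))}) := by
        refine ⟨⟨o, rfl⟩, ?_⟩
        rw [span_singleton_le_iff_mem, mem_perp_span, hB]
        exact ho
      have h1 := hbp.trans (perp_anti (le_sSup hmem))
      rw [span_singleton_le_iff_mem, mem_perp_span, hB] at h1
      exact h1)
    rw [map_smul] at hy0 ⊢
    have hk : k ≠ 0 := by
      rintro rfl
      exact hy0 (zero_smul _ _)
    exact span_singleton_smul_eq (IsUnit.mk0 k hk) _

end DesarguesianExchange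

/-! ### Symmetric 4 × 4 matrices over the field with two elements. -/

section SymmetricMatrices

/-- The symmetric matrix with the given upper triangle. -/
def symMat {R : Type*} (a b c d e f g h i j : R) : Matrix (Fin 4) (Fin 4) R :=
  !![a, b, c, d; b, e, f, g; c, f, h, i; d, g, i, j]

theorem exists_eq_symMat {R : Type*} {M : Matrix (Fin 4) (Fin 4) R} (hM : M.IsSymm) :
    ∃ a b c d e f g h i j, M = symMat a b c d e f g h i j := by
  refine ⟨M 0 0, M 0 1, M 0 2, M 0 3, M 1 1, M 1 2, M 1 3, M 2 2, M 2 3, M 3 3, ?_⟩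
  ext r s
  fin_cases r <;> fin_cases s <;> first | rfl | exact hM.apply _ _

theorem symMat_isSymm {R : Type*} (a b c d e f g h i j : R) :
    (symMat a b c d e f g h i j).IsSymm := by
  ext r s
  fin_cases r <;> fin_cases s <;> rfl

theorem symMat_sub {R : Type*} [Ring R] (a b c d e f g h i j a' b' c' d' e' f' g' h' i' j' : R) :
    symMat a b c d e f g h i j - symMat a' b' c' d' e' f' g' h' i' j' =
      symMat (a - a') (b - b') (c - c') (d - d') (e - e') (f - f') (g - g') (h - h') (i - i')
        (j - j') := by
  ext r s
  fin_cases r <;> fin_cases s <;> rfl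

variable {K : Type*} [Field K] [CharP K 2]

/-- For a symmetric matrix, a permutation and its inverse contribute equal terms, which cancel in
characteristic two. Only the ten involutions (including the identity) remain, and the squares are
removed by `x² = x`. -/
theorem det_symMat (hK : ∀ x : K, x * x = x) (a b c d e f g h i j : K) :
    (symMat a b c d e f g h i j).det = a * e * h * j + b * h * j + c * e * j + d * e * h +
      f * a * j + g * a * h + i * a * e + b * i + c * g + d * f := by
  have h2 : (2 : K) = 0 := CharTwo.two_eq_zero
  simp only [symMat, Matrix.det_succ_row_zero, Fin.sum_univ_succ]
  simp [Fin.succAbove, Matrix.submatrix]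
  linear_combination (b * c * f * j + b * g * d * h + c * i * d * e + f * i * g * a
    - b * f * i * d - b * g * i * c - c * f * g * d - b * b * h * j - c * c * e * j
    - d * d * e * h - f * f * a * j - g * g * a * h - i * i * a * e) * h2
    + h * j * hK b + e * j * hK c + e * h * hK d + a * j * hK f + a * h * hK g + a * e * hK i
    + i * i * hK b + b * hK i + g * g * hK c + c * hK g + f * f * hK d + d * hK f

/-- For fixed `a, b, e, h, i, j` the determinant is `c g + d f` plus an affine function of `(c, d,
f, g)`. The four arguments form a translate of a plane on which `c g + d f` is anisotropic, so the
four values sum to the polar value `1` of two generators. They cannot all be `1`, since four ones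
sum to `0`. -/
theorem bool_symDet : ∀ a b c d e f g h i j : Bool,
    let D := fun c d f g : Bool =>
      ((a && e && h && j) ^^ (b && h && j) ^^ (c && e && j) ^^ (d && e && h) ^^ (f && a && j) ^^
        (g && a && h) ^^ (i && a && e) ^^ (b && i) ^^ (c && g) ^^ (d && f))
    D c d f g = false ∨ D c (!d) (!f) g = false ∨ D (!c) (!d) f (!g) = false ∨
      D (!c) d (!f) (!g) = false := by
  decide

/-- Four symmetric matrices with nonsingular differences. -/
def symFamily (K : Type*) [Field K] : Fin 4 → Matrix (Fin 4) (Fin 4) K :=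
  ![symMat 0 0 0 0 0 0 0 0 0 0, symMat 0 0 0 1 0 1 0 0 0 0, symMat 0 0 1 1 0 0 1 0 0 0,
    symMat 0 0 1 0 0 1 1 0 0 0]

omit [CharP K 2] in
theorem symFamily_isSymm (k : Fin 4) : (symFamily K k).IsSymm := by
  fin_cases k <;> exact symMat_isSymm _ _ _ _ _ _ _ _ _ _

/-- The differences have determinant `c g + d f`, and the four triples of corner entries form an
additive group on which this form is anisotropic. -/
theorem det_symFamily_sub (hK : ∀ x : K, x * x = x) {k l : Fin 4} (hkl : k ≠ l) :
    (symFamily K k - symFamily K l).det ≠ 0 := by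
  fin_cases k <;> fin_cases l <;> first
    | exact absurd rfl hkl
    | simp [symFamily, symMat_sub, det_symMat hK]

/-- The family of four matrices is maximal over the field with two elements. -/
theorem exists_det_sub_symFamily_eq_zero (hK : ∀ x : K, x = 0 ∨ x = 1)
    {M : Matrix (Fin 4) (Fin 4) K} (hM : M.IsSymm) : ∃ k, (M - symFamily K k).det = 0 := by
  have hK' : ∀ x : K, x * x = x := by
    intro x
    rcases hK x with rfl | rfl <;> simp
  let φ : Bool → K := fun b => if b then 1 else 0
  have hφ : ∀ x : K, ∃ b, x = φ b := by
    intro x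
    rcases hK x with rfl | rfl
    · exact ⟨false, rfl⟩
    · exact ⟨true, rfl⟩
  have hadd : ∀ x y, φ x + φ y = φ (x ^^ y) := by
    intro x y
    cases x <;> cases y <;> simp [φ, CharTwo.add_self_eq_zero]
  have hmul : ∀ x y, φ x * φ y = φ (x && y) := by
    intro x y
    cases x <;> cases y <;> simp [φ]
  have hnot : ∀ x, φ x - 1 = φ (!x) := by
    intro x
    cases x <;> simp [φ, CharTwo.neg_eq]
  obtain ⟨a, b, c, d, e, f, g, h, i, j, rfl⟩ := exists_eq_symMat hM
  obtain ⟨a, rfl⟩ := hφ a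
  obtain ⟨b, rfl⟩ := hφ b
  obtain ⟨c, rfl⟩ := hφ c
  obtain ⟨d, rfl⟩ := hφ d
  obtain ⟨e, rfl⟩ := hφ e
  obtain ⟨f, rfl⟩ := hφ f
  obtain ⟨g, rfl⟩ := hφ g
  obtain ⟨h, rfl⟩ := hφ h
  obtain ⟨i, rfl⟩ := hφ i
  obtain ⟨j, rfl⟩ := hφ j
  have h0 : φ false = 0 := rfl
  rcases bool_symDet a b c d e f g h i j with hD | hD | hD | hD
  · refine ⟨0, ?_⟩
    change (symMat _ _ _ _ _ _ _ _ _ _ - symMat (0 : K) 0 0 0 0 0 0 0 0 0).det = 0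
    rw [symMat_sub, det_symMat hK']
    simp only [sub_zero, hmul, hadd]
    exact (congrArg φ hD).trans h0
  · refine ⟨1, ?_⟩
    change (symMat _ _ _ _ _ _ _ _ _ _ - symMat (0 : K) 0 0 1 0 1 0 0 0 0).det = 0
    rw [symMat_sub, det_symMat hK']
    simp only [sub_zero, hnot, hmul, hadd]
    exact (congrArg φ hD).trans h0
  · refine ⟨2, ?_⟩
    change (symMat _ _ _ _ _ _ _ _ _ _ - symMat (0 : K) 0 1 1 0 0 1 0 0 0).det = 0
    rw [symMat_sub, det_symMat hK']
    simp only [sub_zero, hnot, hmul, hadd]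
    exact (congrArg φ hD).trans h0
  · refine ⟨3, ?_⟩
    change (symMat _ _ _ _ _ _ _ _ _ _ - symMat (0 : K) 0 1 0 0 1 1 0 0 0).det = 0
    rw [symMat_sub, det_symMat hK']
    simp only [sub_zero, hnot, hmul, hadd]
    exact (congrArg φ hD).trans h0

end SymmetricMatrices

/-! ### Maximal partial spreads of symplectic 8-spaces. -/

section SymplecticSpreads

variable {K : Type u} [Field K] {V : Type v} [AddCommGroup V] [Module K V]
  [FiniteDimensional K V] {n : ℕ}

/-- In characteristic two, a symplectic form is the polar form of a quadratic form of plus type. -/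
theorem IsSpSpace.exists_quadraticForm [CharP K 2] {B : LinearMap.BilinForm K V}
    (h : IsSpSpace n B) : ∃ Q : QuadraticForm K V, Q.polarBilin = B ∧ IsOPlusSpace n Q := by
  obtain ⟨e, he⟩ := h.exists_coordinates
  let β : LinearMap.BilinForm K V := (dotProductBilin K K).compl₁₂
    (LinearMap.fst K _ _ ∘ₗ e.symm.toLinearMap) (LinearMap.snd K _ _ ∘ₗ e.symm.toLinearMap)
  have hβ : ∀ x y, β x y = (e.symm x).1 ⬝ᵥ (e.symm y).2 := fun _ _ => rfl
  have hB : (LinearMap.BilinMap.toQuadraticMap β).polarBilin = B := by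
    ext x y
    have h1 := he (e.symm x).1 (e.symm x).2 (e.symm y).1 (e.symm y).2
    rw [Prod.mk.eta, Prod.mk.eta, e.apply_symm_apply, e.apply_symm_apply, CharTwo.sub_eq_add] at h1
    rw [LinearMap.BilinMap.polarBilin_toQuadraticMap, h1, LinearMap.add_apply,
      LinearMap.add_apply, LinearMap.flip_apply, hβ, hβ]
  refine ⟨_, hB, h.finrank_eq, hB ▸ h.nondegenerate,
    LinearMap.range (e.toLinearMap ∘ₗ LinearMap.inl K _ _), ?_, ?_⟩
  · rintro _ ⟨x, rfl⟩
    change β (e (x, 0)) (e (x, 0)) = 0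
    rw [hβ, e.symm_apply_apply, dotProduct_zero]
  · rw [LinearMap.finrank_range_of_inj, finrank_fin_fun]
    exact e.injective.comp LinearMap.inl_injective

/-- The maximal partial spread of the symplectic space of dimension eight over the field with
two elements. -/
theorem IsSpSpace.exists_maximal_of_card_two {B : LinearMap.BilinForm K V} (h : IsSpSpace 4 B)
    [CharP K 2] (hK : ∀ x : K, x = 0 ∨ x = 1) :
    ∃ S : Set (Submodule K V), Maximal (IsSymplecticPartialSpread 4 B) S ∧ S.ncard = 5 := by
  obtain ⟨e, he⟩ := h.exists_coordinates
  have hK' : ∀ x : K, x * x = x := by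
    intro x
    rcases hK x with rfl | rfl <;> simp
  -- `none` gives the solid `x = 0`, and `some k` the graph of the `k`-th symmetric matrix.
  let f : Option (Fin 4) → (Fin 4 → K) →ₗ[K] V := fun o => e.toLinearMap ∘ₗ
    o.elim (LinearMap.inr K _ _) fun k => LinearMap.prod LinearMap.id (symFamily K k).mulVecLin
  have hnone : ∀ y, f none y = e (0, y) := fun _ => rfl
  have hsome : ∀ k x, f (some k) x = e (x, (symFamily K k).mulVec x) := fun _ _ => rfl
  have hinj : ∀ o, Function.Injective (f o) := by
    rintro (_ | k) x y hxy
    · exact congrArg Prod.snd (e.injective hxy)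
    · exact congrArg Prod.fst (e.injective hxy)
  have hdim : ∀ o, finrank K (LinearMap.range (f o)) = 4 := fun o => by
    rw [LinearMap.finrank_range_of_inj (hinj o), finrank_fin_fun]
  have hdisj : ∀ o o', o ≠ o' → LinearMap.range (f o) ⊓ LinearMap.range (f o') = ⊥ := by
    have key : ∀ o o', o ≠ o' → ∀ x y, f o x = f o' y → f o x = 0 := by
      rintro (_ | k) (_ | l) hne x y hxy
      · exact absurd rfl hne
      · have h1 := e.injective hxy
        have h2 : 0 = y := congrArg Prod.fst h1
        have h3 : x = (symFamily K l).mulVec y := congrArg Prod.snd h1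
        rw [h3, ← h2, Matrix.mulVec_zero, map_zero]
      · have h1 := e.injective hxy
        have h2 : x = 0 := congrArg Prod.fst h1
        rw [h2, map_zero]
      · have h1 := e.injective hxy
        have h2 : x = y := congrArg Prod.fst h1
        have h3 : (symFamily K k).mulVec x = (symFamily K l).mulVec y := congrArg Prod.snd h1
        have h4 : x = 0 := by
          refine Matrix.eq_zero_of_mulVec_eq_zero
            (det_symFamily_sub hK' fun hc => hne (congrArg some hc)) ?_
          rw [Matrix.sub_mulVec, h3, h2, sub_self]
        rw [h4, map_zero]
    intro o o' hne
    rw [eq_bot_iff]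
    rintro _ ⟨⟨x, rfl⟩, ⟨y, hy⟩⟩
    exact (mem_bot K).2 (key o o' hne x y hy.symm)
  have hne : ∀ o, LinearMap.range (f o) ≠ ⊥ := fun o hc => by
    have := hdim o
    rw [hc, finrank_bot] at this
    omega
  have hrinj : Function.Injective fun o => LinearMap.range (f o) := by
    intro o o' hoo
    by_contra hc
    have h1 := hdisj o o' hc
    rw [show LinearMap.range (f o) = LinearMap.range (f o') from hoo, inf_idem] at h1
    exact hne o' h1
  have hB : ∀ x y x' y', B (e (x, y)) (e (x', y')) = 0 ↔ x ⬝ᵥ y' = x' ⬝ᵥ y := by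
    intro x y x' y'
    rw [he, sub_eq_zero]
  refine ⟨Set.range fun o => LinearMap.range (f o), ⟨⟨⟨?_, ?_⟩, ?_⟩, ?_⟩, ?_⟩
  · rintro _ ⟨o, rfl⟩
    exact hdim o
  · rintro _ ⟨o, rfl⟩ _ ⟨o', rfl⟩ hoo
    exact hdisj o o' fun hc => hoo (by rw [hc])
  · rintro _ ⟨_ | k, rfl⟩ _ ⟨x, rfl⟩ _ ⟨y, rfl⟩
    · rw [hnone, hnone, hB, zero_dotProduct, zero_dotProduct]
    · rw [hsome, hsome, hB, Matrix.dotProduct_mulVec, dotProduct_comm, ← Matrix.mulVec_transpose,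
        symFamily_isSymm k]
  · intro T hT hle W hW
    by_contra hWS
    have hWd : ∀ o, W ⊓ LinearMap.range (f o) = ⊥ := fun o =>
      hT.1.2 W hW _ (hle ⟨o, rfl⟩) (by rintro rfl; exact hWS ⟨o, rfl⟩)
    -- Since `W` misses the solid `x = 0`, the first coordinate is bijective on it and `W` is the
    -- graph of a linear map. Total isotropy makes its matrix symmetric.
    let p : W →ₗ[K] (Fin 4 → K) := LinearMap.fst K _ _ ∘ₗ e.symm.toLinearMap ∘ₗ W.subtype
    have hp : Function.Injective p := by
      rw [← LinearMap.ker_eq_bot, LinearMap.ker_eq_bot']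
      intro w hw
      have h1 : (w : V) ∈ W ⊓ LinearMap.range (f none) := by
        refine ⟨w.2, (e.symm w).2, ?_⟩
        rw [hnone, ← LinearEquiv.eq_symm_apply]
        exact Prod.ext hw.symm rfl
      rw [hWd none] at h1
      exact Subtype.ext h1
    let p' : W ≃ₗ[K] (Fin 4 → K) := LinearEquiv.ofInjectiveOfFinrankEq p hp (by
      rw [finrank_fin_fun]
      exact hT.1.1 W hW)
    let m : (Fin 4 → K) →ₗ[K] (Fin 4 → K) :=
      LinearMap.snd K _ _ ∘ₗ e.symm.toLinearMap ∘ₗ W.subtype ∘ₗ p'.symm.toLinearMap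
    have hm : ∀ x, e (x, (LinearMap.toMatrix' m).mulVec x) ∈ W := by
      intro x
      have h1 : e (x, (LinearMap.toMatrix' m).mulVec x) = p'.symm x := by
        rw [LinearMap.toMatrix'_mulVec, ← LinearEquiv.eq_symm_apply]
        exact Prod.ext (p'.apply_symm_apply x).symm rfl
      rw [h1]
      exact (p'.symm x).2
    have hsymm : (LinearMap.toMatrix' m).IsSymm := by
      ext r s
      have h1 := (hB _ _ _ _).1 (hT.2 W hW _ (hm (Pi.single r 1)) _ (hm (Pi.single s 1)))
      simpa using h1.symm
    -- A kernel vector of a singular difference of matrices is the first coordinate of a nonzero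
    -- common vector of `W` and the `k`-th graph.
    obtain ⟨k, hk⟩ := exists_det_sub_symFamily_eq_zero hK hsymm
    obtain ⟨x, hx0, hx⟩ := Matrix.exists_mulVec_eq_zero_iff.2 hk
    rw [Matrix.sub_mulVec, sub_eq_zero] at hx
    have h1 : e (x, (LinearMap.toMatrix' m).mulVec x) ∈ W ⊓ LinearMap.range (f (some k)) :=
      ⟨hm x, x, by rw [hsome, hx]⟩
    rw [hWd, mem_bot, e.map_eq_zero_iff] at h1
    exact hx0 (congrArg Prod.fst h1)
  · exact (Nat.card_range_of_injective hrinj).trans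
      (by rw [Nat.card_eq_fintype_card, Fintype.card_option, Fintype.card_fin])

theorem charP_two_of_even_card [Finite K] (h : Even (Nat.card K)) : CharP K 2 := by
  have := Fintype.ofFinite K
  rw [Nat.card_eq_fintype_card] at h
  exact ringChar.eq_iff.1 (FiniteField.even_card_iff_char_two.2 (Nat.even_iff.1 h))

/-- For `q > 2` the form is the polar form of a quadratic form of plus type, where the triality
construction applies. For `q = 2` the explicit five solids have the required number `8 - 4 + 1`. -/
theorem IsSpSpace.exists_maximal_spread [Finite K] {B : LinearMap.BilinForm K V}
    (h : IsSpSpace 4 B) (hq : Even (Nat.card K)) :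
    ∃ S : Set (Submodule K V), Maximal (IsSymplecticPartialSpread 4 B) S ∧
      (S.ncard : ℤ) = (Nat.card K : ℤ) ^ 3 - (Nat.card K : ℤ) ^ 2 + 1 := by
  have := charP_two_of_even_card hq
  have h1 : 1 < Nat.card K := Finite.one_lt_card
  rcases Nat.lt_or_ge 2 (Nat.card K) with h2 | h2
  · obtain ⟨Q, rfl, hQ⟩ := h.exists_quadraticForm
    obtain ⟨τ⟩ := hQ.nonempty_triality
    obtain ⟨M, hM⟩ := τ.type_rotation
    obtain ⟨Ω, a, -, hΩ, ha⟩ := hQ.exists_desarguesian h2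
    refine ⟨τ.image (exchange Q Ω a), maximal_symplectic_image_exchange hQ hM hΩ ha, ?_⟩
    rw [τ.ncard_image (exchange_points hΩ ha.isSingularPoint),
      ncard_exchange hQ hΩ ha.isSingularPoint ha.notMem]
  · have h3 : Nat.card K = 2 := by omega
    have hK : ∀ x : K, x = 0 ∨ x = 1 := by
      have h4 : ({0, 1} : Set K) = Set.univ := Set.eq_of_subset_of_ncard_le (Set.subset_univ _)
        (by rw [Set.ncard_univ, h3, Set.ncard_pair zero_ne_one])
      intro x
      exact h4.ge (Set.mem_univ x)
    obtain ⟨S, hS, hcard⟩ := h.exists_maximal_of_card_two hK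
    refine ⟨S, hS, ?_⟩
    rw [hcard, h3]
    norm_num

end SymplecticSpreads

end PolarSpread

theorem mainTheorem5 {K : Type*} [Field K] [Finite K] {V : Type*} [AddCommGroup V] [Module K V]
    (q : ℕ) (hq : Nat.card K = q) :
    (∀ Q : QuadraticForm K V, PolarSpread.IsOPlusSpace 4 Q →
      Nonempty (PolarSpread.Triality Q) ∧
      (2 < q →
        ∀ (τ : PolarSpread.Triality Q) (Ω : Set (Submodule K V)) (a : Submodule K V),
          PolarSpread.IsOvoid Q Ω → PolarSpread.IsExchangePoint Q Ω a →
            Maximal (PolarSpread.IsOrthogonalPartialSpread 4 Q)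
              (τ.image (PolarSpread.exchange Q Ω a)) ∧
            ((τ.image (PolarSpread.exchange Q Ω a)).ncard : ℤ) = (q : ℤ) ^ 3 - (q : ℤ) ^ 2 + 1 ∧
            (Even q →
              Maximal (PolarSpread.IsSymplecticPartialSpread 4 Q.polarBilin)
                (τ.image (PolarSpread.exchange Q Ω a)))) ∧
      (2 < q → Even q →
        ∃ (τ : PolarSpread.Triality Q) (Ω : Set (Submodule K V)) (a : Submodule K V),
          PolarSpread.IsDesarguesianOvoid Q Ω ∧ PolarSpread.IsOvoid Q Ω ∧
          PolarSpread.IsExchangePoint Q Ω a ∧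
          Maximal (PolarSpread.IsOrthogonalPartialSpread 4 Q)
            (τ.image (PolarSpread.exchange Q Ω a)) ∧
          Maximal (PolarSpread.IsSymplecticPartialSpread 4 Q.polarBilin)
            (τ.image (PolarSpread.exchange Q Ω a)) ∧
          ((τ.image (PolarSpread.exchange Q Ω a)).ncard : ℤ) =
            (q : ℤ) ^ 3 - (q : ℤ) ^ 2 + 1)) ∧
    (Even q → ∀ B : LinearMap.BilinForm K V, PolarSpread.IsSpSpace 4 B →
      ∃ S : Set (Submodule K V),
        Maximal (PolarSpread.IsSymplecticPartialSpread 4 B) S ∧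
        (S.ncard : ℤ) = (q : ℤ) ^ 3 - (q : ℤ) ^ 2 + 1) := by
  subst hq
  refine ⟨fun Q hQ => ?_, fun hq B hB => ?_⟩
  · have : FiniteDimensional K V := Module.finite_of_finrank_pos (by rw [hQ.finrank_eq]; norm_num)
    have key : ∀ (τ : PolarSpread.Triality Q) (Ω : Set (Submodule K V)) (a : Submodule K V),
          PolarSpread.IsOvoid Q Ω → PolarSpread.IsExchangePoint Q Ω a →
            Maximal (PolarSpread.IsOrthogonalPartialSpread 4 Q)
              (τ.image (PolarSpread.exchange Q Ω a)) ∧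
            ((τ.image (PolarSpread.exchange Q Ω a)).ncard : ℤ) =
              (Nat.card K : ℤ) ^ 3 - (Nat.card K : ℤ) ^ 2 + 1 ∧
            (Even (Nat.card K) →
              Maximal (PolarSpread.IsSymplecticPartialSpread 4 Q.polarBilin)
                (τ.image (PolarSpread.exchange Q Ω a))) := by
      intro τ Ω a hΩ ha
      obtain ⟨M, hM⟩ := τ.type_rotation
      refine ⟨PolarSpread.maximal_orthogonal_image_exchange hQ hM hΩ ha, ?_, fun hq => ?_⟩
      · rw [τ.ncard_image (PolarSpread.exchange_points hΩ ha.isSingularPoint),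
          PolarSpread.ncard_exchange hQ hΩ ha.isSingularPoint ha.notMem]
      · have := PolarSpread.charP_two_of_even_card hq
        exact PolarSpread.maximal_symplectic_image_exchange hQ hM hΩ ha
    refine ⟨hQ.nonempty_triality, fun _ => key, fun h2 hq => ?_⟩
    have := PolarSpread.charP_two_of_even_card hq
    obtain ⟨τ⟩ := hQ.nonempty_triality
    obtain ⟨Ω, a, hdes, hΩ, ha⟩ := hQ.exists_desarguesian h2
    obtain ⟨h3, h4, h5⟩ := key τ Ω a hΩ ha
    exact ⟨τ, Ω, a, hdes, hΩ, ha, h3, h5 hq, h4⟩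
  · have : FiniteDimensional K V := Module.finite_of_finrank_pos (by rw [hB.finrank_eq]; norm_num)
    exact hB.exists_maximal_spread hq
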